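/- Let $k$ be a field of characteristic $0$. Graphs are finite, possibly disconnected, with multiple edges and loops allowed, and all vertices of valence at least $3$. An orientation of a graph is an ordering of its vertices together with a direction of each edge, up to sign: permuting the vertices multiplies it by the sign of the permutation, and reversing an edge multiplies it by $-1$. Let $\mathcal{HG}$ be the $k$-vector space spanned by isomorphism classes of oriented graphs modulo $(G,-\mathrm{or})=-(G,\mathrm{or})$, graded by the number of vertices, with product $G\cdot H$ the disjoint union (the vertices of $G$ ordered before those of $H$). Let $\mathcal G$, $\mathcal{HC}$ and $\mathcal C$ be the subspaces of $\mathcal{HG}$ spanned by the connected graphs, by the graphs with a cut vertex, and by the connected graphs with a cut vertex, where a cut vertex is a vertex whose deletion disconnects the component containing it. For half-edges $x,y$ of $G$ ending at vertices $v\ne w$, let $G_{xy}$ be the graph obtained by cutting the edges containing $x$ and $y$ in half, gluing $x$ to $y$ and, if $y\neq\bar x$, the other halves $\bar x$ to $\bar y$, and collapsing the edge $xy$ to a point. It is oriented as follows: if the edges of $x$ and $y$ are directed so that $x$ is initial and $y$ is terminal, and $v,w$ are the first two vertices, then the merged vertex comes first, the other vertices keep their order, and the new edge is directed from $\bar y$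 to $\bar x$. If $x$ and $y$ end at the same vertex, put $G_{xy}=0$. Define the bracket on $\mathcal{HG}$ by $$[G,H]=\sum_{x\in G,\;y\in H}(G\cdot H)_{xy}.$$ A pair $\{x,y\}$ of half-edges of $G$ is separating if $G_{xy}$ has more components than $G$. For connected $G$ define the cobracket $\theta\colon\mathcal{HG}\to\mathcal{HG}\otimes\mathcal{HG}$ by $$\theta(G)=\sum_{\{x,y\}\text{ separating}}A\otimes B+(-1)^{ab}B\otimes A,$$ where $G_{xy}=A\cdot B$ with $A$, $B$ connected having $a$ and $b$ vertices; for a disconnected graph, $\theta(G)$ is the corresponding sum over all separating pairs and over all distributions (with Koszul signs) of the components of $G_{xy}$ over the two tensor factors for which the two components created by the separation lie in different factors. Theorem. The bracket and the cobracket are well defined on $\mathcal{HG}$. The natural map $\mathcal G/\mathcal C\to\mathcal{HG}/\mathcal{HC}$ is injective, and the bracket and cobracket of $\mathcal{HG}$ descend to $\mathcal G/\mathcal C$: there are a bilinear map $[\cdot,\cdot]$ on $\mathcal G/\mathcal C$ and a linear map $\theta\colon\mathcal G/\mathcal C\to\mathcal G/\mathcal C\otimes\mathcal G/\mathcal C$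 whose values on classes of elements of $\mathcal G$ agree, in $\mathcal{HG}/\mathcal{HC}$ and in $\mathcal{HG}/\mathcal{HC}\otimes\mathcal{HG}/\mathcal{HC}$ respectively, with the bracket and the cobracket of $\mathcal{HG}$. They make $\mathcal G/\mathcal C$, which is the direct sum of its parts of degree $n$ (spanned by the connected graphs with $n$ vertices), a compatible graded Lie bialgebra with bracket and cobracket of degree $-1$. That is, for homogeneous $X,Y,Z$ of degrees $p,q,r$: 1. $[X,Y]$ has degree $p+q-1$, and $[X,Y]=(-1)^{pq}[Y,X]$; 2. $[[X,Y],Z]+(-1)^{p(q+r)}[[Y,Z],X]+(-1)^{r(p+q)}[[Z,X],Y]=0$; 3. $\theta(X)$ has total degree $p-1$ and is invariant under $A\otimes B\mapsto(-1)^{ab}B\otimes A$, where $a,b$ denote the degrees of $A,B$; 4. $(1+\zeta+\zeta^2)(\theta\otimes 1)\theta(X)=0$, where $\zeta(A\otimes B\otimes C)=(-1)^{a(b+c)}B\otimes C\otimes A$ for $A,B,C$ of degrees $a,b,c$; 5. $\theta[X,Y]+[\theta(X),Y]+(-1)^{p}[X,\theta(Y)]=0$, where $[A\otimes B,Y]=(-1)^{a}A\otimes[B,Y]+(-1)^{bq}[A,Y]\otimes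 B$ and $[X,A\otimes B]=[X,A]\otimes B+(-1)^{(p+1)a}A\otimes[X,B]$. (Equivalently to 1 and 2, $\{X,Y\}=(-1)^{p}[X,Y]$ is an ordinary graded Lie bracket for the shifted degree $\deg-1$.) -/

import Mathlib

open scoped TensorProduct

/-! ### Oriented graphs -/

/-- An oriented finite graph (multiple edges and loops allowed, possibly disconnected or empty), all
of whose vertices have valence at least three.  `H` is the set of half-edges, `bar h` is the other
half of the edge containing `h`, and `vert h` is the vertex at which `h` terminates.  The
orientation data are an ordering of the vertices and a direction of every edge: `dir h = 1` means
that `h` is the initial half of its edge, `dir h = -1` that it is the terminal half (so `dir_bar`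
says that every edge has two distinct halves, one initial and one terminal). -/
structure OGraph : Type 1 where
  V : Type
  H : Type
  [fintypeV : Fintype V]
  [linearOrderV : LinearOrder V]
  [fintypeH : Fintype H]
  [decidableEqH : DecidableEq H]
  bar : H → H
  bar_bar : ∀ h, bar (bar h) = h
  dir : H → ℤˣ
  dir_bar : ∀ h, dir (bar h) = -dir h
  vert : H → V
  three_le_valence : ∀ v, 3 ≤ (Finset.univ.filter fun h => vert h = v).card

attribute [instance] OGraph.fintypeV OGraph.linearOrderV OGraph.fintypeH OGraph.decidableEqH

namespace OGraph

/-- The number of vertices: the degree of a graph. -/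
def degree (G : OGraph) : ℕ := Fintype.card G.V

/-- The simple graph recording which distinct vertices are joined by an edge. -/
def toSimple (G : OGraph) : SimpleGraph G.V where
  Adj u v := u ≠ v ∧ ∃ h, G.vert h = u ∧ G.vert (G.bar h) = v
  symm := ⟨by
    rintro u v ⟨huv, h, rfl, rfl⟩
    exact ⟨huv.symm, G.bar h, rfl, by rw [G.bar_bar]⟩⟩
  loopless := ⟨fun _ h => h.1 rfl⟩

/-- A graph is connected if it is nonempty and any two of its vertices are joined by a path. -/
def IsConnected (G : OGraph) : Prop := G.toSimple.Connected

/-- The number of connected components. -/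
noncomputable def numComponents (G : OGraph) : ℕ := Nat.card G.toSimple.ConnectedComponent

/-- `c` is a cut vertex: deleting `c` disconnects the component of the graph containing `c`, i.e.
some two other vertices are joined by a path in the graph, but by no path avoiding `c`. -/
def IsCutVertex (G : OGraph) (c : G.V) : Prop :=
  ∃ a b : {u : G.V | u ≠ c}, G.toSimple.Reachable a b ∧
    ¬ (G.toSimple.induce {u : G.V | u ≠ c}).Reachable a b

def HasCutVertex (G : OGraph) : Prop := ∃ c, G.IsCutVertex c

/-- An isomorphism of the underlying (unoriented) graphs. -/
structure Iso (G G' : OGraph) where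
  onV : G.V ≃ G'.V
  onH : G.H ≃ G'.H
  bar_onH : ∀ h, G'.bar (onH h) = onH (G.bar h)
  vert_onH : ∀ h, G'.vert (onH h) = onV (G.vert h)

/-- The effect of an isomorphism on orientations: the sign of the permutation of the ordered
vertices (computed by counting inversions), times `-1` for every edge whose direction is
reversed. -/
def Iso.sign {G G' : OGraph} (f : Iso G G') : ℤˣ :=
  (∏ p ∈ (Finset.univ : Finset (G.V × G.V)).filter (fun p => p.1 < p.2),
      if f.onV p.1 < f.onV p.2 then 1 else -1) *
    ∏ h ∈ (Finset.univ : Finset G.H).filter (fun h => G.dir h = 1), G'.dir (f.onH h)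

theorem bar_eq_iff (G : OGraph) {a b : G.H} : G.bar a = b ↔ a = G.bar b :=
  ⟨fun h => by rw [← h, G.bar_bar], fun h => by rw [h, G.bar_bar]⟩

theorem bar_ne (G : OGraph) (h : G.H) : G.bar h ≠ h := fun e => by
  have := G.dir_bar h
  rw [e] at this
  rcases Int.units_eq_one_or (G.dir h) with h1 | h1 <;> rw [h1] at this <;> revert this <;> decide

/-- The disjoint union; the vertices of `G` come before the vertices of `K`. -/
def disjUnion (G K : OGraph) : OGraph where
  V := G.V ⊕ₗ K.V
  H := G.H ⊕ K.H
  bar := Sum.map G.bar K.bar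
  bar_bar := by rintro (h | h) <;> simp [G.bar_bar, K.bar_bar]
  dir := Sum.elim G.dir K.dir
  dir_bar := by rintro (h | h) <;> simp [G.dir_bar, K.dir_bar]
  vert h := toLex (Sum.map G.vert K.vert h)
  three_le_valence := by
    intro v
    rcases hv : ofLex v with u | u
    · refine (G.three_le_valence u).trans (Finset.card_le_card_of_injOn Sum.inl ?_
        Sum.inl_injective.injOn)
      intro h hh
      have : G.vert h = u := by simpa using hh
      simp [this, ← hv]
    · refine (K.three_le_valence u).trans (Finset.card_le_card_of_injOn Sum.inr ?_
        Sum.inr_injective.injOn)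
      intro h hh
      have : K.vert h = u := by simpa using hh
      simp [this, ← hv]

/-- Contraction of two half-edges `x` and `y` that terminate at different vertices `v` and `w`: the
edges containing `x` and `y` are cut in half, `x` is glued to `y` and (if `y` is not the other half
of `x`) `bar x` is glued to `bar y`, and the new edge `xy` is collapsed to a point.  Thus `x` and `y`
disappear, and the half-edges at `w` are moved to `v`, which represents the merged vertex.
The edge formed by `bar x` and `bar y` is directed from `bar y` to `bar x`. -/
def contract (G : OGraph) (x y : G.H) (hxy : G.vert x ≠ G.vert y) : OGraph where
  V := {u : G.V // u ≠ G.vert y}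
  H := {h : G.H // h ≠ x ∧ h ≠ y}
  bar h := ⟨if h.1 = G.bar x then G.bar y else if h.1 = G.bar y then G.bar x else G.bar h.1, by
    obtain ⟨h, hx, hy⟩ := h
    have := G.bar_ne x
    have := G.bar_ne y
    have := @G.bar_eq_iff h x
    have := @G.bar_eq_iff h y
    have := @G.bar_eq_iff x y
    grind⟩
  bar_bar := by
    rintro ⟨h, hx, hy⟩
    have := @G.bar_eq_iff h x
    have := @G.bar_eq_iff h y
    have := G.bar_bar
    grind
  dir h := if h.1 = G.bar x then -1 else if h.1 = G.bar y then 1 else G.dir h.1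
  dir_bar := by
    rintro ⟨h, hx, hy⟩
    have := @G.bar_eq_iff h x
    have := @G.bar_eq_iff h y
    have := @G.bar_eq_iff x y
    have := G.bar_bar
    have := G.dir_bar h
    have : -(-1 : ℤˣ) = 1 := by decide
    grind
  vert h := if hw : G.vert h.1 = G.vert y then ⟨G.vert x, hxy⟩ else ⟨G.vert h.1, hw⟩
  three_le_valence := by
    rintro ⟨u, hu⟩
    by_cases hux : u = G.vert x
    · -- at the merged vertex at least two half-edges survive from each of the two vertices
      have h1 := G.three_le_valence (G.vert x)
      have h2 := G.three_le_valence (G.vert y)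
      have e1 := Finset.pred_card_le_card_erase (s := Finset.univ.filter
        fun h => G.vert h = G.vert x) (a := x)
      have e2 := Finset.pred_card_le_card_erase (s := Finset.univ.filter
        fun h => G.vert h = G.vert y) (a := y)
      have hd : Disjoint ((Finset.univ.filter fun h => G.vert h = G.vert x).erase x)
          ((Finset.univ.filter fun h => G.vert h = G.vert y).erase y) := by
        rw [Finset.disjoint_left]
        intro h ha hb
        simp only [Finset.mem_erase, Finset.mem_filter, Finset.mem_univ, true_and] at ha hb
        exact hxy (ha.2.symm.trans hb.2)
      have hc := Finset.card_union_of_disjoint hd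
      refine le_trans (b := (((Finset.univ.filter fun h => G.vert h = G.vert x).erase x) ∪
          ((Finset.univ.filter fun h => G.vert h = G.vert y).erase y)).card) (by omega) ?_
      refine Finset.card_le_card_of_surjOn Subtype.val ?_
      intro h hh
      simp only [Finset.coe_union, Finset.coe_erase, Set.mem_union, Set.mem_sdiff,
        Finset.coe_filter, Finset.mem_univ, true_and, Set.mem_ofPred_eq,
        Set.mem_singleton_iff] at hh
      refine ⟨⟨h, ?_, ?_⟩, ?_, rfl⟩
      · grind
      · grind
      · simp only [Finset.coe_filter, Finset.mem_univ, true_and, Set.mem_ofPred_eq]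
        grind
    · refine (G.three_le_valence u).trans (Finset.card_le_card_of_surjOn Subtype.val ?_)
      intro h hh
      simp only [Finset.coe_filter, Finset.mem_univ, true_and, Set.mem_ofPred_eq] at hh
      refine ⟨⟨h, ?_, ?_⟩, ?_, rfl⟩
      · grind
      · grind
      · simp only [Finset.coe_filter, Finset.mem_univ, true_and, Set.mem_ofPred_eq]
        grind

/-- The sign relating the orientation of `G` to that of `contract G x y`.  Directing the edges
containing `x` and `y` so that `x` is initial and `y` is terminal multiplies the orientation by the
first factor; the edge `xy` is then directed from `x` to `y`, the other one from `bar y` to `bar x`.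
Reordering the vertices so that `v = vert x` comes first and `w = vert y` second, merging them into
the first vertex, and moving that back to the original place of `v` gives
the second factor: minus the parity of the number of vertices that precede `w`. -/
def contractSign (G : OGraph) (x y : G.H) : ℤˣ :=
  (if y = G.bar x then G.dir x else -(G.dir x * G.dir y)) *
    -(-1) ^ (Finset.univ.filter fun u => u < G.vert y).card

/-- A set of vertices is closed if it is a union of connected components. -/
def IsClosed (G : OGraph) (S : Set G.V) : Prop := ∀ h, G.vert (G.bar h) ∈ S ↔ G.vert h ∈ S

theorem IsClosed.compl {G : OGraph} {S : Set G.V} (hS : G.IsClosed S) : G.IsClosed Sᶜ :=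
  fun h => not_congr (hS h)

open Classical in
/-- The part of the graph lying over a union of connected components. -/
noncomputable def restrict (G : OGraph) (S : Set G.V) (hS : G.IsClosed S) : OGraph where
  V := {v : G.V // v ∈ S}
  H := {h : G.H // G.vert h ∈ S}
  bar h := ⟨G.bar h.1, (hS h.1).2 h.2⟩
  bar_bar h := Subtype.ext (G.bar_bar h.1)
  dir h := G.dir h.1
  dir_bar h := G.dir_bar h.1
  vert h := ⟨G.vert h.1, h.2⟩
  three_le_valence := by
    rintro ⟨u, hu⟩
    refine (G.three_le_valence u).trans (Finset.card_le_card_of_surjOn Subtype.val ?_)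
    intro h hh
    have hv : G.vert h = u := by simpa using hh
    exact ⟨⟨h, hv ▸ hu⟩, by simpa using hv, rfl⟩

open Classical in
/-- The sign of the shuffle that moves the vertices in `S` before those not in `S`: as oriented
graphs, `G` is `shuffleSign G S` times the disjoint union of its parts over `S` and `Sᶜ`. -/
noncomputable def shuffleSign (G : OGraph) (S : Set G.V) : ℤˣ :=
  (-1) ^ (Finset.univ.filter fun p : G.V × G.V => p.1 < p.2 ∧ p.1 ∉ S ∧ p.2 ∈ S).card

end OGraph

/-! ### The space `HG` of all oriented graphs, its bracket and its cobracket -/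

section HG

universe u

variable (k : Type u) [Field k]

/-- The relations identifying isomorphic graphs up to the sign with which the isomorphism acts on
orientations. In particular reversing the orientation of a graph multiplies it by `-1`. -/
noncomputable def isoRelations : Submodule k (OGraph →₀ k) :=
  Submodule.span k {r | ∃ (G G' : OGraph) (f : OGraph.Iso G G'),
    r = Finsupp.single G' 1 - f.sign • Finsupp.single G 1}

/-- The vector space `HG` spanned by all oriented graphs. -/
noncomputable abbrev HG : Type (max 1 u) := (OGraph →₀ k) ⧸ isoRelations k

/-- The element of `HG` given by an oriented graph. -/
noncomputable def graphClass (G : OGraph) : HG k := (isoRelations k).mkQ (Finsupp.single G 1)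

/-- The element `G_{xy}` of `HG` obtained by contracting the half-edges `x` and `y`.  If `x` and `y`
terminate at the same vertex, then the edge `xy` is a loop and `G_{xy}` is zero. -/
noncomputable def contraction (G : OGraph) (x y : G.H) : HG k :=
  if h : G.vert x ≠ G.vert y then G.contractSign x y • graphClass k (G.contract x y h) else 0

/-- `[G, K]`: the sum of all graphs obtained by contracting a half-edge of `G` with a half-edge of
`K` in the product `G · K`. -/
noncomputable def graphBracket (G K : OGraph) : HG k :=
  ∑ x : G.H, ∑ y : K.H, contraction k (G.disjUnion K) (Sum.inl x) (Sum.inr y)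

/-- `A ⊗ B`, where the oriented graph `G = A · B` is the disjoint union of its part `A` over `S` and
its part `B` over the complement of `S` (and `0` if `S` is not a union of components). -/
noncomputable def splitting (G : OGraph) (S : Set G.V) : HG k ⊗[k] HG k :=
  open Classical in
  if hS : G.IsClosed S then
    G.shuffleSign S • (graphClass k (G.restrict S hS) ⊗ₜ[k] graphClass k (G.restrict Sᶜ hS.compl))
  else 0

/-- A pair of half-edges (at different vertices) is separating if contracting it increases the
number of components. -/
def OGraph.IsSeparating (G : OGraph) (x y : G.H) : Prop :=
  ∃ h : G.vert x ≠ G.vert y, G.numComponents < (G.contract x y h).numComponents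

/-- For a separating pair `{x, y}`: the sum of all `± A ⊗ B`, where `G_{xy} = ± A · B` and the two
components of `G_{xy}` into which the component of `G` containing `x`, `y` has been separated lie in
different factors.  These two are the component of the merged vertex and the component of the
edge formed by `bar x` and `bar y`.  If `G` is connected there are
exactly two summands, `A ⊗ B` and `(-1)^{ab} B ⊗ A`, where `a` and `b` are the numbers of vertices of
`A` and `B`. -/
noncomputable def separation (G : OGraph) (x y : G.H) : HG k ⊗[k] HG k :=
  open Classical in
  if h : G.vert x ≠ G.vert y then
    G.contractSign x y •
      ∑ S : Set (G.contract x y h).V,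
        if ∃ z : (G.contract x y h).H, z.1 = G.bar x ∧
            Xor ((⟨G.vert x, h⟩ : (G.contract x y h).V) ∈ S) ((G.contract x y h).vert z ∈ S)
        then splitting k (G.contract x y h) S else 0
  else 0

/-- `θ(G)`: the sum of `separation G x y` over all unordered separating pairs `{x, y}`.  The sum over
ordered pairs counts every unordered pair twice. -/
noncomputable def graphCobracket (G : OGraph) : HG k ⊗[k] HG k :=
  open Classical in
  (2 : k)⁻¹ • ∑ x : G.H, ∑ y : G.H, if G.IsSeparating x y then separation k G x y else 0

variable {k}

/-- `B` is the bracket of `HG`: the bilinear extension of `graphBracket`. -/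
noncomputable def IsHGBracket (B : HG k →ₗ[k] HG k →ₗ[k] HG k) : Prop :=
  ∀ G K : OGraph, B (graphClass k G) (graphClass k K) = graphBracket k G K

/-- `Θ` is the cobracket of `HG`: the linear extension of `graphCobracket`. -/
noncomputable def IsHGCobracket (Θ : HG k →ₗ[k] HG k ⊗[k] HG k) : Prop :=
  ∀ G : OGraph, Θ (graphClass k G) = graphCobracket k G

variable (k)

/-! ### The quotient `G / C` -/

/-- The subspace `G` of `HG` spanned by connected graphs. -/
noncomputable def connectedPart : Submodule k (HG k) :=
  Submodule.span k {X | ∃ G : OGraph, G.IsConnected ∧ X = graphClass k G}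

/-- The subspace `HC` of `HG` spanned by graphs with a cut vertex. -/
noncomputable def cutPart : Submodule k (HG k) :=
  Submodule.span k {X | ∃ G : OGraph, G.HasCutVertex ∧ X = graphClass k G}

/-- The subspace `C` of `HG` spanned by connected graphs with a cut vertex. -/
noncomputable def connectedCutPart : Submodule k (HG k) :=
  Submodule.span k {X | ∃ G : OGraph, G.IsConnected ∧ G.HasCutVertex ∧ X = graphClass k G}

/-- The quotient `G / C`. -/
noncomputable abbrev GModC : Type (max 1 u) :=
  connectedPart k ⧸ (connectedCutPart k).submoduleOf (connectedPart k)

/-- The projection of `G` onto `G / C`. -/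
noncomputable def toGModC : connectedPart k →ₗ[k] GModC k :=
  ((connectedCutPart k).submoduleOf (connectedPart k)).mkQ

/-- The natural map from `G / C` to `HG / HC` induced by the inclusion of `G` in `HG`. -/
noncomputable def inclGModC : GModC k →ₗ[k] HG k ⧸ cutPart k :=
  Submodule.mapQ _ _ (connectedPart k).subtype
    (Submodule.comap_mono (Submodule.span_mono
      (by rintro X ⟨G, -, h, rfl⟩; exact ⟨G, h, rfl⟩)))

/-- The part of degree `n` of `G / C`, spanned by the connected graphs with `n` vertices. -/
noncomputable def gradeGModC (n : ℤ) : Submodule k (GModC k) :=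
  Submodule.span k {X | ∃ (G : OGraph) (hG : G.IsConnected), (G.degree : ℤ) = n ∧
    X = toGModC k ⟨graphClass k G, Submodule.subset_span ⟨G, hG, rfl⟩⟩}

end HG

/-! ### Graded Lie bialgebras -/

section GradedLieBialgebra

variable {k V : Type*} [Field k] [AddCommGroup V] [Module k V] {𝒱 : ℤ → Submodule k V}

/-- The decomposition of a graded vector space as the direct sum of its graded pieces. -/
noncomputable def gradingEquiv (h : DirectSum.IsInternal 𝒱) :
    V ≃ₗ[k] DirectSum ℤ (fun n => 𝒱 n) :=
  (LinearEquiv.ofBijective (DirectSum.coeLinearMap 𝒱)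
    (show Function.Bijective (DirectSum.coeLinearMap 𝒱) from h)).symm

theorem gradingEquiv_apply (h : DirectSum.IsInternal 𝒱) {m : ℤ} {X : V} (hX : X ∈ 𝒱 m) :
    gradingEquiv h X = DirectSum.lof k ℤ (fun n => 𝒱 n) m ⟨X, hX⟩ := by
  rw [gradingEquiv, LinearEquiv.symm_apply_eq]
  simp

/-- For a graded vector space, the operator which multiplies elements of degree `m` by
`(-1)^(n * m)`. -/
noncomputable def koszulSign (h : DirectSum.IsInternal 𝒱) (n : ℤ) : V →ₗ[k] V :=
  DirectSum.toModule k ℤ V (fun m => (n * m).negOnePow • (𝒱 m).subtype) ∘ₗ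
    (gradingEquiv h).toLinearMap

theorem koszulSign_apply (h : DirectSum.IsInternal 𝒱) (n : ℤ) {m : ℤ} {X : V} (hX : X ∈ 𝒱 m) :
    koszulSign h n X = (n * m).negOnePow • X := by
  simp only [koszulSign, LinearMap.comp_apply, LinearEquiv.coe_coe, gradingEquiv_apply h hX,
    DirectSum.toModule_lof]
  rfl

/-- The graded flip: `A ⊗ B ↦ (-1)^(a * b) B ⊗ A` for `A`, `B` of degrees `a`, `b`. -/
noncomputable def koszulSwap (h : DirectSum.IsInternal 𝒱) : V ⊗[k] V →ₗ[k] V ⊗[k] V :=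
  TensorProduct.lift
    (DirectSum.toModule k ℤ (V →ₗ[k] V ⊗[k] V)
        (fun a => ((TensorProduct.mk k V V).flip.compl₂ (koszulSign h a)) ∘ₗ (𝒱 a).subtype) ∘ₗ
      (gradingEquiv h).toLinearMap)

theorem koszulSwap_tmul (h : DirectSum.IsInternal 𝒱) {a b : ℤ} {A B : V} (hA : A ∈ 𝒱 a)
    (hB : B ∈ 𝒱 b) : koszulSwap h (A ⊗ₜ[k] B) = (a * b).negOnePow • (B ⊗ₜ[k] A) := by
  simp only [koszulSwap, TensorProduct.lift.tmul, LinearMap.comp_apply, LinearEquiv.coe_coe,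
    gradingEquiv_apply h hA, DirectSum.toModule_lof]
  simp [koszulSign_apply h a hB]

/-- The graded cyclic permutation: `A ⊗ B ⊗ C ↦ (-1)^(a * (b + c)) B ⊗ C ⊗ A` for `A`, `B`, `C` of
degrees `a`, `b`, `c`. -/
noncomputable def koszulCycle (h : DirectSum.IsInternal 𝒱) :
    V ⊗[k] (V ⊗[k] V) →ₗ[k] V ⊗[k] (V ⊗[k] V) :=
  (TensorProduct.map LinearMap.id (koszulSwap h)) ∘ₗ
    (TensorProduct.assoc k V V V).toLinearMap ∘ₗ
    (TensorProduct.map (koszulSwap h) LinearMap.id) ∘ₗ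
    (TensorProduct.assoc k V V V).symm.toLinearMap

/-- Given the bracket `[·, ·]` of degree `-1` and an element `Y` of degree `q`, the map
`A ⊗ B ↦ [A ⊗ B, Y] = (-1)^a A ⊗ [B, Y] + (-1)^(b * q) [A, Y] ⊗ B`
for `A`, `B` of degrees `a`, `b`. -/
noncomputable def bracketTensorLeft (h : DirectSum.IsInternal 𝒱) (br : V →ₗ[k] V →ₗ[k] V)
    (q : ℤ) (Y : V) : V ⊗[k] V →ₗ[k] V ⊗[k] V :=
  TensorProduct.map (koszulSign h 1) (br.flip Y) + TensorProduct.map (br.flip Y) (koszulSign h q)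

/-- Given the bracket `[·, ·]` of degree `-1` and an element `X` of degree `p`, the map
`A ⊗ B ↦ [X, A ⊗ B] = [X, A] ⊗ B + (-1)^((p + 1) * a) A ⊗ [X, B]`
for `A`, `B` of degrees `a`, `b`. -/
noncomputable def bracketTensorRight (h : DirectSum.IsInternal 𝒱) (br : V →ₗ[k] V →ₗ[k] V)
    (p : ℤ) (X : V) : V ⊗[k] V →ₗ[k] V ⊗[k] V :=
  TensorProduct.map (br X) LinearMap.id + TensorProduct.map (koszulSign h (p + 1)) (br X)

/-- `(V, br, θ)` is a compatible graded Lie bialgebra with respect to the grading `𝒱`, in the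
convention where the bracket and the cobracket have degree `-1`: they are graded symmetric and
satisfy the Jacobi and the co-Jacobi identities, with signs given by the Koszul rule.
(Equivalently, `{X, Y} = (-1)^(deg X) [X, Y]` is an ordinary graded Lie bracket, antisymmetric and
of degree zero, for the shifted degree `deg X - 1`; dually for the cobracket.) -/
structure IsGradedLieBialgebra (𝒱 : ℤ → Submodule k V) (br : V →ₗ[k] V →ₗ[k] V)
    (θ : V →ₗ[k] V ⊗[k] V) : Prop where
  /-- `V` is the direct sum of its graded pieces. -/
  internal : DirectSum.IsInternal 𝒱
  bracket_degree : ∀ p q : ℤ, ∀ X ∈ 𝒱 p, ∀ Y ∈ 𝒱 q, br X Y ∈ 𝒱 (p + q - 1)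
  bracket_symm : ∀ p q : ℤ, ∀ X ∈ 𝒱 p, ∀ Y ∈ 𝒱 q, br X Y = (p * q).negOnePow • br Y X
  jacobi : ∀ p q r : ℤ, ∀ X ∈ 𝒱 p, ∀ Y ∈ 𝒱 q, ∀ Z ∈ 𝒱 r,
    br (br X Y) Z + (p * (q + r)).negOnePow • br (br Y Z) X +
      (r * (p + q)).negOnePow • br (br Z X) Y = 0
  cobracket_degree : ∀ n : ℤ, ∀ X ∈ 𝒱 n,
    θ X ∈ ⨆ a : ℤ, LinearMap.range (TensorProduct.map (𝒱 a).subtype (𝒱 (n - 1 - a)).subtype)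
  cobracket_symm : ∀ X, koszulSwap internal (θ X) = θ X
  cojacobi : ∀ X,
    let T := TensorProduct.assoc k V V V (TensorProduct.map θ LinearMap.id (θ X))
    T + koszulCycle internal T + koszulCycle internal (koszulCycle internal T) = 0
  compatible : ∀ p q : ℤ, ∀ X ∈ 𝒱 p, ∀ Y ∈ 𝒱 q,
    θ (br X Y) + bracketTensorLeft internal br q Y (θ X) +
      p.negOnePow • bracketTensorRight internal br p X (θ Y) = 0

end GradedLieBialgebra

/-! Everything rests on one sign rule. Write `contr` for the contraction of two half-edges that do
not form an edge (zero if they do, or if they end at the same vertex), and `contr₂` for two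
successive contractions. Contraction is natural under isomorphisms and symmetric in its two
half-edges, and two contractions anticommute: `contr₂_anticomm`. The minus sign comes from deleting
two vertices from an ordered set in the two possible orders; all signs of edge directions cancel.

The bracket of `HG` sums contractions between two graphs. A double bracket is therefore a sum of
double contractions in `X · Y · Z`, and in the Jacobi sum each double contraction occurs twice, with
its two pairs in opposite orders. So the terms cancel (`sum_cyclic`).

For the cobracket let D be the sum of all contractions over ordered pairs (`HG.contractions`) and Δ
the coproduct that distributes the components of a graph over two factors, followed by projection to
`GModC` (`HG.projCoproduct`). Anticommutation gives D² = 0 and makes D a derivation of the bracket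
up to sign (`HG.contractions_bracket`). A contraction of a connected graph has at most two
components, and splittings with an empty factor project to zero. Hence θ = ½ Δ D on connected graphs
after projection (`HG.proj₂_cobracket`).

The projection `HG.proj` kills disconnected graphs and graphs with a cut vertex, so it is a left
inverse on `GModC` and the natural map is injective. Graphs with a loop vanish because flipping the
loop reverses the orientation. A bridge forces a cut vertex or a loop, because valences are at least
three. Hence `GModC` is spanned by connected graphs without bridges, and for these every contraction
in a bracket is again connected. Identities of iterated brackets can thus be checked in `HG` and
then projected.

Descent to the quotient is geometric. In a bracket, a cut vertex of `X` has a side that avoids the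
edge being cut, and this side stays separated in the contraction. In the cobracket of a connected
graph with a cut vertex, one of the two parts of each splitting acquires a cut vertex, a bridge or a
loop (`HG.proj_restrict_of_cut_mem`, `HG.proj_restrict_of_cut_notMem`).

Compatibility: if `Y` is connected without bridges, the components of a contraction of `K · Y`
correspond to those of `K`, so Δ[K, Y] = [ΔK, Y] (`HG.projCoproduct_bracket`). Together with the
derivation property of D this gives the identity for ½ Δ D. Co-Jacobi: with Δ₃ = (Δ ⊗ proj) ∘
coproduct (`HG.projCoproduct₃`), the cyclic sum of (θ ⊗ 1)Δ equals ½ Δ₃ D on graphs with at most two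
components. The cyclic sum of (θ ⊗ 1)θ is therefore ¼ Δ₃ D² = 0. -/

open scoped TensorProduct

/-! ### Signs of bijections of finite linear orders -/

section Signs

/-- `1` if `a < b` and `-1` otherwise. -/
def ordSign {V : Type*} [LinearOrder V] (a b : V) : ℤˣ := if a < b then 1 else -1

theorem ordSign_swap {V : Type*} [LinearOrder V] {a b : V} (h : a ≠ b) :
    ordSign b a = -ordSign a b := by
  unfold ordSign
  rcases lt_or_gt_of_ne h with h | h <;> simp [h, h.le, not_lt_of_ge]

theorem ordSign_swap_mul {V W : Type*} [LinearOrder V] [LinearOrder W] {a b : V} {c d : W}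
    (h : a ≠ b) (h' : c ≠ d) : ordSign b a * ordSign d c = ordSign a b * ordSign c d := by
  rw [ordSign_swap h, ordSign_swap h', neg_mul_neg]

/-- The sign of an injective map between linear orders, computed by counting inversions. -/
def vertSign {V W : Type*} [Fintype V] [LinearOrder V] [LinearOrder W] (f : V → W) : ℤˣ :=
  ∏ p, ∏ q, if p < q then ordSign (f p) (f q) else 1

theorem vertSign_of_strictMono {V W : Type*} [Fintype V] [LinearOrder V] [LinearOrder W]
    {f : V → W} (hf : StrictMono f) : vertSign f = 1 := by
  refine Finset.prod_eq_one fun p _ => Finset.prod_eq_one fun q _ => ?_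
  split_ifs with h
  · simp [ordSign, hf h]
  · rfl

theorem vertSign_comp_strictMono {V W X : Type*} [Fintype V] [LinearOrder V] [LinearOrder W]
    [LinearOrder X] {f : V → W} {g : W → X} (hg : StrictMono g) :
    vertSign (fun v => g (f v)) = vertSign f := by
  simp [vertSign, ordSign, hg.lt_iff_lt]

/-- The sign of an injective map in terms of its signs on two complementary subsets. -/
theorem vertSign_split {A B V W : Type*} [Fintype V] [LinearOrder V] [LinearOrder W]
    [Fintype A] [LinearOrder A] [Fintype B] [LinearOrder B] (e : A ⊕ B ≃ V)
    (hA : StrictMono fun a => e (.inl a)) (hB : StrictMono fun b => e (.inr b))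
    {f : V → W} (hf : Function.Injective f) :
    vertSign f = vertSign (fun a => f (e (.inl a))) * vertSign (fun b => f (e (.inr b))) *
      ∏ a, ∏ b, ordSign (e (.inl a)) (e (.inr b)) * ordSign (f (e (.inl a))) (f (e (.inr b))) := by
  have hsplit : ∀ g : V → ℤˣ, ∏ v, g v = (∏ a, g (e (.inl a))) * ∏ b, g (e (.inr b)) := by
    intro g
    rw [← e.prod_comp, Fintype.prod_sum_type]
  -- A mixed pair is compared in one of the two orders only. The product of its signs before and
  -- after `f` is `-1` exactly if the pair is inverted.
  have key : ∀ a b, ordSign (e (.inl a)) (e (.inr b)) *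
      ordSign (f (e (.inl a))) (f (e (.inr b))) =
      (if e (.inl a) < e (.inr b) then ordSign (f (e (.inl a))) (f (e (.inr b))) else 1) *
      (if e (.inr b) < e (.inl a) then ordSign (f (e (.inr b))) (f (e (.inl a))) else 1) := by
    intro a b
    have hne : e (.inl a) ≠ e (.inr b) := fun h => by simpa using e.injective h
    have hfne := hf.ne hne
    rw [ordSign_swap hfne]
    rcases lt_or_gt_of_ne hne with h | h
    · simp [ordSign, h, h.not_gt]
    · rw [if_neg h.not_gt, if_pos h]
      simp only [ordSign, h.not_gt, if_false]
      split_ifs <;> simp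
  unfold vertSign
  simp only [key, hsplit, Finset.prod_mul_distrib, hA.lt_iff_lt, hB.lt_iff_lt]
  rw [Finset.prod_comm (f := fun (b : B) (a : A) =>
    if e (.inr b) < e (.inl a) then ordSign (f (e (.inr b))) (f (e (.inl a))) else 1)]
  set X1 := ∏ a, ∏ x : A, if a < x then ordSign (f (e (.inl a))) (f (e (.inl x))) else 1
  set X2 := ∏ a, ∏ x : B, if e (.inl a) < e (.inr x) then
    ordSign (f (e (.inl a))) (f (e (.inr x))) else 1
  set X3 := ∏ a, ∏ x : B, if e (.inr x) < e (.inl a) then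
    ordSign (f (e (.inr x))) (f (e (.inl a))) else 1
  set X4 := ∏ a, ∏ x : B, if a < x then ordSign (f (e (.inr a))) (f (e (.inr x))) else 1
  ac_rfl

theorem neg_one_pow_card_filter {V : Type*} [Fintype V] (P : V → Prop) [DecidablePred P] :
    (-1 : ℤˣ) ^ (Finset.univ.filter P).card = ∏ u, if P u then -1 else 1 := by
  rw [Finset.prod_ite]
  simp

/-- The sign of the number of elements before `w`. -/
def rankSign {V : Type*} [Fintype V] [LinearOrder V] (w : V) : ℤˣ :=
  (-1) ^ (Finset.univ.filter fun u => u < w).card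

theorem prod_eq_mul_prod_ne {V M : Type*} [Fintype V] [DecidableEq V] [CommMonoid M] (w : V)
    (g : V → M) : ∏ v, g v = g w * ∏ u : {u // u ≠ w}, g u := by
  rw [← Finset.mul_prod_erase _ _ (Finset.mem_univ w)]
  congr 1
  exact Finset.prod_subtype _ (by simp) _

theorem prod_eq_mul_prod_ne_ne {V M : Type*} [Fintype V] [DecidableEq V] [CommMonoid M] {x y : V}
    (hxy : x ≠ y) (g : V → M) :
    ∏ v, g v = g x * g y * ∏ u : {u // u ≠ x ∧ u ≠ y}, g u := by
  rw [← Finset.mul_prod_erase _ _ (Finset.mem_univ x),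
    ← Finset.mul_prod_erase _ _ (Finset.mem_erase.2 ⟨hxy.symm, Finset.mem_univ y⟩), mul_assoc]
  congr 2
  exact Finset.prod_subtype _ (by simp [and_comm]) _

/-- This gives the rank parity the same shape as the factor split off when a point is deleted from
`vertSign`. -/
theorem rankSign_eq {V : Type*} [Fintype V] [LinearOrder V] (w : V) :
    rankSign w = ∏ u : {u // u ≠ w}, ordSign w u.1 := by
  rw [rankSign, neg_one_pow_card_filter, prod_eq_mul_prod_ne w]
  simp only [lt_irrefl, if_false, one_mul]
  refine Finset.prod_congr rfl fun u _ => ?_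
  rcases lt_or_gt_of_ne u.2 with h | h <;> simp [ordSign, h, h.not_gt]

/-- The sign relating two directions of the edges. -/
def dirSign {H : Type*} [Fintype H] (d d' : H → ℤˣ) : ℤˣ := ∏ h, if d h = 1 then d' h else 1

theorem dirSign_eq_one {H : Type*} [Fintype H] {d d' : H → ℤˣ} (h : ∀ a, d' a = d a) :
    dirSign d d' = 1 :=
  Finset.prod_eq_one fun a _ => by rw [h]; split_ifs with h1 <;> simp [h1]

/-- The sign relating two directions which differ at most at one edge. -/
theorem dirSign_eq_mul {H : Type*} [Fintype H] {d d' : H → ℤˣ} (g g' : H) (hg : g' ≠ g)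
    (hd : d g' = -d g) (hd' : d' g' = -d' g) (h : ∀ a, a ≠ g → a ≠ g' → d' a = d a) :
    dirSign d d' = d g * d' g := by
  classical
  rw [dirSign, prod_eq_mul_prod_ne_ne hg.symm, Finset.prod_eq_one, mul_one, hd, hd']
  -- Only the half that is initial for `d` contributes; it contributes `d' g` or `-d' g` according
  -- to the sign of `d g`.
  · rcases Int.units_eq_one_or (d g) with h1 | h1 <;> rw [h1] <;> simp
  · rintro ⟨u, hu⟩ -
    simp only [h u hu.1 hu.2]
    split_ifs with h1 <;> simp [h1]

end Signs

/-! ### Linear maps out of the space of oriented graphs -/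

namespace OGraph

theorem Iso.sign_eq {G G' : OGraph} (f : Iso G G') :
    f.sign = vertSign f.onV * dirSign G.dir (fun h => G'.dir (f.onH h)) := by
  unfold Iso.sign vertSign dirSign
  rw [Finset.prod_filter, Finset.prod_filter, Fintype.prod_prod_type]
  rfl

theorem Iso.sign_eq_one {G G' : OGraph} (f : Iso G G') (h1 : StrictMono f.onV)
    (h2 : ∀ h, G'.dir (f.onH h) = G.dir h) : f.sign = 1 := by
  rw [f.sign_eq, vertSign_of_strictMono h1, dirSign_eq_one h2, one_mul]

end OGraph

section Lift

open OGraph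

universe u

variable (k : Type u) [Field k]

theorem graphClass_iso {G G' : OGraph} (f : Iso G G') :
    graphClass k G' = f.sign • graphClass k G := by
  have h : Finsupp.single G' 1 - f.sign • Finsupp.single G 1 ∈ isoRelations k :=
    Submodule.subset_span ⟨G, G', f, rfl⟩
  have := (Submodule.Quotient.mk_eq_zero _).2 h
  rw [Submodule.Quotient.mk_sub, sub_eq_zero] at this
  rw [graphClass, graphClass, ← LinearMap.map_smul_of_tower]
  exact this

variable {k}

/-- The linear map on `HG` given by a function on oriented graphs compatible with isomorphisms. -/
noncomputable def HG.lift {M : Type*} [AddCommGroup M] [Module k M] (φ : OGraph → M)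
    (hφ : ∀ (G G' : OGraph) (f : Iso G G'), φ G' = f.sign • φ G) : HG k →ₗ[k] M :=
  (isoRelations k).liftQ (Finsupp.linearCombination k φ) <| by
    rw [isoRelations, Submodule.span_le]
    rintro _ ⟨G, G', f, rfl⟩
    rw [SetLike.mem_coe, LinearMap.mem_ker, map_sub, LinearMap.map_smul_of_tower]
    simp [hφ G G' f]

@[simp]
theorem HG.lift_graphClass {M : Type*} [AddCommGroup M] [Module k M] (φ : OGraph → M)
    (hφ : ∀ (G G' : OGraph) (f : Iso G G'), φ G' = f.sign • φ G) (G : OGraph) :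
    HG.lift (k := k) φ hφ (graphClass k G) = φ G := by
  rw [HG.lift, graphClass]
  erw [Submodule.liftQ_apply]
  simp

theorem HG.span_graphClass : Submodule.span k (Set.range (graphClass k)) = ⊤ := by
  rw [eq_top_iff]
  rintro X -
  obtain ⟨X, rfl⟩ := Submodule.mkQ_surjective _ X
  induction X using Finsupp.induction_linear with
  | zero => simp
  | add X Y hX hY => rw [map_add]; exact add_mem hX hY
  | single G a =>
    have : Finsupp.single G a = a • Finsupp.single G (1 : k) := by simp
    rw [this, map_smul]
    exact Submodule.smul_mem _ _ (Submodule.subset_span ⟨G, rfl⟩)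

theorem HG.hom_ext {M : Type*} [AddCommGroup M] [Module k M] {φ ψ : HG k →ₗ[k] M}
    (h : ∀ G, φ (graphClass k G) = ψ (graphClass k G)) : φ = ψ :=
  LinearMap.ext_on_range HG.span_graphClass h

end Lift

/-! ### Coordinates on contractions, disjoint unions and parts of graphs -/

theorem sum_subtype_eq_dite {H M : Type*} [Fintype H] [AddCommMonoid M] {P : H → Prop}
    [DecidablePred P] (F : {a // P a} → M) :
    ∑ a, F a = ∑ b : H, if hb : P b then F ⟨b, hb⟩ else 0 := by
  have h1 : ∑ b : H, (if hb : P b then F ⟨b, hb⟩ else 0) =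
      ∑ b ∈ Finset.univ.filter P, if hb : P b then F ⟨b, hb⟩ else 0 := by
    refine (Finset.sum_subset (Finset.filter_subset _ _) fun b _ hb => ?_).symm
    rw [dif_neg (by simpa using hb)]
  rw [h1, Finset.sum_subtype (p := P) _ (by simp)]
  exact Finset.sum_congr rfl fun a _ => by rw [dif_pos a.2]

namespace OGraph

/-- Two graphs whose vertices and half-edges are embedded with the same images in common sets, in a
way compatible with the structure, are isomorphic. -/
theorem exists_iso {A B : OGraph} {X Y : Type*} {aV : A.V → X} {bV : B.V → X} {aH : A.H → Y}
    {bH : B.H → Y} (haV : Function.Injective aV) (hbV : Function.Injective bV)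
    (haH : Function.Injective aH) (hbH : Function.Injective bH)
    (hV : ∀ x, (∃ v, aV v = x) ↔ ∃ v, bV v = x) (hH : ∀ y, (∃ h, aH h = y) ↔ ∃ h, bH h = y)
    (hbar : ∀ a b, aH a = bH b → aH (A.bar a) = bH (B.bar b))
    (hvert : ∀ a b, aH a = bH b → aV (A.vert a) = bV (B.vert b)) :
    ∃ f : Iso A B, (∀ v, bV (f.onV v) = aV v) ∧ ∀ h, bH (f.onH h) = aH h := by
  choose φ hφ using fun v => (hV (aV v)).1 ⟨v, rfl⟩
  choose φ' hφ' using fun v => (hV (bV v)).2 ⟨v, rfl⟩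
  choose ψ hψ using fun v => (hH (aH v)).1 ⟨v, rfl⟩
  choose ψ' hψ' using fun v => (hH (bH v)).2 ⟨v, rfl⟩
  refine ⟨⟨⟨φ, φ', fun v => haV ?_, fun v => hbV ?_⟩, ⟨ψ, ψ', fun v => haH ?_, fun v => hbH ?_⟩,
    fun h => hbH ?_, fun h => hbV ?_⟩, hφ, hψ⟩
  · rw [hφ', hφ]
  · rw [hφ, hφ']
  · rw [hψ', hψ]
  · rw [hψ, hψ']
  · change bH (B.bar (ψ h)) = bH (ψ (A.bar h))
    rw [hψ, hbar h (ψ h) (hψ h).symm]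
  · change bV (B.vert (ψ h)) = bV (φ (A.vert h))
    rw [hφ, hvert h (ψ h) (hψ h).symm]

/-- Composing with an order embedding does not change inversions, so the sign of an isomorphism can
be computed in the coordinates of an ambient ordered set. -/
theorem Iso.sign_eq_of_strictMono {A B : OGraph} {X : Type*} [LinearOrder X] (f : Iso A B)
    {aV : A.V → X} {bV : B.V → X} (hbV : StrictMono bV) (hf : ∀ v, bV (f.onV v) = aV v) :
    f.sign = vertSign aV * dirSign A.dir (fun h => B.dir (f.onH h)) := by
  rw [f.sign_eq, ← vertSign_comp_strictMono hbV]
  simp only [hf]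

/-- Two oriented graphs embedded in an order preserving way with the same images, and with the same
structure and directions of edges, represent the same class. -/
theorem graphClass_eq (k : Type*) [Field k] {A B : OGraph} {X Y : Type*} [LinearOrder X]
    {aV : A.V → X} {bV : B.V → X} {aH : A.H → Y}
    {bH : B.H → Y} (haV : StrictMono aV) (hbV : StrictMono bV)
    (haH : Function.Injective aH) (hbH : Function.Injective bH)
    (hV : ∀ x, (∃ v, aV v = x) ↔ ∃ v, bV v = x) (hH : ∀ y, (∃ h, aH h = y) ↔ ∃ h, bH h = y)
    (hbar : ∀ a b, aH a = bH b → aH (A.bar a) = bH (B.bar b))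
    (hvert : ∀ a b, aH a = bH b → aV (A.vert a) = bV (B.vert b))
    (hdir : ∀ a b, aH a = bH b → A.dir a = B.dir b) : graphClass k A = graphClass k B := by
  obtain ⟨f, hfV, hfH⟩ := exists_iso haV.injective hbV.injective haH hbH hV hH hbar hvert
  rw [graphClass_iso k f, f.sign_eq_of_strictMono hbV hfV, vertSign_of_strictMono haV,
    dirSign_eq_one fun a => (hdir a _ (hfH a).symm).symm, one_mul, one_smul]

section Contract

variable (G : OGraph) {x y : G.H} (h : G.vert x ≠ G.vert y)

/-- The inclusion of the vertices of a contraction. -/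
def ctrV (u : (G.contract x y h).V) : G.V := Subtype.val (p := fun u => u ≠ G.vert y) u

/-- The inclusion of the half-edges of a contraction. -/
def ctrH (a : (G.contract x y h).H) : G.H := Subtype.val (p := fun a => a ≠ x ∧ a ≠ y) a

/-- The vertex of a contraction given by a vertex of the graph. -/
def toCtrV (u : G.V) (hu : u ≠ G.vert y) : (G.contract x y h).V := ⟨u, hu⟩

/-- The half-edge of a contraction given by a half-edge of the graph. -/
def toCtrH (a : G.H) (ha : a ≠ x ∧ a ≠ y) : (G.contract x y h).H := ⟨a, ha⟩

@[simp] theorem ctrV_toCtrV (u : G.V) (hu : u ≠ G.vert y) : G.ctrV h (G.toCtrV h u hu) = u := rfl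

@[simp] theorem ctrH_toCtrH (a : G.H) (ha : a ≠ x ∧ a ≠ y) : G.ctrH h (G.toCtrH h a ha) = a := rfl

theorem ctrV_ne (u : (G.contract x y h).V) : G.ctrV h u ≠ G.vert y := Subtype.prop u

theorem ctrH_ne (a : (G.contract x y h).H) : G.ctrH h a ≠ x ∧ G.ctrH h a ≠ y := Subtype.prop a

theorem ctrV_strictMono : StrictMono (G.ctrV h) := fun _ _ h => h

theorem ctrV_injective : Function.Injective (G.ctrV h) := (G.ctrV_strictMono h).injective

theorem ctrH_injective : Function.Injective (G.ctrH h) := fun _ _ h => Subtype.ext h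

theorem exists_ctrV (v : G.V) : (∃ u, G.ctrV h u = v) ↔ v ≠ G.vert y :=
  ⟨by rintro ⟨u, rfl⟩; exact G.ctrV_ne h u, fun hv => ⟨G.toCtrV h v hv, rfl⟩⟩

theorem exists_ctrH (b : G.H) : (∃ a, G.ctrH h a = b) ↔ b ≠ x ∧ b ≠ y :=
  ⟨by rintro ⟨u, rfl⟩; exact G.ctrH_ne h u, fun hv => ⟨G.toCtrH h b hv, rfl⟩⟩

theorem ctrH_bar (a : (G.contract x y h).H) : G.ctrH h ((G.contract x y h).bar a) =
    if G.ctrH h a = G.bar x then G.bar y else if G.ctrH h a = G.bar y then G.bar x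
      else G.bar (G.ctrH h a) := rfl

theorem contract_dir (a : (G.contract x y h).H) : (G.contract x y h).dir a =
    if G.ctrH h a = G.bar x then -1 else if G.ctrH h a = G.bar y then 1
      else G.dir (G.ctrH h a) := rfl

theorem ctrV_vert (a : (G.contract x y h).H) : G.ctrV h ((G.contract x y h).vert a) =
    if G.vert (G.ctrH h a) = G.vert y then G.vert x else G.vert (G.ctrH h a) := by
  by_cases hh : G.vert (G.ctrH h a) = G.vert y
  · rw [if_pos hh]
    exact congrArg (Subtype.val (p := fun u => u ≠ G.vert y)) (dif_pos hh)
  · rw [if_neg hh]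
    exact congrArg (Subtype.val (p := fun u => u ≠ G.vert y)) (dif_neg hh)

theorem sum_ctrH {M : Type*} [AddCommMonoid M] (F : (G.contract x y h).H → M) :
    ∑ a, F a = ∑ b : G.H, if hb : b ≠ x ∧ b ≠ y then F (G.toCtrH h b hb) else 0 := by
  exact sum_subtype_eq_dite (P := fun a => a ≠ x ∧ a ≠ y) F

end Contract

section DisjUnion

variable (G K : OGraph)

/-- The inclusion of the vertices of the first graph in a disjoint union. -/
def inlV (v : G.V) : (G.disjUnion K).V := toLex (Sum.inl v)

/-- The inclusion of the vertices of the second graph in a disjoint union. -/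
def inrV (v : K.V) : (G.disjUnion K).V := toLex (Sum.inr v)

/-- The inclusion of the half-edges of the first graph in a disjoint union. -/
def inlH (v : G.H) : (G.disjUnion K).H := Sum.inl v

/-- The inclusion of the half-edges of the second graph in a disjoint union. -/
def inrH (v : K.H) : (G.disjUnion K).H := Sum.inr v

variable {G K}

/-- A function on the vertices of a disjoint union. -/
def elimV {α : Type*} (f : G.V → α) (g : K.V → α) (v : (G.disjUnion K).V) : α :=
  Sum.elim f g (ofLex v)

/-- A function on the half-edges of a disjoint union. -/
def elimH {α : Type*} (f : G.H → α) (g : K.H → α) (v : (G.disjUnion K).H) : α :=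
  Sum.elim f g v

variable {α : Type*}

@[simp] theorem elimV_inlV (f : G.V → α) (g : K.V → α) (v : G.V) :
    elimV f g (inlV G K v) = f v := rfl

@[simp] theorem elimV_inrV (f : G.V → α) (g : K.V → α) (v : K.V) :
    elimV f g (inrV G K v) = g v := rfl

@[simp] theorem elimH_inlH (f : G.H → α) (g : K.H → α) (v : G.H) :
    elimH f g (inlH G K v) = f v := rfl

@[simp] theorem elimH_inrH (f : G.H → α) (g : K.H → α) (v : K.H) :
    elimH f g (inrH G K v) = g v := rfl

theorem forall_disjUnionV {P : (G.disjUnion K).V → Prop} :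
    (∀ v, P v) ↔ (∀ v, P (inlV G K v)) ∧ ∀ v, P (inrV G K v) :=
  ⟨fun h => ⟨fun _ => h _, fun _ => h _⟩, fun h v => by
    rcases v with v | v
    exacts [h.1 v, h.2 v]⟩

theorem forall_disjUnionH {P : (G.disjUnion K).H → Prop} :
    (∀ v, P v) ↔ (∀ v, P (inlH G K v)) ∧ ∀ v, P (inrH G K v) :=
  ⟨fun h => ⟨fun _ => h _, fun _ => h _⟩, fun h v => by
    rcases v with v | v
    exacts [h.1 v, h.2 v]⟩

theorem exists_disjUnionV {P : (G.disjUnion K).V → Prop} :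
    (∃ v, P v) ↔ (∃ v, P (inlV G K v)) ∨ ∃ v, P (inrV G K v) := by
  have := forall_disjUnionV (P := fun v => ¬ P v)
  grind

theorem exists_disjUnionH {P : (G.disjUnion K).H → Prop} :
    (∃ v, P v) ↔ (∃ v, P (inlH G K v)) ∨ ∃ v, P (inrH G K v) := by
  have := forall_disjUnionH (P := fun v => ¬ P v)
  grind

variable (G K)

theorem inlV_strictMono : StrictMono (inlV G K) := Sum.Lex.inl_strictMono

theorem inrV_strictMono : StrictMono (inrV G K) := Sum.Lex.inr_strictMono

theorem inlV_injective : Function.Injective (inlV G K) := (inlV_strictMono G K).injective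

theorem inrV_injective : Function.Injective (inrV G K) := (inrV_strictMono G K).injective

theorem inlH_injective : Function.Injective (inlH G K) := Sum.inl_injective

theorem inrH_injective : Function.Injective (inrH G K) := Sum.inr_injective

theorem inlV_lt_inrV (v : G.V) (w : K.V) : inlV G K v < inrV G K w := Sum.Lex.inl_lt_inr _ _

variable {G K}

@[simp] theorem inlV_inj {v w : G.V} : inlV G K v = inlV G K w ↔ v = w :=
  (inlV_injective G K).eq_iff

@[simp] theorem inrV_inj {v w : K.V} : inrV G K v = inrV G K w ↔ v = w :=
  (inrV_injective G K).eq_iff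

@[simp] theorem inlH_inj {v w : G.H} : inlH G K v = inlH G K w ↔ v = w :=
  (inlH_injective G K).eq_iff

@[simp] theorem inrH_inj {v w : K.H} : inrH G K v = inrH G K w ↔ v = w :=
  (inrH_injective G K).eq_iff

@[simp] theorem inlV_ne_inrV {v : G.V} {w : K.V} : inlV G K v ≠ inrV G K w :=
  (inlV_lt_inrV G K v w).ne

@[simp] theorem inrV_ne_inlV {v : G.V} {w : K.V} : inrV G K w ≠ inlV G K v :=
  (inlV_lt_inrV G K v w).ne'

@[simp] theorem inlH_ne_inrH {v : G.H} {w : K.H} : inlH G K v ≠ inrH G K w := Sum.inl_ne_inr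

@[simp] theorem inrH_ne_inlH {v : G.H} {w : K.H} : inrH G K w ≠ inlH G K v := Sum.inr_ne_inl

@[simp] theorem bar_inlH (v : G.H) : (G.disjUnion K).bar (inlH G K v) = inlH G K (G.bar v) := rfl

@[simp] theorem bar_inrH (v : K.H) : (G.disjUnion K).bar (inrH G K v) = inrH G K (K.bar v) := rfl

@[simp] theorem dir_inlH (v : G.H) : (G.disjUnion K).dir (inlH G K v) = G.dir v := rfl

@[simp] theorem dir_inrH (v : K.H) : (G.disjUnion K).dir (inrH G K v) = K.dir v := rfl

@[simp] theorem vert_inlH (v : G.H) : (G.disjUnion K).vert (inlH G K v) = inlV G K (G.vert v) :=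
  rfl

@[simp] theorem vert_inrH (v : K.H) : (G.disjUnion K).vert (inrH G K v) = inrV G K (K.vert v) :=
  rfl

theorem strictMono_disjUnion [LinearOrder α] {f : (G.disjUnion K).V → α}
    (h1 : StrictMono fun v => f (inlV G K v)) (h2 : StrictMono fun v => f (inrV G K v))
    (h3 : ∀ v w, f (inlV G K v) < f (inrV G K w)) : StrictMono f := by
  have key : ∀ a b, a < b → f a < f b := by
    rw [forall_disjUnionV]
    constructor <;> intro v <;> rw [forall_disjUnionV] <;> constructor <;> intro w hvw
    · exact h1 ((inlV_strictMono G K).lt_iff_lt.1 hvw)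
    · exact h3 v w
    · exact (lt_asymm hvw (inlV_lt_inrV G K w v)).elim
    · exact h2 ((inrV_strictMono G K).lt_iff_lt.1 hvw)
  exact fun a b => key a b

theorem sum_disjUnionH {M : Type*} [AddCommMonoid M] (F : (G.disjUnion K).H → M) :
    ∑ a, F a = ∑ a, F (inlH G K a) + ∑ a, F (inrH G K a) :=
  Fintype.sum_sum_type (α₁ := G.H) (α₂ := K.H) F

end DisjUnion

section Restrict

variable (G : OGraph) {S : Set G.V} (hS : G.IsClosed S)

/-- The inclusion of the vertices of a part of a graph. -/
def resV (u : (G.restrict S hS).V) : G.V := Subtype.val (p := fun u => u ∈ S) u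

/-- The inclusion of the half-edges of a part of a graph. -/
def resH (a : (G.restrict S hS).H) : G.H := Subtype.val (p := fun a => G.vert a ∈ S) a

/-- The vertex of a part of a graph given by a vertex of the graph. -/
def toResV (u : G.V) (hu : u ∈ S) : (G.restrict S hS).V := ⟨u, hu⟩

/-- The half-edge of a part of a graph given by a half-edge of the graph. -/
def toResH (a : G.H) (ha : G.vert a ∈ S) : (G.restrict S hS).H := ⟨a, ha⟩

@[simp] theorem resH_toResH (a : G.H) (ha : G.vert a ∈ S) : G.resH hS (G.toResH hS a ha) = a := rfl

theorem resV_mem (u : (G.restrict S hS).V) : G.resV hS u ∈ S := Subtype.prop u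

theorem resH_mem (a : (G.restrict S hS).H) : G.vert (G.resH hS a) ∈ S := Subtype.prop a

theorem resV_strictMono : StrictMono (G.resV hS) := fun _ _ h => h

theorem resV_injective : Function.Injective (G.resV hS) := (G.resV_strictMono hS).injective

theorem resH_injective : Function.Injective (G.resH hS) := fun _ _ h => Subtype.ext h

theorem exists_resV (v : G.V) : (∃ u, G.resV hS u = v) ↔ v ∈ S :=
  ⟨by rintro ⟨u, rfl⟩; exact G.resV_mem hS u, fun hv => ⟨G.toResV hS v hv, rfl⟩⟩

theorem exists_resH (b : G.H) : (∃ a, G.resH hS a = b) ↔ G.vert b ∈ S :=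
  ⟨by rintro ⟨u, rfl⟩; exact G.resH_mem hS u, fun hv => ⟨G.toResH hS b hv, rfl⟩⟩

@[simp] theorem resH_bar (a : (G.restrict S hS).H) :
    G.resH hS ((G.restrict S hS).bar a) = G.bar (G.resH hS a) := rfl

@[simp] theorem restrict_dir (a : (G.restrict S hS).H) :
    (G.restrict S hS).dir a = G.dir (G.resH hS a) := rfl

@[simp] theorem resV_vert (a : (G.restrict S hS).H) :
    G.resV hS ((G.restrict S hS).vert a) = G.vert (G.resH hS a) := rfl

end Restrict

end OGraph

/-! ### Signs under deletion and replacement of a vertex -/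

section Signs

/-- The effect of deleting a point on the sign of an injective map. -/
theorem vertSign_eq_mul_prod {V W : Type*} [Fintype V] [LinearOrder V] [LinearOrder W]
    {f : V → W} (hf : Function.Injective f) (w : V) :
    vertSign f = vertSign (fun u : {u // u ≠ w} => f u) *
      ∏ u : {u // u ≠ w}, ordSign w u.1 * ordSign (f w) (f u) := by
  rw [vertSign_split (Equiv.sumCompl (· ≠ w)) (fun _ _ h => h) (fun _ _ h => h) hf]
  have hs : ∀ u : {u // ¬ u ≠ w}, u = ⟨w, by simp⟩ := fun u => Subtype.ext (not_not.1 u.2)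
  have : Unique {u // ¬ u ≠ w} := ⟨⟨⟨w, by simp⟩⟩, hs⟩
  have h1 : vertSign (fun b => f (Equiv.sumCompl (· ≠ w) (.inr b))) = 1 :=
    vertSign_of_strictMono fun a b h => by rw [hs a, hs b] at h; exact (lt_irrefl _ h).elim
  rw [h1, mul_one]
  congr 1
  refine Finset.prod_congr rfl fun u _ => ?_
  rw [Fintype.prod_subsingleton _ ⟨w, by simp⟩]
  exact ordSign_swap_mul u.2.symm (hf.ne u.2.symm)

/-- The pairs containing `w` contribute the parity of its rank before, times the parity of its rank
after. -/
theorem vertSign_equiv {V W : Type*} [Fintype V] [LinearOrder V] [Fintype W] [LinearOrder W]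
    (f : V ≃ W) (w : V) :
    vertSign f = vertSign (fun u : {u // u ≠ w} => f u) * (rankSign w * rankSign (f w)) := by
  rw [vertSign_eq_mul_prod f.injective w]
  congr 1
  have h2 : rankSign (f w) = ∏ u : {u // u ≠ w}, ordSign (f w) (f u.1) := by
    rw [rankSign_eq]
    exact (Equiv.prod_comp (f.subtypeEquiv (p := fun u => u ≠ w) (q := fun u => u ≠ f w)
      (fun a => by simp)) (fun u => ordSign (f w) u.1)).symm
  rw [h2, rankSign_eq, ← Finset.prod_mul_distrib]

/-- Restoring the deleted point `w` changes the rank of `u` exactly if `w` precedes `u`. This is the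
origin of the sign in `contr₂_anticomm`. -/
theorem rankSign_subtype_ne {V : Type*} [Fintype V] [LinearOrder V] {w : V} (u : {u // u ≠ w}) :
    rankSign u.1 = rankSign u * ordSign u.1 w := by
  have h : rankSign u = ∏ v : {v // v ≠ w}, if v.1 < u.1 then -1 else 1 := by
    rw [rankSign, neg_one_pow_card_filter]
    rfl
  rw [h, rankSign, neg_one_pow_card_filter, prod_eq_mul_prod_ne w, mul_comm]
  congr 1
  rcases lt_or_gt_of_ne u.2 with h | h <;> simp [ordSign, h, h.not_gt]

/-- The sign of the map from the complement of `w` to the complement of `v` which sends `v` to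
`w`. -/
theorem vertSign_replace {V : Type*} [Fintype V] [LinearOrder V] {v w : V} (hvw : v ≠ w) :
    vertSign (fun u : {u // u ≠ w} => if u.1 = v then w else u.1) =
      -(rankSign v * rankSign w) := by
  have hinj : Function.Injective (fun u : {u // u ≠ w} => if u.1 = v then w else u.1) := by
    rintro ⟨a, ha⟩ ⟨b, hb⟩ h
    have h : (if a = v then w else a) = if b = v then w else b := h
    apply Subtype.ext
    change a = b
    grind
  rw [vertSign_eq_mul_prod hinj ⟨v, hvw⟩, vertSign_of_strictMono, one_mul]
  · have h1 := rankSign_subtype_ne (w := w) ⟨v, hvw⟩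
    have h2 := rankSign_subtype_ne (w := v) ⟨w, hvw.symm⟩
    -- Deleting `v` and `w` in either order leaves the same set, so both reduced ranks become
    -- products over one index set.
    let e : {u : {u // u ≠ w} // u ≠ ⟨v, hvw⟩} ≃ {u : {u // u ≠ v} // u ≠ ⟨w, hvw.symm⟩} :=
      { toFun := fun u => ⟨⟨u.1.1, fun e => u.2 (Subtype.ext e)⟩,
          fun e => u.1.2 (congrArg Subtype.val e)⟩
        invFun := fun u => ⟨⟨u.1.1, fun e => u.2 (Subtype.ext e)⟩,
          fun e => u.1.2 (congrArg Subtype.val e)⟩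
        left_inv := fun u => rfl
        right_inv := fun u => rfl }
    have h3 : rankSign (⟨w, hvw.symm⟩ : {u // u ≠ v}) =
        ∏ u : {u : {u // u ≠ w} // u ≠ ⟨v, hvw⟩}, ordSign w u.1.1 :=
      (rankSign_eq _).trans (Equiv.prod_comp e fun u => ordSign w u.1.1).symm
    have h4 : rankSign (⟨v, hvw⟩ : {u // u ≠ w}) =
        ∏ u : {u : {u // u ≠ w} // u ≠ ⟨v, hvw⟩}, ordSign v u.1.1 := rankSign_eq _
    rw [h1, h2, h3, h4, ordSign_swap hvw]
    have h5 : ordSign v w * ordSign v w = 1 := Int.units_mul_self _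
    rw [mul_neg, mul_neg, neg_neg, mul_mul_mul_comm, h5, mul_one, ← Finset.prod_mul_distrib]
    refine Finset.prod_congr rfl fun u _ => ?_
    have : u.1.1 ≠ v := fun e => u.2 (Subtype.ext e)
    simp only [if_true, this, if_false]
    rfl
  · intro a b hab
    have ha : a.1.1 ≠ v := fun e => a.2 (Subtype.ext e)
    have hb : b.1.1 ≠ v := fun e => b.2 (Subtype.ext e)
    simp only [ha, hb, if_false]
    exact hab

theorem prod_eq_of_range_ne_ne {L H M : Type*} [Fintype L] [Fintype H] [DecidableEq H]
    [CommMonoid M] {i : L → H} (hi : Function.Injective i) {x y : H} (hxy : x ≠ y)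
    (hr : ∀ h, (∃ a, i a = h) ↔ h ≠ x ∧ h ≠ y) (g : H → M) :
    ∏ h, g h = g x * g y * ∏ a, g (i a) := by
  rw [prod_eq_mul_prod_ne_ne hxy]
  congr 1
  refine (Fintype.prod_bijective (fun a => (⟨i a, (hr _).1 ⟨a, rfl⟩⟩ : {u // u ≠ x ∧ u ≠ y}))
    ⟨fun a b hab => hi (congrArg Subtype.val hab), ?_⟩ _ _ fun a => rfl).symm
  rintro ⟨h, hh⟩
  obtain ⟨a, rfl⟩ := (hr h).2 hh
  exact ⟨a, rfl⟩

end Signs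

/-! ### Naturality and symmetry of contractions -/

namespace OGraph

theorem bar_injective (G : OGraph) : Function.Injective G.bar := fun a b h => by
  rw [← G.bar_bar a, h, G.bar_bar]

@[simp] theorem bar_inj (G : OGraph) {a b : G.H} : G.bar a = G.bar b ↔ a = b :=
  G.bar_injective.eq_iff

/-- For a pair that is not an edge the two minus signs of `contractSign` cancel; the sign
computations below start from this form. -/
theorem contractSign_eq (G : OGraph) {x y : G.H} (h : y ≠ G.bar x) :
    G.contractSign x y = G.dir x * G.dir y * rankSign (G.vert y) := by
  rw [contractSign, if_neg h, neg_mul_neg, rankSign]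

theorem Iso.dir_bar {G G' : OGraph} (f : Iso G G') (h : G.H) :
    G'.dir (f.onH (G.bar h)) = - G'.dir (f.onH h) := by
  rw [← f.bar_onH, G'.dir_bar]

theorem ne_of_vert_ne {G : OGraph} {x y : G.H} (h : G.vert x ≠ G.vert y) : x ≠ y :=
  fun e => h (by rw [e])

/-- The two cut edges contribute `G.dir z * d z` for `z = x, y`. The new edge has the same
prescribed direction on both sides and contributes nothing. -/
theorem dirSign_contract (G : OGraph) {x y : G.H} (h : G.vert x ≠ G.vert y) (hb : y ≠ G.bar x)
    {d : G.H → ℤˣ} (hd : ∀ a, d (G.bar a) = - d a) {d' : (G.contract x y h).H → ℤˣ}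
    (hd' : ∀ a, d' a = if G.ctrH h a = G.bar x then -1 else if G.ctrH h a = G.bar y then 1
      else d (G.ctrH h a)) :
    dirSign G.dir d = G.dir x * G.dir y * d x * d y * dirSign (G.contract x y h).dir d' := by
  have hxy := ne_of_vert_ne h
  have hbar : ∀ z, (if G.dir z = 1 then d z else 1) *
      (if G.dir (G.bar z) = 1 then d (G.bar z) else 1) = G.dir z * d z := by
    intro z
    rw [G.dir_bar, hd]
    rcases Int.units_eq_one_or (G.dir z) with h1 | h1 <;> rw [h1] <;> simp
  obtain ⟨X, hX⟩ := (G.exists_ctrH h (G.bar x)).2 ⟨G.bar_ne x, hb.symm⟩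
  obtain ⟨Y, hY⟩ := (G.exists_ctrH h (G.bar y)).2
    ⟨fun e => hb (by rw [← e, G.bar_bar]), G.bar_ne y⟩
  have hXY : X ≠ Y := fun e => hxy (G.bar_injective (by rw [← hX, ← hY, e]))
  rw [dirSign, prod_eq_of_range_ne_ne (G.ctrH_injective h) hxy (G.exists_ctrH h), dirSign,
    prod_eq_mul_prod_ne_ne hXY, prod_eq_mul_prod_ne_ne hXY]
  simp only [hX, hY]
  have e1 : (if (G.contract x y h).dir X = 1 then d' X else 1) = 1 := by
    simp [contract_dir, hX]
  have e2 : (if (G.contract x y h).dir Y = 1 then d' Y else 1) = 1 := by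
    rw [hd', hY]
    simp [hxy.symm]
  have e3 : ∀ u : {u // u ≠ X ∧ u ≠ Y}, (if (G.contract x y h).dir u.1 = 1 then d' u.1 else 1) =
      if G.dir (G.ctrH h u.1) = 1 then d (G.ctrH h u.1) else 1 := by
    rintro ⟨u, hu1, hu2⟩
    have h1 : G.ctrH h u ≠ G.bar x := fun e => hu1 (G.ctrH_injective h (e.trans hX.symm))
    have h2 : G.ctrH h u ≠ G.bar y := fun e => hu2 (G.ctrH_injective h (e.trans hY.symm))
    rw [hd', contract_dir, if_neg h1, if_neg h2, if_neg h1, if_neg h2]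
  rw [e1, e2, one_mul, one_mul, Finset.prod_congr rfl fun u _ => e3 u, ← mul_assoc]
  congr 1
  rw [mul_mul_mul_comm, hbar, hbar]
  ac_rfl

theorem vertSign_contract (G : OGraph) {x y : G.H} (h : G.vert x ≠ G.vert y) {W : Type*}
    [Fintype W] [LinearOrder W] (f : G.V ≃ W) :
    vertSign f = vertSign (fun u => f (G.ctrV h u)) *
      (rankSign (G.vert y) * rankSign (f (G.vert y))) :=
  vertSign_equiv f (G.vert y)

theorem vertSign_contract_replace (G : OGraph) {x y : G.H} (h : G.vert x ≠ G.vert y) :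
    vertSign (fun u => if G.ctrV h u = G.vert x then G.vert y else G.ctrV h u) =
      -(rankSign (G.vert x) * rankSign (G.vert y)) :=
  vertSign_replace h

theorem rankSign_ctrV (G : OGraph) {x y : G.H} (h : G.vert x ≠ G.vert y)
    (u : (G.contract x y h).V) :
    rankSign (G.ctrV h u) = rankSign u * ordSign (G.ctrV h u) (G.vert y) :=
  rankSign_subtype_ne (w := G.vert y) u

/-- The part of `f.sign` lost in passing to the contraction consists of the directions of the two
cut edges and of the rank of `G.vert y`, which are precisely the ingredients of `contractSign`. -/
theorem Iso.exists_contract {G G' : OGraph} (f : Iso G G') {x y : G.H}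
    (h : G.vert x ≠ G.vert y) (h' : G'.vert (f.onH x) ≠ G'.vert (f.onH y)) (hb : y ≠ G.bar x) :
    ∃ f' : Iso (G.contract x y h) (G'.contract (f.onH x) (f.onH y) h'),
      (∀ v, G'.ctrV h' (f'.onV v) = f.onV (G.ctrV h v)) ∧
      (∀ a, G'.ctrH h' (f'.onH a) = f.onH (G.ctrH h a)) ∧
      f.sign * G.contractSign x y = G'.contractSign (f.onH x) (f.onH y) * f'.sign := by
  obtain ⟨f', hV, hH⟩ := exists_iso (A := G.contract x y h)
    (B := G'.contract (f.onH x) (f.onH y) h') (f.onV.injective.comp (G.ctrV_injective h))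
    (G'.ctrV_injective h') (f.onH.injective.comp (G.ctrH_injective h)) (G'.ctrH_injective h')
    (by
      intro v
      obtain ⟨v, rfl⟩ := f.onV.surjective v
      simp [exists_ctrV, f.vert_onH])
    (by
      intro v
      obtain ⟨v, rfl⟩ := f.onH.surjective v
      simp [exists_ctrH])
    (by
      intro a b hab
      simp only [Function.comp_apply] at hab ⊢
      rw [ctrH_bar, ctrH_bar, ← hab]
      simp only [f.bar_onH, f.onH.apply_eq_iff_eq, apply_ite f.onH])
    (by
      intro a b hab
      simp only [Function.comp_apply] at hab ⊢
      rw [ctrV_vert, ctrV_vert, ← hab]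
      simp only [f.vert_onH, f.onV.apply_eq_iff_eq, apply_ite f.onV])
  refine ⟨f', hV, hH, ?_⟩
  have hb' : f.onH y ≠ G'.bar (f.onH x) := by rw [f.bar_onH]; simpa using hb
  rw [contractSign_eq _ hb, contractSign_eq _ hb', f.sign_eq,
    f'.sign_eq_of_strictMono (G'.ctrV_strictMono h') hV, G.vertSign_contract h, ← f.vert_onH,
    G.dirSign_contract h hb f.dir_bar (d' := fun a => (G'.contract _ _ h').dir (f'.onH a))]
  · have aux : ∀ a b c d e1 e2 e3 e4 : ℤˣ, e1 * (e3 * e4) * (a * b * c * d * e2) * (a * b * e3) =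
        c * d * e4 * (e1 * e2) := by
      intro a b c d e1 e2 e3 e4
      have ha : a * a = 1 := Int.units_mul_self _
      have hb : b * b = 1 := Int.units_mul_self _
      have hc : e3 * e3 = 1 := Int.units_mul_self _
      calc _ = (a * a) * (b * b) * (e3 * e3) * (c * d * e4 * (e1 * e2)) := by ac_rfl
        _ = _ := by rw [ha, hb, hc]; simp
    exact aux _ _ _ _ _ _ _ _
  · intro a
    rw [contract_dir, hH]
    simp only [Function.comp_apply, f.bar_onH, f.onH.apply_eq_iff_eq]

/-- Exchanging `x` and `y` lets the merged vertex take the place of `G.vert y` instead of `G.vert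
x`, at the cost of `-1` times both rank signs, and reverses the new edge, for another `-1`. What
remains is the quotient of the two contraction signs. -/
theorem exists_contract_swap (G : OGraph) {x y : G.H} (h : G.vert x ≠ G.vert y)
    (hb : y ≠ G.bar x) :
    ∃ f : Iso (G.contract x y h) (G.contract y x h.symm),
      (∀ a, G.ctrH h.symm (f.onH a) = G.ctrH h a) ∧
      G.contractSign x y = G.contractSign y x * f.sign := by
  have hxy := ne_of_vert_ne h
  have hb' : x ≠ G.bar y := fun e => hb (by rw [e, G.bar_bar])
  obtain ⟨f, hV, hH⟩ := exists_iso (A := G.contract x y h) (B := G.contract y x h.symm)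
    (aV := fun u => if G.ctrV h u = G.vert x then G.vert y else G.ctrV h u)
    (by
      intro a b hab
      have h1 := G.ctrV_ne h a
      have h2 := G.ctrV_ne h b
      apply G.ctrV_injective h
      grind)
    (G.ctrV_injective h.symm) (G.ctrH_injective h) (G.ctrH_injective h.symm)
    (by
      intro v
      have h1 := G.exists_ctrV h
      rw [exists_ctrV]
      constructor
      · rintro ⟨u, rfl⟩
        grind
      · intro hv
        by_cases hvy : v = G.vert y
        · obtain ⟨u, hu⟩ := (h1 (G.vert x)).2 h
          exact ⟨u, by simp [hu, hvy]⟩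
        · obtain ⟨u, hu⟩ := (h1 v).2 hvy
          exact ⟨u, by simp [hu, hv]⟩)
    (by intro v; simp [exists_ctrH, and_comm])
    (by
      intro a b hab
      rw [ctrH_bar, ctrH_bar, ← hab]
      have := G.bar_injective.ne hxy
      grind)
    (by
      intro a b hab
      rw [ctrV_vert, ctrV_vert, ← hab]
      grind)
  refine ⟨f, hH, ?_⟩
  rw [contractSign_eq _ hb, contractSign_eq _ hb',
    f.sign_eq_of_strictMono (G.ctrV_strictMono h.symm) hV, vertSign_contract_replace]
  obtain ⟨X, hX⟩ := (G.exists_ctrH h (G.bar x)).2 ⟨G.bar_ne x, hb.symm⟩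
  obtain ⟨Y, hY⟩ := (G.exists_ctrH h (G.bar y)).2
    ⟨fun e => hb (by rw [← e, G.bar_bar]), G.bar_ne y⟩
  have hXY : X ≠ Y := fun e => hxy (G.bar_injective (by rw [← hX, ← hY, e]))
  rw [dirSign_eq_mul X Y hXY.symm]
  · rw [contract_dir, contract_dir, hH, hX]
    simp only [bar_inj, hxy, if_true, if_false]
    have aux : ∀ a b c d : ℤˣ, a * b * c = b * a * d * (-(d * c) * (-1 * 1)) := by
      intro a b c d
      have hd : d * d = 1 := Int.units_mul_self _
      calc a * b * c = b * a * (d * d) * c := by rw [hd, mul_one, mul_comm a b]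
        _ = _ := by simp only [mul_one, mul_neg, neg_neg]; ac_rfl
    exact aux _ _ _ _
  · rw [contract_dir, contract_dir, hX, hY]
    simp [hxy.symm]
  · rw [contract_dir, contract_dir, hH, hH, hX, hY]
    simp [hxy]
  · intro a ha1 ha2
    have h1 : G.ctrH h a ≠ G.bar x := fun e => ha1 (G.ctrH_injective h (e.trans hX.symm))
    have h2 : G.ctrH h a ≠ G.bar y := fun e => ha2 (G.ctrH_injective h (e.trans hY.symm))
    rw [contract_dir, contract_dir, hH]
    simp [h1, h2]

end OGraph

section Contr

open OGraph

universe u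

variable (k : Type u) [Field k]

/-- The contraction of two half-edges which do not form an edge, as an element of `HG`. -/
noncomputable def contr (G : OGraph) (x y : G.H) : HG k :=
  -- A pair forming an edge never joins the two factors of a bracket, and its `separation` is zero,
  -- so it may be discarded.
  if y = G.bar x then 0 else contraction k G x y

variable {k}

theorem contr_of_ne {G : OGraph} {x y : G.H} (h : G.vert x ≠ G.vert y) (hb : y ≠ G.bar x) :
    contr k G x y = G.contractSign x y • graphClass k (G.contract x y h) := by
  rw [contr, if_neg hb, contraction, dif_pos h]

theorem contr_of_eq_bar {G : OGraph} {x y : G.H} (hb : y = G.bar x) : contr k G x y = 0 :=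
  if_pos hb

theorem contr_of_vert_eq {G : OGraph} {x y : G.H} (h : G.vert x = G.vert y) :
    contr k G x y = 0 := by
  rw [contr, contraction, dif_neg (not_not.2 h), ite_self]

theorem contr_iso {G G' : OGraph} (f : Iso G G') (x y : G.H) :
    contr k G' (f.onH x) (f.onH y) = f.sign • contr k G x y := by
  by_cases hb : y = G.bar x
  · rw [contr_of_eq_bar hb, contr_of_eq_bar (by rw [f.bar_onH, hb]), smul_zero]
  by_cases h : G.vert x = G.vert y
  · rw [contr_of_vert_eq h, contr_of_vert_eq (by rw [f.vert_onH, f.vert_onH, h]), smul_zero]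
  have h' : G'.vert (f.onH x) ≠ G'.vert (f.onH y) := by simpa [f.vert_onH] using h
  obtain ⟨f', -, -, hs⟩ := f.exists_contract h h' hb
  rw [contr_of_ne h hb, contr_of_ne h' (by simpa [f.bar_onH] using hb), graphClass_iso k f',
    smul_smul, smul_smul, hs]

theorem contr_comm (G : OGraph) (x y : G.H) : contr k G x y = contr k G y x := by
  by_cases hb : y = G.bar x
  · rw [contr_of_eq_bar hb, contr_of_eq_bar (by rw [hb, G.bar_bar])]
  by_cases h : G.vert x = G.vert y
  · rw [contr_of_vert_eq h, contr_of_vert_eq h.symm]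
  obtain ⟨f', -, hs⟩ := G.exists_contract_swap h hb
  rw [contr_of_ne h hb, contr_of_ne (Ne.symm h) (fun e => hb (by rw [e, G.bar_bar])),
    graphClass_iso k f', smul_smul, hs]

variable (k)

/-- The condition under which `G_{xy}` is defined and contains `z` and `w`. -/
def OGraph.CanContract₂ (G : OGraph) (x y z w : G.H) : Prop :=
  G.vert x ≠ G.vert y ∧ y ≠ G.bar x ∧ (z ≠ x ∧ z ≠ y) ∧ w ≠ x ∧ w ≠ y

open Classical in
/-- The contraction of two pairs of half-edges, as an element of `HG`. -/
noncomputable def contr₂ (G : OGraph) (x y z w : G.H) : HG k :=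
  if h : G.CanContract₂ x y z w then
    G.contractSign x y • contr k (G.contract x y h.1) (G.toCtrH h.1 z h.2.2.1)
      (G.toCtrH h.1 w h.2.2.2)
  else 0

variable {k}

theorem contr₂_of {G : OGraph} {x y : G.H} (h : G.vert x ≠ G.vert y) (hb : y ≠ G.bar x)
    (z w : (G.contract x y h).H) : contr₂ k G x y (G.ctrH h z) (G.ctrH h w) =
      G.contractSign x y • contr k (G.contract x y h) z w := by
  have hh : G.CanContract₂ x y (G.ctrH h z) (G.ctrH h w) :=
    ⟨h, hb, G.ctrH_ne h z, G.ctrH_ne h w⟩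
  rw [contr₂, dif_pos hh]
  rfl

theorem contr₂_iso {G G' : OGraph} (f : Iso G G') (x y z w : G.H) :
    contr₂ k G' (f.onH x) (f.onH y) (f.onH z) (f.onH w) = f.sign • contr₂ k G x y z w := by
  by_cases h : G.CanContract₂ x y z w
  · obtain ⟨h, hb, hz, hw⟩ := h
    obtain ⟨z, rfl⟩ := (G.exists_ctrH h z).2 hz
    obtain ⟨w, rfl⟩ := (G.exists_ctrH h w).2 hw
    have h' : G'.vert (f.onH x) ≠ G'.vert (f.onH y) := by simpa [f.vert_onH] using h
    have hb' : f.onH y ≠ G'.bar (f.onH x) := by simpa [f.bar_onH] using hb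
    obtain ⟨f', -, hH, hs⟩ := f.exists_contract h h' hb
    rw [← hH, ← hH, contr₂_of h hb, contr₂_of h' hb', contr_iso, smul_smul, smul_smul, hs]
  · rw [contr₂, contr₂, dif_neg h, dif_neg, smul_zero]
    simpa [CanContract₂, f.vert_onH, f.bar_onH] using h

theorem contr₂_comm_right (G : OGraph) (x y z w : G.H) :
    contr₂ k G x y z w = contr₂ k G x y w z := by
  by_cases h : G.CanContract₂ x y z w
  · obtain ⟨h, hb, hz, hw⟩ := h
    obtain ⟨z, rfl⟩ := (G.exists_ctrH h z).2 hz
    obtain ⟨w, rfl⟩ := (G.exists_ctrH h w).2 hw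
    rw [contr₂_of h hb, contr₂_of h hb, contr_comm]
  · rw [contr₂, contr₂, dif_neg h, dif_neg]
    rw [CanContract₂] at h ⊢
    tauto

theorem contr₂_comm_left (G : OGraph) (x y z w : G.H) :
    contr₂ k G x y z w = contr₂ k G y x z w := by
  by_cases h : G.CanContract₂ x y z w
  · obtain ⟨h, hb, hz, hw⟩ := h
    obtain ⟨z, rfl⟩ := (G.exists_ctrH h z).2 hz
    obtain ⟨w, rfl⟩ := (G.exists_ctrH h w).2 hw
    have hb' : x ≠ G.bar y := fun e => hb (by rw [e, G.bar_bar])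
    obtain ⟨f, hf, hs⟩ := G.exists_contract_swap h hb
    rw [contr₂_of h hb, ← hf, ← hf, contr₂_of h.symm hb', contr_iso, smul_smul, hs]
  · rw [contr₂, contr₂, dif_neg h, dif_neg]
    rw [CanContract₂] at h ⊢
    have : x = G.bar y ↔ y = G.bar x := by rw [← G.bar_eq_iff, eq_comm]
    tauto

end Contr

/-! ### Contractions anticommute -/

section Involutions

variable {H : Type*} [DecidableEq H]

/-- The involution on half-edges after contracting `x` and `y`. -/
def ctrBar (bar : H → H) (x y c : H) : H :=
  if c = bar x then bar y else if c = bar y then bar x else bar c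

/-- The directions of half-edges after contracting `x` and `y`. -/
def ctrDir (bar : H → H) (d : H → ℤˣ) (x y c : H) : ℤˣ :=
  if c = bar x then -1 else if c = bar y then 1 else d c

variable {bar : H → H} {x y z w : H}

/-- Both orders cut the same edges and glue the same ends; only the case where a half-edge of one
pair is opposite to one of the other needs attention. The hypotheses `hb3` and `hb4` exclude that
both pairs lie on the same two edges, in which case the first contraction turns the second pair into
an edge. -/
theorem ctrBar_comm (hbar : ∀ a, bar (bar a) = a) (hxy : x ≠ y) (hzw : z ≠ w)
    (hz : z ≠ x ∧ z ≠ y) (hw : w ≠ x ∧ w ≠ y)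
    (hb1 : y ≠ bar x) (hb2 : w ≠ bar z) (hb3 : ¬ (z = bar x ∧ w = bar y))
    (hb4 : ¬ (z = bar y ∧ w = bar x)) {c : H} (hc : (c ≠ x ∧ c ≠ y) ∧ c ≠ z ∧ c ≠ w) :
    ctrBar (ctrBar bar x y) z w c = ctrBar (ctrBar bar z w) x y c := by
  unfold ctrBar
  by_cases h1 : z = bar x
  · subst h1; grind
  by_cases h2 : z = bar y
  · subst h2; grind
  by_cases h3 : w = bar x
  · subst h3; grind
  by_cases h4 : w = bar y
  · subst h4; grind
  grind

/-- If no edge is shared between the two pairs, the two new edges are directed independently. -/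
theorem ctrDir_comm (hbar : ∀ a, bar (bar a) = a) {d : H → ℤˣ}
    (h1 : z ≠ bar x) (h2 : z ≠ bar y) (h3 : w ≠ bar x) (h4 : w ≠ bar y)
    (hxy : x ≠ y) (hz : z ≠ x ∧ z ≠ y) (hw : w ≠ x ∧ w ≠ y) (c : H) :
    ctrDir (ctrBar bar x y) (ctrDir bar d x y) z w c =
      ctrDir (ctrBar bar z w) (ctrDir bar d z w) x y c := by
  unfold ctrDir ctrBar
  have : ∀ a b, bar a = bar b → a = b := fun a b h => by rw [← hbar a, h, hbar]
  grind

/-- If the two pairs share an edge, the double contraction fuses three edges into one, and this is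
the only edge whose direction can depend on the order. The half-edge `g` is `bar y` or `bar x`, the
one opposite to the member of the first pair that is not on the shared edge. -/
theorem ctrDir_adjacent (hbar : ∀ a, bar (bar a) = a) (hne : ∀ a, bar a ≠ a)
    {d : H → ℤˣ} (hd : ∀ a, d (bar a) = - d a)
    (hxy : x ≠ y) (hzw : z ≠ w)
    (hz : z ≠ x ∧ z ≠ y) (hw : w ≠ x ∧ w ≠ y)
    (hb1 : y ≠ bar x) (hb2 : w ≠ bar z) (hb3 : ¬ (z = bar x ∧ w = bar y))
    (hb4 : ¬ (z = bar y ∧ w = bar x)) (h : z = bar x ∨ z = bar y ∨ w = bar x ∨ w = bar y) :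
    ∃ g, ((g ≠ x ∧ g ≠ y) ∧ g ≠ z ∧ g ≠ w) ∧
      (∀ c, ((c ≠ x ∧ c ≠ y) ∧ c ≠ z ∧ c ≠ w) → c ≠ g → c ≠ ctrBar (ctrBar bar x y) z w g →
        ctrDir (ctrBar bar x y) (ctrDir bar d x y) z w c =
        ctrDir (ctrBar bar z w) (ctrDir bar d z w) x y c) ∧
      ctrDir (ctrBar bar x y) (ctrDir bar d x y) z w g *
        ctrDir (ctrBar bar z w) (ctrDir bar d z w) x y g =
      d x * d y * (d z * d w) * (ctrDir bar d x y z * ctrDir bar d x y w *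
        (ctrDir bar d z w x * ctrDir bar d z w y)) := by
  have hinj : ∀ a b, bar a = bar b → a = b := fun a b h => by rw [← hbar a, h, hbar]
  have hsq : ∀ a, d a * d a = 1 := fun a => Int.units_mul_self _
  -- With this, each of the four adjacency cases only has to supply `g` and the values of the six
  -- directions involved.
  have fin : ∀ (g : H) (e1 e2 e3 e4 e5 e6 : ℤˣ), ((g ≠ x ∧ g ≠ y) ∧ g ≠ z ∧ g ≠ w) →
      ctrDir (ctrBar bar x y) (ctrDir bar d x y) z w g = e1 →
      ctrDir (ctrBar bar z w) (ctrDir bar d z w) x y g = e2 →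
      ctrDir bar d x y z = e3 → ctrDir bar d x y w = e4 →
      ctrDir bar d z w x = e5 → ctrDir bar d z w y = e6 →
      e1 * e2 = d x * d y * (d z * d w) * (e3 * e4 * (e5 * e6)) →
      (∀ c, ((c ≠ x ∧ c ≠ y) ∧ c ≠ z ∧ c ≠ w) → c ≠ g → c ≠ ctrBar (ctrBar bar x y) z w g →
        ctrDir (ctrBar bar x y) (ctrDir bar d x y) z w c =
        ctrDir (ctrBar bar z w) (ctrDir bar d z w) x y c) →
    ∃ g, ((g ≠ x ∧ g ≠ y) ∧ g ≠ z ∧ g ≠ w) ∧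
      (∀ c, ((c ≠ x ∧ c ≠ y) ∧ c ≠ z ∧ c ≠ w) → c ≠ g → c ≠ ctrBar (ctrBar bar x y) z w g →
        ctrDir (ctrBar bar x y) (ctrDir bar d x y) z w c =
        ctrDir (ctrBar bar z w) (ctrDir bar d z w) x y c) ∧
      ctrDir (ctrBar bar x y) (ctrDir bar d x y) z w g *
        ctrDir (ctrBar bar z w) (ctrDir bar d z w) x y g =
      d x * d y * (d z * d w) * (ctrDir bar d x y z * ctrDir bar d x y w *
        (ctrDir bar d z w x * ctrDir bar d z w y)) := by
    intro g e1 e2 e3 e4 e5 e6 hg h1 h2 h3 h4 h5 h6 h7 h8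
    exact ⟨g, hg, h8, by rw [h1, h2, h3, h4, h5, h6, h7]⟩
  have hu : ∀ a : H, d a = 1 ∨ d a = -1 := fun a => Int.units_eq_one_or _
  rcases h with rfl | rfl | rfl | rfl
  · have e : w ≠ bar y := fun e => hb3 ⟨rfl, e⟩
    refine fin (bar y) (-1) 1 (-1) (d w) (-1) (d y) (by grind) ?_ ?_ ?_ ?_ ?_ ?_ ?_ ?_
    · unfold ctrDir ctrBar; grind
    · unfold ctrDir ctrBar; grind
    · unfold ctrDir; grind
    · unfold ctrDir; grind
    · unfold ctrDir; grind
    · unfold ctrDir; grind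
    · rw [hd]
      rcases hu x with h | h <;> rcases hu y with h' | h' <;> rcases hu w with h'' | h'' <;>
        simp [h, h', h'']
    · unfold ctrDir ctrBar; grind
  · have e : w ≠ bar x := fun e => hb4 ⟨rfl, e⟩
    refine fin (bar x) (-1) (-1) 1 (d w) (d x) (-1) (by grind) ?_ ?_ ?_ ?_ ?_ ?_ ?_ ?_
    · unfold ctrDir ctrBar; grind
    · unfold ctrDir ctrBar; grind
    · unfold ctrDir; grind
    · unfold ctrDir; grind
    · unfold ctrDir; grind
    · unfold ctrDir; grind
    · rw [hd]
      rcases hu x with h | h <;> rcases hu y with h' | h' <;> rcases hu w with h'' | h'' <;>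
        simp [h, h', h'']
    · unfold ctrDir ctrBar; grind
  · have e : z ≠ bar y := fun e => hb4 ⟨e, rfl⟩
    refine fin (bar y) 1 1 (d z) (-1) 1 (d y) (by grind) ?_ ?_ ?_ ?_ ?_ ?_ ?_ ?_
    · unfold ctrDir ctrBar; grind
    · unfold ctrDir ctrBar; grind
    · unfold ctrDir; grind
    · unfold ctrDir; grind
    · unfold ctrDir; grind
    · unfold ctrDir; grind
    · rw [hd]
      rcases hu x with h | h <;> rcases hu y with h' | h' <;> rcases hu z with h'' | h'' <;>
        simp [h, h', h'']
    · unfold ctrDir ctrBar; grind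
  · have e : z ≠ bar x := fun e => hb3 ⟨e, rfl⟩
    refine fin (bar x) 1 (-1) (d z) 1 (d x) 1 (by grind) ?_ ?_ ?_ ?_ ?_ ?_ ?_ ?_
    · unfold ctrDir ctrBar; grind
    · unfold ctrDir ctrBar; grind
    · unfold ctrDir; grind
    · unfold ctrDir; grind
    · unfold ctrDir; grind
    · unfold ctrDir; grind
    · rw [hd]
      rcases hu x with h | h <;> rcases hu y with h' | h' <;> rcases hu z with h'' | h'' <;>
        simp [h, h', h'']
    · unfold ctrDir ctrBar; grind

end Involutions

section Anticommute

open OGraph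

variable {k : Type*} [Field k]

theorem OGraph.exists_ctrV_ctrV (G : OGraph) {x y : G.H} (h1 : G.vert x ≠ G.vert y)
    {z w : (G.contract x y h1).H} (h2 : (G.contract x y h1).vert z ≠ (G.contract x y h1).vert w)
    (v : G.V) : (∃ u, G.ctrV h1 ((G.contract x y h1).ctrV h2 u) = v) ↔
      v ≠ G.vert y ∧ v ≠ G.ctrV h1 ((G.contract x y h1).vert w) := by
  rw [← G.exists_ctrV h1]
  constructor
  · rintro ⟨u, rfl⟩
    refine ⟨⟨_, rfl⟩, ?_⟩
    rw [(G.ctrV_injective h1).ne_iff]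
    exact (G.contract x y h1).ctrV_ne h2 u
  · rintro ⟨⟨u, rfl⟩, hu⟩
    rw [(G.ctrV_injective h1).ne_iff, ← (G.contract x y h1).exists_ctrV h2] at hu
    obtain ⟨u, rfl⟩ := hu
    exact ⟨u, rfl⟩

theorem OGraph.exists_ctrH_ctrH (G : OGraph) {x y : G.H} (h1 : G.vert x ≠ G.vert y)
    {z w : (G.contract x y h1).H} (h2 : (G.contract x y h1).vert z ≠ (G.contract x y h1).vert w)
    (v : G.H) : (∃ u, G.ctrH h1 ((G.contract x y h1).ctrH h2 u) = v) ↔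
      (v ≠ x ∧ v ≠ y) ∧ v ≠ G.ctrH h1 z ∧ v ≠ G.ctrH h1 w := by
  rw [← G.exists_ctrH h1]
  constructor
  · rintro ⟨u, rfl⟩
    refine ⟨⟨_, rfl⟩, ?_⟩
    rw [(G.ctrH_injective h1).ne_iff, (G.ctrH_injective h1).ne_iff]
    exact (G.contract x y h1).ctrH_ne h2 u
  · rintro ⟨⟨u, rfl⟩, hu⟩
    rw [(G.ctrH_injective h1).ne_iff, (G.ctrH_injective h1).ne_iff,
      ← (G.contract x y h1).exists_ctrH h2] at hu
    obtain ⟨u, rfl⟩ := hu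
    exact ⟨u, rfl⟩

theorem OGraph.ctrH_bar_eq (G : OGraph) {x y : G.H} (h : G.vert x ≠ G.vert y)
    (a : (G.contract x y h).H) :
    G.ctrH h ((G.contract x y h).bar a) = ctrBar G.bar x y (G.ctrH h a) := rfl

theorem OGraph.contract_dir_eq (G : OGraph) {x y : G.H} (h : G.vert x ≠ G.vert y)
    (a : (G.contract x y h).H) :
    (G.contract x y h).dir a = ctrDir G.bar G.dir x y (G.ctrH h a) := rfl

theorem OGraph.ctrH_ctrH_bar (G : OGraph) {x y : G.H} (h1 : G.vert x ≠ G.vert y)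
    {z w : (G.contract x y h1).H} (h2 : (G.contract x y h1).vert z ≠ (G.contract x y h1).vert w)
    (a : ((G.contract x y h1).contract z w h2).H) :
    G.ctrH h1 ((G.contract x y h1).ctrH h2 (((G.contract x y h1).contract z w h2).bar a)) =
      ctrBar (ctrBar G.bar x y) (G.ctrH h1 z) (G.ctrH h1 w)
        (G.ctrH h1 ((G.contract x y h1).ctrH h2 a)) := by
  rw [ctrH_bar]
  simp only [apply_ite (G.ctrH h1), ← (G.ctrH_injective h1).eq_iff, ctrH_bar_eq]
  rfl

theorem OGraph.contract_contract_dir (G : OGraph) {x y : G.H} (h1 : G.vert x ≠ G.vert y)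
    {z w : (G.contract x y h1).H} (h2 : (G.contract x y h1).vert z ≠ (G.contract x y h1).vert w)
    (a : ((G.contract x y h1).contract z w h2).H) :
    ((G.contract x y h1).contract z w h2).dir a =
      ctrDir (ctrBar G.bar x y) (ctrDir G.bar G.dir x y) (G.ctrH h1 z) (G.ctrH h1 w)
        (G.ctrH h1 ((G.contract x y h1).ctrH h2 a)) := by
  rw [contract_dir]
  simp only [← (G.ctrH_injective h1).eq_iff, ctrH_bar_eq]
  rfl

/-- Since `G.vert w ≠ G.vert y`, both orders delete the same two vertices and keep the names of all
others; hence the isomorphism preserves the vertex order. -/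
theorem OGraph.exists_iso_contract_contract (G : OGraph) {x y z w : G.H}
    (h1 : G.vert x ≠ G.vert y) (hz : z ≠ x ∧ z ≠ y) (hw : w ≠ x ∧ w ≠ y)
    (h2 : (G.contract x y h1).vert (G.toCtrH h1 z hz) ≠
      (G.contract x y h1).vert (G.toCtrH h1 w hw))
    (h3 : G.vert z ≠ G.vert w) (hx : x ≠ z ∧ x ≠ w) (hy : y ≠ z ∧ y ≠ w)
    (h4 : (G.contract z w h3).vert (G.toCtrH h3 x hx) ≠
      (G.contract z w h3).vert (G.toCtrH h3 y hy))
    (hb1 : y ≠ G.bar x) (hb2 : w ≠ G.bar z) (hb3 : ¬ (z = G.bar x ∧ w = G.bar y))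
    (hb4 : ¬ (z = G.bar y ∧ w = G.bar x)) (hwy : G.vert w ≠ G.vert y) :
    ∃ f : Iso ((G.contract x y h1).contract _ _ h2) ((G.contract z w h3).contract _ _ h4),
      StrictMono f.onV ∧ ∀ a, G.ctrH h3 ((G.contract z w h3).ctrH h4 (f.onH a)) =
        G.ctrH h1 ((G.contract x y h1).ctrH h2 a) := by
  have e2 := (G.ctrV_injective h1).ne h2
  have e4 := (G.ctrV_injective h3).ne h4
  rw [ctrV_vert, ctrV_vert, ctrH_toCtrH, ctrH_toCtrH] at e2 e4
  have hmA := (G.ctrV_strictMono h1).comp ((G.contract x y h1).ctrV_strictMono h2)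
  have hmB := (G.ctrV_strictMono h3).comp ((G.contract z w h3).ctrV_strictMono h4)
  have hrA := G.exists_ctrV_ctrV h1 h2
  have hrB := G.exists_ctrV_ctrV h3 h4
  rw [ctrV_vert, ctrH_toCtrH, if_neg hwy] at hrA
  rw [ctrV_vert, ctrH_toCtrH, if_neg hwy.symm] at hrB
  have hrA' := G.exists_ctrH_ctrH h1 h2
  have hrB' := G.exists_ctrH_ctrH h3 h4
  obtain ⟨f, hV, hH⟩ := exists_iso hmA.injective hmB.injective
    ((G.ctrH_injective h1).comp ((G.contract x y h1).ctrH_injective h2))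
    ((G.ctrH_injective h3).comp ((G.contract z w h3).ctrH_injective h4))
    (fun v => (hrA v).trans (and_comm.trans (hrB v).symm))
    (fun v => (hrA' v).trans (and_comm.trans (hrB' v).symm))
    (by
      intro a b hab
      have ha := (hrA' _).1 ⟨a, rfl⟩
      simp only [Function.comp_apply, ctrH_toCtrH] at hab ha ⊢
      rw [ctrH_ctrH_bar, ctrH_ctrH_bar, ← hab]
      exact ctrBar_comm G.bar_bar (ne_of_vert_ne h1) (ne_of_vert_ne h3) hz hw hb1 hb2 hb3 hb4 ha)
    (by
      intro a b hab
      have ha := (hrA' _).1 ⟨a, rfl⟩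
      simp only [Function.comp_apply, ctrH_toCtrH] at hab ha ⊢
      simp only [ctrV_vert, apply_ite (G.ctrV h1), apply_ite (G.ctrV h3), ctrH_toCtrH,
        ← (G.ctrV_injective h1).eq_iff, ← (G.ctrV_injective h3).eq_iff, ← hab]
      generalize G.ctrH h1 ((G.contract x y h1).ctrH h2 a) = c at *
      clear * - h1 h3 hwy e2 e4
      grind)
  refine ⟨f, fun a b hab => ?_, hH⟩
  rw [← hmB.lt_iff_lt, hV, hV]
  exact hmA hab

theorem OGraph.dirSign_contract_contract (G : OGraph) {x y z w : G.H}
    (h1 : G.vert x ≠ G.vert y) (hz : z ≠ x ∧ z ≠ y) (hw : w ≠ x ∧ w ≠ y)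
    (h2 : (G.contract x y h1).vert (G.toCtrH h1 z hz) ≠
      (G.contract x y h1).vert (G.toCtrH h1 w hw))
    (h3 : G.vert z ≠ G.vert w) (hx : x ≠ z ∧ x ≠ w) (hy : y ≠ z ∧ y ≠ w)
    (h4 : (G.contract z w h3).vert (G.toCtrH h3 x hx) ≠
      (G.contract z w h3).vert (G.toCtrH h3 y hy))
    (hb1 : y ≠ G.bar x) (hb2 : w ≠ G.bar z) (hb3 : ¬ (z = G.bar x ∧ w = G.bar y))
    (hb4 : ¬ (z = G.bar y ∧ w = G.bar x))
    (f : Iso ((G.contract x y h1).contract _ _ h2) ((G.contract z w h3).contract _ _ h4))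
    (hf : ∀ a, G.ctrH h3 ((G.contract z w h3).ctrH h4 (f.onH a)) =
        G.ctrH h1 ((G.contract x y h1).ctrH h2 a)) :
    dirSign ((G.contract x y h1).contract _ _ h2).dir
        (fun a => ((G.contract z w h3).contract _ _ h4).dir (f.onH a)) =
      G.dir x * G.dir y * (G.dir z * G.dir w) *
      ((G.contract x y h1).dir (G.toCtrH h1 z hz) * (G.contract x y h1).dir (G.toCtrH h1 w hw) *
      ((G.contract z w h3).dir (G.toCtrH h3 x hx) *
        (G.contract z w h3).dir (G.toCtrH h3 y hy))) := by
  have hinj : Function.Injective fun a => G.ctrH h1 ((G.contract x y h1).ctrH h2 a) :=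
    (G.ctrH_injective h1).comp ((G.contract x y h1).ctrH_injective h2)
  have hr := G.exists_ctrH_ctrH h1 h2
  simp only [ctrH_toCtrH] at hr
  have hxy := ne_of_vert_ne h1
  have hzw := ne_of_vert_ne h3
  have hdA := G.contract_contract_dir h1 h2
  have hdB := fun a => (G.contract_contract_dir h3 h4 (f.onH a))
  simp only [hf, ctrH_toCtrH] at hdA hdB
  rw [G.contract_dir_eq h1 (G.toCtrH h1 z hz), G.contract_dir_eq h1 (G.toCtrH h1 w hw),
    G.contract_dir_eq h3 (G.toCtrH h3 x hx), G.contract_dir_eq h3 (G.toCtrH h3 y hy)]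
  simp only [ctrH_toCtrH]
  by_cases hc : z = G.bar x ∨ z = G.bar y ∨ w = G.bar x ∨ w = G.bar y
  · obtain ⟨g, hg, h5, h6⟩ := ctrDir_adjacent G.bar_bar G.bar_ne G.dir_bar hxy hzw hz hw hb1 hb2
      hb3 hb4 hc
    obtain ⟨g, rfl⟩ := (hr g).2 hg
    rw [← h6, dirSign_eq_mul g (OGraph.bar _ g) (OGraph.bar_ne _ g) (OGraph.dir_bar _ g)
      (f.dir_bar g)]
    · rw [hdA, hdB]
    · intro a h7 h8
      rw [hdA, hdB]
      refine (h5 _ ((hr _).1 ⟨a, rfl⟩) (hinj.ne h7) ?_).symm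
      have := hinj.ne h8
      simp only [ctrH_ctrH_bar] at this
      exact this
  · simp only [not_or] at hc
    obtain ⟨c1, c2, c3, c4⟩ := hc
    rw [dirSign_eq_one]
    · have c1' : x ≠ G.bar z := fun e => c1 (by rw [e, G.bar_bar])
      have c2' : y ≠ G.bar z := fun e => c2 (by rw [e, G.bar_bar])
      have c3' : x ≠ G.bar w := fun e => c3 (by rw [e, G.bar_bar])
      have c4' : y ≠ G.bar w := fun e => c4 (by rw [e, G.bar_bar])
      simp only [ctrDir, c1, c2, c3, c4, c1', c2', c3', c4', if_false]
      rw [mul_comm (G.dir z * G.dir w) (G.dir x * G.dir y), Int.units_mul_self]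
    · intro a
      rw [hdA, hdB]
      exact (ctrDir_comm G.bar_bar c1 c2 c3 c4 hxy hz hw _).symm

/-- If `z` and `w` end at one vertex, or form an edge, they still do so after `x` and `y` have been
contracted. -/
theorem contr₂_eq_zero_of_not (G : OGraph) {x y z w : G.H} (h : ¬ G.CanContract₂ z w x y) :
    contr₂ k G x y z w = 0 := by
  by_cases h1 : G.CanContract₂ x y z w
  · rw [contr₂, dif_pos h1]
    obtain ⟨h1, hb, hz, hw⟩ := h1
    simp only [CanContract₂, hz.1.symm, hz.2.symm, hw.1.symm, hw.2.symm, ne_eq, not_false_eq_true,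
      and_true, not_and_or, not_not] at h
    rcases h with h | h
    · rw [contr_of_vert_eq, smul_zero]
      apply G.ctrV_injective h1
      rw [ctrV_vert, ctrV_vert, ctrH_toCtrH, ctrH_toCtrH, h]
    · rw [contr_of_eq_bar, smul_zero]
      apply G.ctrH_injective h1
      rw [ctrH_bar, ctrH_toCtrH, ctrH_toCtrH, if_neg, if_neg, h]
      · rintro rfl
        exact hw.2 (by rw [h, G.bar_bar])
      · rintro rfl
        exact hw.1 (by rw [h, G.bar_bar])
  · rw [contr₂, dif_neg h1]

/-- All direction signs occur twice and cancel. Deleting `G.vert y` first shifts the rank of `G.vert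
w` if it precedes it, and conversely. Exactly one of these shifts happens, which leaves one factor
`-1`. -/
theorem contr₂_anticomm (G : OGraph) (x y z w : G.H) :
    contr₂ k G x y z w = - contr₂ k G z w x y := by
  by_cases hh : G.CanContract₂ x y z w
  swap
  · rw [contr₂_eq_zero_of_not G hh, contr₂, dif_neg hh, neg_zero]
  by_cases hh' : G.CanContract₂ z w x y
  swap
  · rw [contr₂_eq_zero_of_not G hh', contr₂, dif_neg hh', neg_zero]
  -- If `w` and `y` end at the same vertex then `z` and `y` do not, and the symmetry of contractions
  -- exchanges `z` and `w`.
  wlog hwy : G.vert w ≠ G.vert y generalizing z w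
  · have hzy : G.vert z ≠ G.vert y := fun e => hh'.1 (e.trans (not_not.1 hwy).symm)
    rw [contr₂_comm_right, contr₂_comm_left G z w]
    have hbar : w ≠ G.bar z ↔ z ≠ G.bar w := by
      rw [not_iff_not, eq_comm, G.bar_eq_iff]
    refine this w z ?_ ?_ hzy
    · exact ⟨hh.1, hh.2.1, hh.2.2.2, hh.2.2.1⟩
    · exact ⟨hh'.1.symm, hbar.1 hh'.2.1, hh'.2.2.1.symm, hh'.2.2.2.symm⟩
  obtain ⟨h1, hb1, hz, hw⟩ := hh
  obtain ⟨h3, hb2, hx, hy⟩ := hh'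
  have hxy := ne_of_vert_ne h1
  have hzw := ne_of_vert_ne h3
  have hbb := G.bar_bar
  have hbn := G.bar_ne
  have hh1 : G.CanContract₂ x y z w := ⟨h1, hb1, hz, hw⟩
  have hh2 : G.CanContract₂ z w x y := ⟨h3, hb2, hx, hy⟩
  rw [contr₂, dif_pos hh1, contr₂, dif_pos hh2]
  -- Both pairs lie on the same two edges: after either contraction the other pair is an edge, and
  -- both sides vanish.
  by_cases hb3 : (z = G.bar x ∧ w = G.bar y) ∨ (z = G.bar y ∧ w = G.bar x)
  · rw [contr_of_eq_bar, contr_of_eq_bar, smul_zero, smul_zero, neg_zero]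
    · apply G.ctrH_injective h3
      rw [ctrH_bar_eq, ctrH_toCtrH, ctrH_toCtrH, ctrBar]
      grind
    · apply G.ctrH_injective h1
      rw [ctrH_bar_eq, ctrH_toCtrH, ctrH_toCtrH, ctrBar]
      grind
  have e1 : G.toCtrH h1 w hw ≠ (G.contract x y h1).bar (G.toCtrH h1 z hz) := by
    rw [← (G.ctrH_injective h1).ne_iff, ctrH_bar_eq, ctrH_toCtrH, ctrH_toCtrH, ctrBar]
    grind
  have e2 : G.toCtrH h3 y hy ≠ (G.contract z w h3).bar (G.toCtrH h3 x hx) := by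
    rw [← (G.ctrH_injective h3).ne_iff, ctrH_bar_eq, ctrH_toCtrH, ctrH_toCtrH, ctrBar]
    grind
  have hv : (G.contract x y h1).vert (G.toCtrH h1 z hz) = (G.contract x y h1).vert (G.toCtrH h1 w hw)
      ↔ (G.contract z w h3).vert (G.toCtrH h3 x hx) =
        (G.contract z w h3).vert (G.toCtrH h3 y hy) := by
    rw [← (G.ctrV_injective h1).eq_iff, ← (G.ctrV_injective h3).eq_iff, ctrV_vert, ctrV_vert,
      ctrV_vert, ctrV_vert]
    simp only [ctrH_toCtrH]
    clear * - h1 h3 hwy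
    grind
  by_cases h2 : (G.contract x y h1).vert (G.toCtrH h1 z hz) =
      (G.contract x y h1).vert (G.toCtrH h1 w hw)
  · rw [contr_of_vert_eq h2, contr_of_vert_eq (hv.1 h2), smul_zero, smul_zero, neg_zero]
  have h4 := fun h => h2 (hv.2 h)
  rw [not_or] at hb3
  obtain ⟨f, hfm, hf⟩ := G.exists_iso_contract_contract h1 hz hw h2 h3 hx hy h4 hb1 hb2 hb3.1 hb3.2
    hwy
  rw [contr_of_ne h2 e1, contr_of_ne h4 e2, graphClass_iso k f, f.sign_eq,
    vertSign_of_strictMono hfm, one_mul,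
    G.dirSign_contract_contract h1 hz hw h2 h3 hx hy h4 hb1 hb2 hb3.1 hb3.2 f hf,
    contractSign_eq _ hb1, contractSign_eq _ hb2, contractSign_eq _ e1, contractSign_eq _ e2]
  -- The two `ordSign` factors that enter here are opposite, the only source of the minus sign.
  have r1 := G.rankSign_ctrV h1 ((G.contract x y h1).vert (G.toCtrH h1 w hw))
  have r2 := G.rankSign_ctrV h3 ((G.contract z w h3).vert (G.toCtrH h3 y hy))
  rw [ctrV_vert, ctrH_toCtrH, if_neg hwy] at r1
  rw [ctrV_vert, ctrH_toCtrH, if_neg hwy.symm, ordSign_swap hwy] at r2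
  rw [r1, r2]
  generalize graphClass k _ = X
  simp only [smul_smul, ← Units.neg_smul]
  congr 1
  have aux : ∀ d1 d2 d3 d4 d5 d6 d7 d8 s s' o : ℤˣ,
      d5 * d6 * (s' * -o) * (d1 * d2 * s) = -(d7 * d8 * (s * o) * (d3 * d4 * s' *
        (d5 * d6 * (d7 * d8) * (d1 * d2 * (d3 * d4))))) := by
    intro d1 d2 d3 d4 d5 d6 d7 d8 s s' o
    have sq : ∀ a : ℤˣ, a * a = 1 := Int.units_mul_self
    calc _ = -(d5 * d6 * (s' * o) * (d1 * d2 * s)) := by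
          simp only [mul_neg, neg_mul]
      _ = -(d5 * d6 * (s' * o) * (d1 * d2 * s) *
          (((d7 * d8) * (d7 * d8)) * ((d3 * d4) * (d3 * d4)))) := by
          rw [sq, sq, one_mul, mul_one]
      _ = _ := by congr 1; ac_rfl
  exact aux _ _ _ _ _ _ _ _ _ _ _

end Anticommute

/-! ### Isomorphisms of disjoint unions -/

namespace OGraph

variable {G K L G' K' : OGraph}

/-- The identity isomorphism. -/
def Iso.refl (G : OGraph) : Iso G G := ⟨Equiv.refl _, Equiv.refl _, fun _ => rfl, fun _ => rfl⟩

theorem Iso.sign_refl (G : OGraph) : (Iso.refl G).sign = 1 :=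
  Iso.sign_eq_one _ (fun _ _ h => h) fun _ => rfl

theorem Iso.sign_disjUnion (F : Iso (G.disjUnion K) L) :
    F.sign = vertSign (fun v => F.onV (inlV G K v)) * vertSign (fun v => F.onV (inrV G K v)) *
      (∏ v, ∏ w, ordSign (F.onV (inlV G K v)) (F.onV (inrV G K w))) *
      (dirSign G.dir (fun h => L.dir (F.onH (inlH G K h))) *
        dirSign K.dir (fun h => L.dir (F.onH (inrH G K h)))) := by
  rw [F.sign_eq]
  congr 1
  · refine (vertSign_split (e := (toLex : G.V ⊕ K.V ≃ (G.disjUnion K).V)) (inlV_strictMono G K)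
      (inrV_strictMono G K) F.onV.injective).trans ?_
    congr 1
    refine Finset.prod_congr rfl fun v _ => Finset.prod_congr rfl fun w _ => ?_
    have h : ordSign (inlV G K v) (inrV G K w) = 1 := if_pos (inlV_lt_inrV G K v w)
    exact (congrArg (· * _) h).trans (one_mul _)
  · exact Fintype.prod_sum_type _

/-- An isomorphism out of a disjoint union is determined by its values on the two parts. -/
theorem exists_iso_disjUnion {f : G.V → L.V} {g : K.V → L.V} {φ : G.H → L.H} {ψ : K.H → L.H}
    (hf : Function.Injective f) (hg : Function.Injective g) (hfg : ∀ v w, f v ≠ g w)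
    (hV : ∀ u, (∃ v, f v = u) ∨ ∃ v, g v = u)
    (hφ : Function.Injective φ) (hψ : Function.Injective ψ) (hφψ : ∀ v w, φ v ≠ ψ w)
    (hH : ∀ u, (∃ v, φ v = u) ∨ ∃ v, ψ v = u)
    (h1 : ∀ v, L.bar (φ v) = φ (G.bar v)) (h2 : ∀ v, L.bar (ψ v) = ψ (K.bar v))
    (h3 : ∀ v, L.vert (φ v) = f (G.vert v)) (h4 : ∀ v, L.vert (ψ v) = g (K.vert v)) :
    ∃ F : Iso (G.disjUnion K) L,
      (∀ v, F.onV (inlV G K v) = f v) ∧ (∀ v, F.onV (inrV G K v) = g v) ∧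
      (∀ v, F.onH (inlH G K v) = φ v) ∧ (∀ v, F.onH (inrH G K v) = ψ v) := by
  obtain ⟨F, hV, hH⟩ := exists_iso (A := G.disjUnion K) (B := L)
    (aV := elimV f g) (bV := id) (bH := id) (aH := elimH φ ψ)
    (by
      intro a b
      revert a b
      simp [forall_disjUnionV, hf.eq_iff, hg.eq_iff, hfg, (hfg _ _).symm])
    Function.injective_id
    (by
      intro a b
      revert a b
      simp [forall_disjUnionH, hφ.eq_iff, hψ.eq_iff, hφψ, (hφψ _ _).symm])
    Function.injective_id
    (by simpa [exists_disjUnionV] using hV)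
    (by simpa [exists_disjUnionH] using hH)
    (by simp [forall_disjUnionH, h1, h2])
    (by simp [forall_disjUnionH, h3, h4])
  simp only [forall_disjUnionV, forall_disjUnionH, elimV_inlV, elimV_inrV, elimH_inlH, elimH_inrH,
    id] at hV hH
  exact ⟨F, hV.1, hV.2, hH.1, hH.2⟩

theorem exists_iso_disjUnion_map (f : Iso G G') (g : Iso K K') :
    ∃ F : Iso (G.disjUnion K) (G'.disjUnion K'),
      (∀ v, F.onH (inlH G K v) = inlH G' K' (f.onH v)) ∧
      (∀ v, F.onH (inrH G K v) = inrH G' K' (g.onH v)) ∧ F.sign = f.sign * g.sign := by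
  obtain ⟨F, hV1, hV2, hH1, hH2⟩ := exists_iso_disjUnion (G := G) (K := K) (L := G'.disjUnion K')
    (f := fun v => inlV G' K' (f.onV v)) (g := fun v => inrV G' K' (g.onV v))
    (φ := fun v => inlH G' K' (f.onH v)) (ψ := fun v => inrH G' K' (g.onH v))
    ((inlV_injective _ _).comp f.onV.injective) ((inrV_injective _ _).comp g.onV.injective)
    (by simp) (by
      rw [forall_disjUnionV]
      exact ⟨fun v => Or.inl ⟨f.onV.symm v, by simp⟩, fun v => Or.inr ⟨g.onV.symm v, by simp⟩⟩)
    ((inlH_injective _ _).comp f.onH.injective) ((inrH_injective _ _).comp g.onH.injective)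
    (by simp) (by
      rw [forall_disjUnionH]
      exact ⟨fun v => Or.inl ⟨f.onH.symm v, by simp⟩, fun v => Or.inr ⟨g.onH.symm v, by simp⟩⟩)
    (by simp [f.bar_onH]) (by simp [g.bar_onH]) (by simp [f.vert_onH]) (by simp [g.vert_onH])
  refine ⟨F, hH1, hH2, ?_⟩
  have h1 : ∀ v w, ordSign (inlV G' K' (f.onV v)) (inrV G' K' (g.onV w)) = 1 :=
    fun v w => if_pos (inlV_lt_inrV _ _ _ _)
  simp only [F.sign_disjUnion, hV1, hV2, hH1, hH2, f.sign_eq, g.sign_eq, dir_inlH, dir_inrH, h1,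
    Finset.prod_const_one]
  rw [vertSign_comp_strictMono (inlV_strictMono G' K'),
    vertSign_comp_strictMono (inrV_strictMono G' K')]
  ac_rfl

variable (G K L)

theorem exists_iso_disjUnion_comm :
    ∃ F : Iso (G.disjUnion K) (K.disjUnion G),
      (∀ v, F.onH (inlH G K v) = inrH K G v) ∧ (∀ v, F.onH (inrH G K v) = inlH K G v) ∧
      F.sign = (-1) ^ (G.degree * K.degree) := by
  obtain ⟨F, hV1, hV2, hH1, hH2⟩ := exists_iso_disjUnion (G := G) (K := K) (L := K.disjUnion G)
    (f := inrV K G) (g := inlV K G) (φ := inrH K G) (ψ := inlH K G)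
    (inrV_injective _ _) (inlV_injective _ _)
    (by simp) (by simp [forall_disjUnionV]) (inrH_injective _ _) (inlH_injective _ _)
    (by simp) (by simp [forall_disjUnionH]) (by simp) (by simp) (by simp) (by simp)
  refine ⟨F, hH1, hH2, ?_⟩
  have h1 : ∀ v w, ordSign (inrV K G v) (inlV K G w) = -1 :=
    fun v w => if_neg (inlV_lt_inrV _ _ _ _).not_gt
  simp only [F.sign_disjUnion, hV1, hV2, hH1, hH2, h1, Finset.prod_const, Finset.card_univ,
    dir_inlH, dir_inrH]
  rw [vertSign_of_strictMono (inrV_strictMono K G), vertSign_of_strictMono (inlV_strictMono K G),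
    dirSign_eq_one (d := G.dir) (fun a => rfl), dirSign_eq_one (fun a => rfl), ← pow_mul, mul_comm G.degree]
  simp [degree]

theorem exists_iso_disjUnion_assoc :
    ∃ F : Iso (G.disjUnion (K.disjUnion L)) ((G.disjUnion K).disjUnion L),
      (∀ v, F.onH (inlH _ _ v) = inlH _ _ (inlH _ _ v)) ∧
      (∀ v, F.onH (inrH _ _ (inlH _ _ v)) = inlH _ _ (inrH _ _ v)) ∧
      (∀ v, F.onH (inrH _ _ (inrH _ _ v)) = inrH _ _ v) ∧ F.sign = 1 := by
  obtain ⟨F, hV1, hV2, hH1, hH2⟩ := exists_iso_disjUnion (G := G) (K := K.disjUnion L)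
    (L := (G.disjUnion K).disjUnion L)
    (f := fun v => inlV _ _ (inlV _ _ v))
    (g := elimV (fun v => inlV _ _ (inrV _ _ v)) (fun v => inrV _ _ v))
    (φ := fun v => inlH _ _ (inlH _ _ v))
    (ψ := elimH (fun v => inlH _ _ (inrH _ _ v)) (fun v => inrH _ _ v))
    (by intro a b; simp)
    (by intro a b; revert a b; simp [forall_disjUnionV])
    (by simp [forall_disjUnionV]) (by simp [forall_disjUnionV, exists_disjUnionV])
    (by intro a b; simp)
    (by intro a b; revert a b; simp [forall_disjUnionH])
    (by simp [forall_disjUnionH]) (by simp [forall_disjUnionH, exists_disjUnionH])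
    (by simp) (by simp [forall_disjUnionH]) (by simp) (by simp [forall_disjUnionH])
  refine ⟨F, hH1, fun v => (hH2 _).trans (elimH_inlH _ _ _),
    fun v => (hH2 _).trans (elimH_inrH _ _ _), F.sign_eq_one ?_ ?_⟩
  · refine strictMono_disjUnion ?_ (strictMono_disjUnion ?_ ?_ ?_) ?_
    · simp only [hV1]
      exact (inlV_strictMono _ _).comp (inlV_strictMono _ _)
    · simp only [hV2, elimV_inlV]
      exact (inlV_strictMono _ _).comp (inrV_strictMono _ _)
    · simp only [hV2, elimV_inrV]
      exact inrV_strictMono _ _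
    · simp [hV2, inlV_lt_inrV]
    · simp [hV2, hV1, forall_disjUnionV, inlV_lt_inrV, (inlV_strictMono _ _).lt_iff_lt]
  · simp [forall_disjUnionH, hH1, hH2]

theorem prod_disjUnionV {M : Type*} [CommMonoid M] (g : (G.disjUnion K).V → M) :
    ∏ u, g u = (∏ v, g (inlV G K v)) * ∏ v, g (inrV G K v) :=
  Fintype.prod_sum_type (α₁ := G.V) (α₂ := K.V) g

theorem rankSign_inlV (v : G.V) : rankSign (inlV G K v) = rankSign v := by
  rw [rankSign, rankSign, neg_one_pow_card_filter, neg_one_pow_card_filter]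
  rw [prod_disjUnionV]
  have h1 : ∀ w, (if inrV G K w < inlV G K v then (-1 : ℤˣ) else 1) = 1 :=
    fun w => if_neg (inlV_lt_inrV _ _ _ _).not_gt
  have h2 : ∀ w, inlV G K w < inlV G K v ↔ w < v := fun w => (inlV_strictMono G K).lt_iff_lt
  refine (congrArg₂ (· * ·) (Finset.prod_congr rfl fun w _ => if_congr (h2 w) rfl rfl)
    (Finset.prod_eq_one fun w _ => h1 w)).trans (mul_one _)

theorem rankSign_inrV (v : K.V) : rankSign (inrV G K v) = (-1) ^ G.degree * rankSign v := by
  rw [rankSign, rankSign, neg_one_pow_card_filter, neg_one_pow_card_filter]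
  rw [prod_disjUnionV]
  have h1 : ∀ w, (if inlV G K w < inrV G K v then (-1 : ℤˣ) else 1) = -1 :=
    fun w => if_pos (inlV_lt_inrV _ _ _ _)
  have h2 : ∀ w, inrV G K w < inrV G K v ↔ w < v := fun w => (inrV_strictMono G K).lt_iff_lt
  refine (congrArg₂ (· * ·) (Finset.prod_congr rfl fun w _ => h1 w)
    (Finset.prod_congr rfl fun w _ => if_congr (h2 w) rfl rfl)).trans ?_
  rw [Finset.prod_const]
  rfl

end OGraph

/-! ### The bracket of `HG` -/

namespace OGraph

/-- Contracting two half-edges of one factor of a disjoint union. -/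
theorem exists_iso_contract_disjUnion (G K : OGraph) {x y : G.H} (h : G.vert x ≠ G.vert y)
    (h' : (G.disjUnion K).vert (inlH G K x) ≠ (G.disjUnion K).vert (inlH G K y)) :
    ∃ F : Iso ((G.contract x y h).disjUnion K) ((G.disjUnion K).contract (inlH G K x) (inlH G K y) h'),
      (∀ a, (G.disjUnion K).ctrH h' (F.onH (inlH _ _ a)) = inlH G K (G.ctrH h a)) ∧
      (∀ a, (G.disjUnion K).ctrH h' (F.onH (inrH _ _ a)) = inrH G K a) ∧ F.sign = 1 := by
  obtain ⟨F, hV, hH⟩ := exists_iso (A := (G.contract x y h).disjUnion K)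
    (B := (G.disjUnion K).contract (inlH G K x) (inlH G K y) h')
    (aV := elimV (fun v => inlV G K (G.ctrV h v)) (inrV G K)) (bV := (G.disjUnion K).ctrV h')
    (aH := elimH (fun v => inlH G K (G.ctrH h v)) (inrH G K)) (bH := (G.disjUnion K).ctrH h')
    (by
      intro a b
      revert a b
      simp [forall_disjUnionV, (G.ctrV_injective h).eq_iff])
    ((G.disjUnion K).ctrV_injective h')
    (by
      intro a b
      revert a b
      simp [forall_disjUnionH, (G.ctrH_injective h).eq_iff])
    ((G.disjUnion K).ctrH_injective h')
    (by
      simp [forall_disjUnionV, exists_disjUnionV, exists_ctrV])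
    (by
      simp [forall_disjUnionH, exists_disjUnionH, exists_ctrH])
    (by
      simp only [forall_disjUnionH, elimH_inlH, elimH_inrH, bar_inlH, bar_inrH]
      constructor <;> intro a b hab <;> rw [(G.disjUnion K).ctrH_bar h', ← hab]
      · simp only [ctrH_bar, bar_inlH, inlH_inj, apply_ite (inlH G K)]
      · simp)
    (by
      simp only [forall_disjUnionH, elimH_inlH, elimH_inrH, vert_inlH, vert_inrH, elimV_inlV,
        elimV_inrV]
      constructor <;> intro a b hab <;> rw [(G.disjUnion K).ctrV_vert h', ← hab]
      · simp only [ctrV_vert, vert_inlH, inlV_inj, apply_ite (inlV G K)]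
      · simp)
  refine ⟨F, fun a => hH _, fun a => hH _, F.sign_eq_one ?_ ?_⟩
  · intro a b hab
    rw [← ((G.disjUnion K).ctrV_strictMono h').lt_iff_lt, hV, hV]
    refine strictMono_disjUnion ?_ ?_ ?_ hab
    · exact (inlV_strictMono G K).comp (G.ctrV_strictMono h)
    · exact inrV_strictMono G K
    · intro v w
      exact inlV_lt_inrV _ _ _ _
  · rw [forall_disjUnionH]
    constructor <;> intro a <;> rw [contract_dir, hH]
    · simp only [elimH_inlH, dir_inlH, contract_dir, bar_inlH, inlH_inj]
    · simp

theorem contractSign_inlH (G K : OGraph) {x y : G.H} (hb : y ≠ G.bar x) :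
    (G.disjUnion K).contractSign (inlH G K x) (inlH G K y) = G.contractSign x y := by
  rw [contractSign_eq _ hb, contractSign_eq, dir_inlH, dir_inlH, vert_inlH, rankSign_inlV]
  simpa using hb

theorem sum_eq_sum_ctrH (G : OGraph) {x y : G.H} (h : G.vert x ≠ G.vert y) {M : Type*}
    [AddCommMonoid M] {F : G.H → M} (hx : F x = 0) (hy : F y = 0) :
    ∑ a, F a = ∑ a, F (G.ctrH h a) := by
  rw [sum_ctrH]
  refine Finset.sum_congr rfl fun a _ => ?_
  split_ifs with ha
  · rfl
  · rw [not_and_or, not_not, not_not] at ha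
    rcases ha with rfl | rfl <;> assumption

end OGraph

section Bracket

open OGraph

universe u

variable {k : Type u} [Field k]

theorem contr₂_eq_zero {G : OGraph} {x y z w : G.H}
    (h : z = x ∨ z = y ∨ w = x ∨ w = y) : contr₂ k G x y z w = 0 := by
  rw [contr₂, dif_neg]
  rw [CanContract₂]
  tauto

theorem graphBracket_eq (G K : OGraph) :
    graphBracket k G K = ∑ x, ∑ y, contr k (G.disjUnion K) (inlH G K x) (inrH G K y) := by
  refine Finset.sum_congr rfl fun x _ => Finset.sum_congr rfl fun y _ => ?_
  rw [contr, if_neg]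
  · rfl
  · simp

theorem graphBracket_iso_left {G G' : OGraph} (f : Iso G G') (K : OGraph) :
    graphBracket k G' K = f.sign • graphBracket k G K := by
  obtain ⟨F, h1, h2, hs⟩ := exists_iso_disjUnion_map f (Iso.refl K)
  rw [Iso.sign_refl, mul_one] at hs
  rw [graphBracket_eq, graphBracket_eq, ← hs, ← f.onH.sum_comp, Finset.smul_sum]
  refine Finset.sum_congr rfl fun x _ => ?_
  rw [Finset.smul_sum]
  refine Finset.sum_congr rfl fun y _ => ?_
  rw [← contr_iso, h1, h2]
  rfl

theorem graphBracket_iso_right (G : OGraph) {K K' : OGraph} (f : Iso K K') :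
    graphBracket k G K' = f.sign • graphBracket k G K := by
  obtain ⟨F, h1, h2, hs⟩ := exists_iso_disjUnion_map (Iso.refl G) f
  rw [Iso.sign_refl, one_mul] at hs
  rw [graphBracket_eq, graphBracket_eq, ← hs, Finset.smul_sum]
  refine Finset.sum_congr rfl fun x _ => ?_
  rw [Finset.smul_sum, ← f.onH.sum_comp]
  refine Finset.sum_congr rfl fun y _ => ?_
  rw [← contr_iso, h1, h2]
  rfl

variable (k) in
/-- The bracket of `HG`. -/
noncomputable def HG.bracket : HG k →ₗ[k] HG k →ₗ[k] HG k :=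
  HG.lift (fun G => HG.lift (graphBracket k G) fun _ _ f => graphBracket_iso_right G f)
    fun G G' f => HG.hom_ext fun K => by
      rw [LinearMap.smul_apply, HG.lift_graphClass, HG.lift_graphClass, graphBracket_iso_left f]

theorem HG.bracket_graphClass (G K : OGraph) :
    HG.bracket k (graphClass k G) (graphClass k K) = graphBracket k G K := by
  rw [HG.bracket, HG.lift_graphClass, HG.lift_graphClass]

theorem graphBracket_comm (G K : OGraph) :
    graphBracket k G K = ((-1 : ℤˣ) ^ (G.degree * K.degree)) • graphBracket k K G := by
  obtain ⟨F, h1, h2, hs⟩ := exists_iso_disjUnion_comm K G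
  rw [graphBracket_eq, graphBracket_eq, Finset.sum_comm, Finset.smul_sum]
  refine Finset.sum_congr rfl fun x _ => ?_
  rw [Finset.smul_sum]
  refine Finset.sum_congr rfl fun y _ => ?_
  rw [contr_comm, ← h1, ← h2, contr_iso, hs, mul_comm]

/-- The bracket of a contraction. -/
theorem HG.bracket_contr (G K : OGraph) (x y : G.H) :
    HG.bracket k (contr k G x y) (graphClass k K) =
      ∑ a, ∑ b, contr₂ k (G.disjUnion K) (inlH G K x) (inlH G K y) (inlH G K a) (inrH G K b) := by
  by_cases hb : y = G.bar x
  · rw [contr_of_eq_bar hb, map_zero, LinearMap.zero_apply]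
    symm
    refine Finset.sum_eq_zero fun a _ => Finset.sum_eq_zero fun b _ => ?_
    rw [contr₂, dif_neg]
    simp [CanContract₂, hb]
  by_cases h : G.vert x = G.vert y
  · rw [contr_of_vert_eq h, map_zero, LinearMap.zero_apply]
    symm
    refine Finset.sum_eq_zero fun a _ => Finset.sum_eq_zero fun b _ => ?_
    rw [contr₂, dif_neg]
    simp [CanContract₂, h]
  have h' : (G.disjUnion K).vert (inlH G K x) ≠ (G.disjUnion K).vert (inlH G K y) := by simpa
  obtain ⟨F, hl, hr, hs⟩ := exists_iso_contract_disjUnion G K h h'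
  rw [contr_of_ne h hb, LinearMap.map_smul_of_tower, LinearMap.smul_apply, HG.bracket_graphClass,
    G.sum_eq_sum_ctrH h, graphBracket_eq, Finset.smul_sum]
  · refine Finset.sum_congr rfl fun a _ => ?_
    rw [Finset.smul_sum]
    refine Finset.sum_congr rfl fun b _ => ?_
    rw [← hl, ← hr, contr₂_of, contractSign_inlH G K hb, contr_iso, hs, one_smul]
    simpa using hb
  · exact Finset.sum_eq_zero fun b _ => contr₂_eq_zero (by simp)
  · exact Finset.sum_eq_zero fun b _ => contr₂_eq_zero (by simp)

/-- The second contraction uses a surviving half-edge of `X` or of `Y`. Half-edges already consumed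
may be left in the sum because `contr₂` is zero on them. -/
theorem HG.bracket_bracket (X Y Z : OGraph) :
    HG.bracket k (HG.bracket k (graphClass k X) (graphClass k Y)) (graphClass k Z) =
      ∑ x, ∑ y, ∑ z, ((∑ a, contr₂ k ((X.disjUnion Y).disjUnion Z) (inlH _ _ (inlH _ _ x))
        (inlH _ _ (inrH _ _ y)) (inlH _ _ (inlH _ _ a)) (inrH _ _ z)) +
      ∑ a, contr₂ k ((X.disjUnion Y).disjUnion Z) (inlH _ _ (inlH _ _ x))
        (inlH _ _ (inrH _ _ y)) (inlH _ _ (inrH _ _ a)) (inrH _ _ z)) := by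
  rw [HG.bracket_graphClass, graphBracket_eq, map_sum, LinearMap.sum_apply]
  refine Finset.sum_congr rfl fun x _ => ?_
  rw [map_sum, LinearMap.sum_apply]
  refine Finset.sum_congr rfl fun y _ => ?_
  rw [HG.bracket_contr, Finset.sum_comm]
  refine Finset.sum_congr rfl fun z _ => ?_
  rw [sum_disjUnionH]

/-- There are six families of double contractions, indexed by the graph that is met twice and by the
order of the two pairs. The two orders cancel by `h`. -/
theorem sum_cyclic {T A B C M : Type*} [Fintype A] [Fintype B] [Fintype C] [AddCommGroup M]
    (c : T → T → T → T → M) (h : ∀ x y z w, c x y z w = -c z w x y)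
    (hl : ∀ x y z w, c x y z w = c y x z w) (hr : ∀ x y z w, c x y z w = c x y w z)
    (i : A → T) (j : B → T) (l : C → T) :
    ∑ x, ∑ y, ∑ z, ((∑ a, c (i x) (j y) (i a) (l z)) + ∑ a, c (i x) (j y) (j a) (l z)) +
    ∑ y, ∑ z, ∑ x, ((∑ a, c (j y) (l z) (j a) (i x)) + ∑ a, c (j y) (l z) (l a) (i x)) +
    ∑ z, ∑ x, ∑ y, ((∑ a, c (l z) (i x) (l a) (j y)) + ∑ a, c (l z) (i x) (i a) (j y)) = 0 := by
  have h1 : ∑ z, ∑ x, ∑ y, ∑ a, c (l z) (i x) (i a) (j y) =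
      -∑ x, ∑ y, ∑ z, ∑ a, c (i x) (j y) (i a) (l z) := by
    simp only [← Fintype.sum_prod_type', ← Finset.sum_neg_distrib]
    refine Fintype.sum_equiv ⟨fun p => (p.2.2.2, p.2.2.1, p.1, p.2.1),
      fun p => (p.2.2.1, p.2.2.2, p.2.1, p.1), fun _ => rfl, fun _ => rfl⟩ _ _ ?_
    rintro ⟨z, x, y, a⟩
    exact ((h _ _ _ _).trans (congrArg _ (hr _ _ _ _)))
  have h2 : ∑ y, ∑ z, ∑ x, ∑ a, c (j y) (l z) (j a) (i x) =
      -∑ x, ∑ y, ∑ z, ∑ a, c (i x) (j y) (j a) (l z) := by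
    simp only [← Fintype.sum_prod_type', ← Finset.sum_neg_distrib]
    refine Fintype.sum_equiv ⟨fun p => (p.2.2.1, p.2.2.2, p.2.1, p.1),
      fun p => (p.2.2.2, p.2.2.1, p.1, p.2.1), fun _ => rfl, fun _ => rfl⟩ _ _ ?_
    rintro ⟨y, z, x, a⟩
    exact ((h _ _ _ _).trans (congrArg _ (hl _ _ _ _)))
  have h3 : ∑ z, ∑ x, ∑ y, ∑ a, c (l z) (i x) (l a) (j y) =
      -∑ y, ∑ z, ∑ x, ∑ a, c (j y) (l z) (l a) (i x) := by
    simp only [← Fintype.sum_prod_type', ← Finset.sum_neg_distrib]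
    refine Fintype.sum_equiv ⟨fun p => (p.2.2.1, p.2.2.2, p.2.1, p.1),
      fun p => (p.2.2.2, p.2.2.1, p.1, p.2.1), fun _ => rfl, fun _ => rfl⟩ _ _ ?_
    rintro ⟨y, z, x, a⟩
    exact ((h _ _ _ _).trans (congrArg _ (hl _ _ _ _)))
  simp only [Finset.sum_add_distrib, h1, h2, h3]
  abel

theorem HG.jacobi (X Y Z : OGraph) :
    HG.bracket k (HG.bracket k (graphClass k X) (graphClass k Y)) (graphClass k Z) +
      ((-1 : ℤˣ) ^ (X.degree * (Y.degree + Z.degree))) •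
        HG.bracket k (HG.bracket k (graphClass k Y) (graphClass k Z)) (graphClass k X) +
      ((-1 : ℤˣ) ^ (Z.degree * (X.degree + Y.degree))) •
        HG.bracket k (HG.bracket k (graphClass k Z) (graphClass k X)) (graphClass k Y) = 0 := by
  obtain ⟨F1, a1, a2, a3, hs1⟩ := exists_iso_disjUnion_assoc X Y Z
  obtain ⟨F2, b1, b2, hs2⟩ := exists_iso_disjUnion_comm (Y.disjUnion Z) X
  obtain ⟨F3, c1, c2, c3, hs3⟩ := exists_iso_disjUnion_assoc Y Z X
  obtain ⟨F4, d1, d2, hs4⟩ := exists_iso_disjUnion_comm (Z.disjUnion X) Y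
  have hdeg : ∀ G K : OGraph, (G.disjUnion K).degree = G.degree + K.degree :=
    fun G K => Fintype.card_sum
  rw [hdeg] at hs2 hs4
  -- All three double brackets are transported to the single graph `X · Y · Z`. The signs of the
  -- block permutations are the Koszul signs.
  have e1 : ∀ p q r s, contr₂ k ((X.disjUnion Y).disjUnion Z) (F1.onH (F2.onH p)) (F1.onH (F2.onH q)) (F1.onH (F2.onH r))
      (F1.onH (F2.onH s)) = ((-1 : ℤˣ) ^ (X.degree * (Y.degree + Z.degree))) •
        contr₂ k ((Y.disjUnion Z).disjUnion X) p q r s := by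
    intro p q r s
    rw [contr₂_iso, contr₂_iso, hs1, hs2, one_smul, mul_comm]
  have e2 : ∀ p q r s, contr₂ k ((X.disjUnion Y).disjUnion Z) (F1.onH (F2.onH (F3.onH (F4.onH p))))
      (F1.onH (F2.onH (F3.onH (F4.onH q)))) (F1.onH (F2.onH (F3.onH (F4.onH r))))
      (F1.onH (F2.onH (F3.onH (F4.onH s)))) =
      ((-1 : ℤˣ) ^ (Z.degree * (X.degree + Y.degree))) •
        contr₂ k ((Z.disjUnion X).disjUnion Y) p q r s := by
    intro p q r s
    rw [e1, contr₂_iso, contr₂_iso, hs3, hs4, one_smul, smul_smul, ← pow_add]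
    congr 1
    -- Two successive rotations give the Koszul exponent of the third term up to the even number `2
    -- * (X.degree * Y.degree)`.
    have : X.degree * (Y.degree + Z.degree) + (Z.degree + X.degree) * Y.degree =
      Z.degree * (X.degree + Y.degree) + 2 * (X.degree * Y.degree) := by ring
    rw [this, pow_add, pow_mul]
    simp
  rw [HG.bracket_bracket, HG.bracket_bracket, HG.bracket_bracket]
  simp only [Finset.smul_sum, smul_add, ← e1, ← e2, a1, a2, a3, b1, b2, c1, c2, c3, d1, d2]
  exact sum_cyclic _ (contr₂_anticomm _) (contr₂_comm_left _) (contr₂_comm_right _)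
    (fun x => inlH _ _ (inlH _ _ x)) (fun y => inlH _ _ (inrH _ _ y)) (fun z => inrH _ _ z)

end Bracket

/-! ### Components, and the cobracket of `HG` -/

namespace OGraph

variable {G G' : OGraph}

/-- The isomorphism of simple graphs given by an isomorphism of graphs. -/
def Iso.toSimple (f : Iso G G') : G.toSimple ≃g G'.toSimple where
  toEquiv := f.onV
  map_rel_iff' := by
    intro u v
    constructor
    · rintro ⟨huv, h, h1, h2⟩
      refine ⟨fun e => huv (by rw [e]), f.onH.symm h, f.onV.injective ?_, f.onV.injective ?_⟩
      · rw [← f.vert_onH, Equiv.apply_symm_apply]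
        exact h1
      · rw [← f.vert_onH, ← f.bar_onH, Equiv.apply_symm_apply]
        exact h2
    · rintro ⟨huv, h, rfl, rfl⟩
      exact ⟨fun e => huv (f.onV.injective e), f.onH h, f.vert_onH h, by
        rw [f.bar_onH, f.vert_onH]⟩

theorem Iso.numComponents_eq (f : Iso G G') : G'.numComponents = G.numComponents :=
  (Nat.card_congr f.toSimple.connectedComponentEquiv).symm

theorem Iso.isClosed_iff (f : Iso G G') {S : Set G.V} {S' : Set G'.V}
    (h : ∀ v, f.onV v ∈ S' ↔ v ∈ S) : G'.IsClosed S' ↔ G.IsClosed S := by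
  constructor
  · intro hS a
    rw [← h, ← h, ← f.vert_onH, ← f.vert_onH, ← f.bar_onH]
    exact hS _
  · intro hS a
    obtain ⟨a, rfl⟩ := f.onH.surjective a
    rw [f.bar_onH, f.vert_onH, f.vert_onH, h, h]
    exact hS _

theorem IsClosed.mem_iff_of_adj {S : Set G.V} (hS : G.IsClosed S) {u v : G.V}
    (h : G.toSimple.Adj u v) : u ∈ S ↔ v ∈ S := by
  obtain ⟨-, a, rfl, rfl⟩ := h
  exact (hS a).symm

theorem IsClosed.mem_iff_of_reachable {S : Set G.V} (hS : G.IsClosed S) {u v : G.V}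
    (h : G.toSimple.Reachable u v) : u ∈ S ↔ v ∈ S := by
  obtain ⟨p⟩ := h
  induction p with
  | nil => rfl
  | cons h _ ih => exact (hS.mem_iff_of_adj h).trans ih

theorem reachable_bar (h : G.H) : G.toSimple.Reachable (G.vert h) (G.vert (G.bar h)) := by
  by_cases e : G.vert h = G.vert (G.bar h)
  · rw [← e]
  · exact SimpleGraph.Adj.reachable ⟨e, h, rfl, rfl⟩

theorem isClosed_reachable (v : G.V) : G.IsClosed {u | G.toSimple.Reachable v u} := fun h =>
  ⟨fun h1 => h1.trans (reachable_bar h).symm, fun h1 => h1.trans (reachable_bar h)⟩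

theorem isClosed_empty : G.IsClosed ∅ := fun _ => Iff.rfl

/-- Connectedness is tested on closed sets rather than paths, since closed sets are easily carried
through contractions and disjoint unions. -/
theorem isConnected_iff : G.IsConnected ↔
    Nonempty G.V ∧ ∀ S, G.IsClosed S → S.Nonempty → S = Set.univ := by
  constructor
  · intro h
    refine ⟨h.nonempty, fun S hS ⟨v, hv⟩ => Set.eq_univ_of_forall fun u => ?_⟩
    exact (hS.mem_iff_of_reachable (h.preconnected v u)).1 hv
  · rintro ⟨h1, h2⟩
    refine ⟨fun u v => ?_⟩
    have := h2 _ (isClosed_reachable u) ⟨u, SimpleGraph.Reachable.refl _⟩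
    exact this.ge (Set.mem_univ v)

theorem numComponents_eq_one (h : G.IsConnected) : G.numComponents = 1 := by
  have := h.preconnected.subsingleton_connectedComponent
  have := h.nonempty
  have : Nonempty G.toSimple.ConnectedComponent := ⟨G.toSimple.connectedComponentMk this.some⟩
  exact Nat.card_unique

theorem one_lt_numComponents {S : Set G.V} (hS : G.IsClosed S) {u v : G.V} (hu : u ∈ S)
    (hv : v ∉ S) : 1 < G.numComponents := by
  rw [numComponents, Nat.card_eq_fintype_card, Fintype.one_lt_card_iff]
  refine ⟨G.toSimple.connectedComponentMk u, G.toSimple.connectedComponentMk v, fun h => hv ?_⟩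
  exact (hS.mem_iff_of_reachable (SimpleGraph.ConnectedComponent.exact h)).1 hu

/-- Only pairs with one element on each side matter, so the parametrizations of the two sides need
not be monotone. -/
theorem shuffleSign_eq {S : Set G.V} {A B : Type*} [Fintype A] [Fintype B] {i : A → G.V}
    {j : B → G.V} (hi : Function.Injective i) (hj : Function.Injective j)
    (hi' : ∀ v, (∃ a, i a = v) ↔ v ∈ S) (hj' : ∀ v, (∃ a, j a = v) ↔ v ∉ S) :
    G.shuffleSign S = ∏ a, ∏ b, ordSign (i a) (j b) := by
  classical
  have h1 : G.shuffleSign S = ∏ v, ∏ u, if u < v ∧ u ∉ S ∧ v ∈ S then -1 else 1 := by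
    rw [shuffleSign, neg_one_pow_card_filter, Fintype.prod_prod_type]
    exact Finset.prod_comm
  rw [h1]
  symm
  refine Fintype.prod_of_injective i hi _ _ (fun v hv => ?_) fun a => ?_
  · refine Finset.prod_eq_one fun u _ => if_neg fun h => hv ?_
    exact (hi' v).2 h.2.2
  · refine Fintype.prod_of_injective j hj _ _ (fun v hv => ?_) fun b => ?_
    · refine if_neg fun h => hv ?_
      exact (hj' v).2 h.2.1
    · have ha := (hi' _).1 ⟨a, rfl⟩
      have hb := (hj' _).1 ⟨b, rfl⟩
      have : i a ≠ j b := fun e => hb (e ▸ ha)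
      rcases lt_or_gt_of_ne this with h | h
      · simp [ordSign, h, h.not_gt]
      · simp [ordSign, h, h.not_gt, ha, hb]

theorem shuffleSign_eq_res {S : Set G.V} (hS : G.IsClosed S) :
    G.shuffleSign S = ∏ a, ∏ b, ordSign (G.resV hS a) (G.resV hS.compl b) :=
  shuffleSign_eq (G.resV_injective _) (G.resV_injective _) (G.exists_resV _) (G.exists_resV _)

theorem bijective_resV {S : Set G.V} (hS : G.IsClosed S) :
    Function.Bijective (Sum.elim (G.resV hS) (G.resV hS.compl)) := by
  constructor
  · rintro (a | a) (b | b) hab <;> simp only [Sum.elim_inl, Sum.elim_inr] at hab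
    · rw [G.resV_injective hS hab]
    · exact absurd (hab ▸ G.resV_mem hS a) (G.resV_mem hS.compl b)
    · exact absurd (hab ▸ G.resV_mem hS b) (G.resV_mem hS.compl a)
    · rw [G.resV_injective hS.compl hab]
  · intro v
    by_cases hv : v ∈ S
    · exact ⟨.inl (G.toResV hS v hv), rfl⟩
    · exact ⟨.inr (G.toResV hS.compl v hv), rfl⟩

theorem bijective_resH {S : Set G.V} (hS : G.IsClosed S) :
    Function.Bijective (Sum.elim (G.resH hS) (G.resH hS.compl)) := by
  constructor
  · rintro (a | a) (b | b) hab <;> simp only [Sum.elim_inl, Sum.elim_inr] at hab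
    · rw [G.resH_injective hS hab]
    · exact absurd (hab ▸ G.resH_mem hS a) (G.resH_mem hS.compl b)
    · exact absurd (hab ▸ G.resH_mem hS b) (G.resH_mem hS.compl a)
    · rw [G.resH_injective hS.compl hab]
  · intro v
    by_cases hv : G.vert v ∈ S
    · exact ⟨.inl (G.toResH hS v hv), rfl⟩
    · exact ⟨.inr (G.toResH hS.compl v hv), rfl⟩

theorem Iso.sign_eq_of_isClosed (f : Iso G G') {S : Set G.V} (hS : G.IsClosed S) :
    f.sign = vertSign (fun v => f.onV (G.resV hS v)) * vertSign (fun v => f.onV (G.resV hS.compl v)) *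
      (G.shuffleSign S * ∏ v, ∏ w, ordSign (f.onV (G.resV hS v)) (f.onV (G.resV hS.compl w))) *
      (dirSign (G.restrict S hS).dir (fun h => G'.dir (f.onH (G.resH hS h))) *
        dirSign (G.restrict Sᶜ hS.compl).dir (fun h => G'.dir (f.onH (G.resH hS.compl h)))) := by
  rw [f.sign_eq]
  congr 1
  · refine (vertSign_split (e := Equiv.ofBijective _ (bijective_resV hS)) (G.resV_strictMono hS)
      (G.resV_strictMono hS.compl) f.onV.injective).trans ?_
    rw [shuffleSign_eq_res hS]
    simp only [← Finset.prod_mul_distrib]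
    rfl
  · rw [dirSign, ← (Equiv.ofBijective _ (bijective_resH hS)).prod_comp, Fintype.prod_sum_type]
    rfl

theorem Iso.exists_restrict (f : Iso G G') {S : Set G.V} {S' : Set G'.V}
    (h : ∀ v, f.onV v ∈ S' ↔ v ∈ S) (hS : G.IsClosed S) (hS' : G'.IsClosed S') :
    ∃ g : Iso (G.restrict S hS) (G'.restrict S' hS'),
      (∀ v, G'.resV hS' (g.onV v) = f.onV (G.resV hS v)) ∧
      (∀ v, G'.resH hS' (g.onH v) = f.onH (G.resH hS v)) ∧
      g.sign = vertSign (fun v => f.onV (G.resV hS v)) *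
        dirSign (G.restrict S hS).dir (fun h => G'.dir (f.onH (G.resH hS h))) := by
  obtain ⟨g, hV, hH⟩ := exists_iso (A := G.restrict S hS) (B := G'.restrict S' hS')
    (aV := fun v => f.onV (G.resV hS v)) (bV := G'.resV hS')
    (aH := fun v => f.onH (G.resH hS v)) (bH := G'.resH hS')
    (f.onV.injective.comp (G.resV_injective hS)) (G'.resV_injective hS')
    (f.onH.injective.comp (G.resH_injective hS)) (G'.resH_injective hS')
    (by
      intro v
      obtain ⟨v, rfl⟩ := f.onV.surjective v
      simp [exists_resV, h])
    (by
      intro v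
      obtain ⟨v, rfl⟩ := f.onH.surjective v
      simp [exists_resH, h, f.vert_onH])
    (by
      intro a b hab
      rw [resH_bar, resH_bar, ← hab, f.bar_onH])
    (by
      intro a b hab
      rw [resV_vert, resV_vert, ← hab, f.vert_onH])
  refine ⟨g, hV, hH, ?_⟩
  rw [g.sign_eq, ← vertSign_comp_strictMono (G'.resV_strictMono hS')]
  simp only [hV, hH, restrict_dir]

end OGraph

section Cobracket

open OGraph

universe u

variable (k : Type u) [Field k] {G G' : OGraph}

theorem units_smul_tmul_smul {R M N : Type*} [CommRing R] [AddCommGroup M] [AddCommGroup N]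
    [Module R M] [Module R N] (a b : ℤˣ) (x : M) (y : N) :
    (a • x) ⊗ₜ[R] (b • y) = (a * b) • (x ⊗ₜ[R] y) := by
  rcases Int.units_eq_one_or a with rfl | rfl <;> rcases Int.units_eq_one_or b with rfl | rfl <;>
    simp [Units.smul_def, TensorProduct.neg_tmul, TensorProduct.tmul_neg]

theorem splitting_of_isClosed {S : Set G.V} (hS : G.IsClosed S) : splitting k G S =
    G.shuffleSign S • (graphClass k (G.restrict S hS) ⊗ₜ[k] graphClass k (G.restrict Sᶜ hS.compl)) :=
  dif_pos hS

theorem splitting_of_not_isClosed {S : Set G.V} (hS : ¬ G.IsClosed S) : splitting k G S = 0 :=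
  dif_neg hS

/-- `f.sign` factors into its signs on `S` and on the complement and a product over mixed pairs; the
mixed part turns one shuffle sign into the other. -/
theorem splitting_iso (f : Iso G G') {S : Set G.V} {S' : Set G'.V}
    (h : ∀ v, f.onV v ∈ S' ↔ v ∈ S) : splitting k G' S' = f.sign • splitting k G S := by
  by_cases hS : G.IsClosed S
  · have hS' := (f.isClosed_iff h).2 hS
    obtain ⟨g1, -, -, h1⟩ := f.exists_restrict h hS hS'
    obtain ⟨g2, -, -, h2⟩ := f.exists_restrict (fun v => not_congr (h v)) hS.compl hS'.compl
    have h3 : G'.shuffleSign S' = ∏ v, ∏ w,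
        ordSign (f.onV (G.resV hS v)) (f.onV (G.resV hS.compl w)) := by
      refine shuffleSign_eq (f.onV.injective.comp (G.resV_injective _))
        (f.onV.injective.comp (G.resV_injective _)) ?_ ?_ <;> intro v <;>
        obtain ⟨v, rfl⟩ := f.onV.surjective v
      · simp [exists_resV, h]
      · simp only [EmbeddingLike.apply_eq_iff_eq, exists_resV, h]
        rfl
    rw [splitting_of_isClosed k hS, splitting_of_isClosed k hS', graphClass_iso k g1,
      graphClass_iso k g2, f.sign_eq_of_isClosed hS, h1, h2, h3, smul_smul]
    rw [units_smul_tmul_smul, smul_smul]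
    congr 1
    have aux : ∀ a b c d e s : ℤˣ, e * (a * c * (b * d)) = a * b * (s * e) * (c * d) * s := by
      intro a b c d e s
      calc _ = a * b * e * (c * d) * 1 := by rw [mul_one]; ac_rfl
        _ = a * b * e * (c * d) * (s * s) := by rw [Int.units_mul_self]
        _ = _ := by ac_rfl
    exact aux _ _ _ _ _ _
  · rw [splitting_of_not_isClosed k hS, splitting_of_not_isClosed k fun h' =>
      hS ((f.isClosed_iff h).1 h'), smul_zero]

/-- The sum of all decompositions of a graph into two complementary parts. -/
noncomputable def cop (G : OGraph) : HG k ⊗[k] HG k := ∑ S : Set G.V, splitting k G S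

open Classical in
/-- The sum of all decompositions of a graph into two complementary parts, one containing the vertex
`m` and the other containing `u`. -/
noncomputable def sepCop (G : OGraph) (m u : G.V) : HG k ⊗[k] HG k :=
  ∑ S : Set G.V, if Xor (m ∈ S) (u ∈ S) then splitting k G S else 0

theorem cop_iso (f : Iso G G') : cop k G' = f.sign • cop k G := by
  rw [cop, cop, Finset.smul_sum, ← (Equiv.Set.congr f.onV).sum_comp]
  exact Finset.sum_congr rfl fun S _ => splitting_iso k f fun v => by simp

theorem sepCop_iso (f : Iso G G') (m u : G.V) :
    sepCop k G' (f.onV m) (f.onV u) = f.sign • sepCop k G m u := by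
  rw [sepCop, sepCop, Finset.smul_sum, ← (Equiv.Set.congr f.onV).sum_comp]
  refine Finset.sum_congr rfl fun S _ => ?_
  have h : ∀ v, f.onV v ∈ Equiv.Set.congr f.onV S ↔ v ∈ S := fun v => by simp
  rw [h, h, splitting_iso k f h, smul_ite, smul_zero]

namespace OGraph

/-- The merged vertex of a contraction. -/
def mergedV (G : OGraph) {x y : G.H} (h : G.vert x ≠ G.vert y) : (G.contract x y h).V :=
  G.toCtrV h (G.vert x) h

@[simp]
theorem ctrV_mergedV (G : OGraph) {x y : G.H} (h : G.vert x ≠ G.vert y) :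
    G.ctrV h (G.mergedV h) = G.vert x := rfl

theorem bar_ne_of_ne {x y : G.H} (hb : y ≠ G.bar x) :
    G.bar x ≠ x ∧ G.bar x ≠ y := ⟨G.bar_ne x, hb.symm⟩

/-- The half of the new edge of a contraction at which the half-edge `bar x` was. -/
def newH (G : OGraph) {x y : G.H} (h : G.vert x ≠ G.vert y) (hb : y ≠ G.bar x) :
    (G.contract x y h).H := G.toCtrH h (G.bar x) (bar_ne_of_ne hb)

@[simp]
theorem ctrH_newH (G : OGraph) {x y : G.H} (h : G.vert x ≠ G.vert y) (hb : y ≠ G.bar x) :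
    G.ctrH h (G.newH h hb) = G.bar x := rfl

end OGraph

theorem separation_of_ne {x y : G.H} (h : G.vert x ≠ G.vert y) (hb : y ≠ G.bar x) :
    separation k G x y = G.contractSign x y • sepCop k (G.contract x y h) (G.mergedV h)
      ((G.contract x y h).vert (G.newH h hb)) := by
  rw [separation, dif_pos h, sepCop]
  congr 1
  refine Finset.sum_congr rfl fun S _ => ?_
  congr 1
  rw [eq_iff_iff]
  constructor
  · rintro ⟨z, hz, h1⟩
    have : z = G.newH h hb := G.ctrH_injective h hz
    rwa [this] at h1
  · exact fun h1 => ⟨G.newH h hb, rfl, h1⟩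

theorem separation_of_vert_eq {x y : G.H} (h : G.vert x = G.vert y) : separation k G x y = 0 :=
  dif_neg (not_not_intro h)

/-- Contracting an edge consumes `G.bar x` itself, so there is no new edge to be separated from the
merged vertex. -/
theorem separation_of_eq_bar {x y : G.H} (hb : y = G.bar x) : separation k G x y = 0 := by
  by_cases h : G.vert x = G.vert y
  · exact separation_of_vert_eq k h
  rw [separation, dif_pos h, Finset.sum_eq_zero, smul_zero]
  refine fun S _ => if_neg ?_
  rintro ⟨z, hz, -⟩
  exact (G.ctrH_ne h z).2 (hz.trans hb.symm)

theorem separation_iso (f : Iso G G') (x y : G.H) :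
    separation k G' (f.onH x) (f.onH y) = f.sign • separation k G x y := by
  by_cases h : G.vert x = G.vert y
  · rw [separation_of_vert_eq k h, separation_of_vert_eq, smul_zero]
    rw [f.vert_onH, f.vert_onH, h]
  by_cases hb : y = G.bar x
  · rw [separation_of_eq_bar k hb, separation_of_eq_bar, smul_zero]
    rw [f.bar_onH, hb]
  have h' : G'.vert (f.onH x) ≠ G'.vert (f.onH y) := by rwa [f.vert_onH, f.vert_onH, f.onV.injective.ne_iff]
  have hb' : f.onH y ≠ G'.bar (f.onH x) := by rwa [f.bar_onH, f.onH.injective.ne_iff]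
  obtain ⟨f', hV, hH, hs⟩ := f.exists_contract h h' hb
  rw [separation_of_ne k h hb, separation_of_ne k h' hb', smul_smul, hs, ← smul_smul, ← sepCop_iso,
    ← f'.vert_onH]
  congr 3
  · exact G'.ctrV_injective h' (by rw [hV, ctrV_mergedV, ctrV_mergedV, f.vert_onH])
  · exact G'.ctrH_injective h' (by rw [hH, ctrH_newH, ctrH_newH, f.bar_onH])

theorem OGraph.isSeparating_iso (f : Iso G G') {x y : G.H} (hb : y ≠ G.bar x) :
    G'.IsSeparating (f.onH x) (f.onH y) ↔ G.IsSeparating x y := by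
  by_cases h : G.vert x = G.vert y
  · have h' : G'.vert (f.onH x) = G'.vert (f.onH y) := by rw [f.vert_onH, f.vert_onH, h]
    exact ⟨fun e => absurd h' e.1, fun e => absurd h e.1⟩
  have h' : G'.vert (f.onH x) ≠ G'.vert (f.onH y) := by rwa [f.vert_onH, f.vert_onH, f.onV.injective.ne_iff]
  obtain ⟨f', -, -, -⟩ := f.exists_contract h h' hb
  rw [IsSeparating, IsSeparating, f.numComponents_eq]
  exact ⟨fun ⟨_, e⟩ => ⟨h, f'.numComponents_eq ▸ e⟩, fun ⟨_, e⟩ => ⟨h', f'.numComponents_eq.symm ▸ e⟩⟩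

theorem graphCobracket_iso (f : Iso G G') :
    graphCobracket k G' = f.sign • graphCobracket k G := by
  rw [graphCobracket, graphCobracket, smul_comm f.sign]
  congr 1
  rw [Finset.smul_sum]
  refine (Fintype.sum_equiv f.onH _ _ fun x => ?_).symm
  rw [Finset.smul_sum]
  refine Fintype.sum_equiv f.onH _ _ fun y => ?_
  rw [separation_iso]
  -- Whether an edge is separating is irrelevant, since its `separation` is zero anyway.
  by_cases hb : y = G.bar x
  · rw [separation_of_eq_bar k hb, smul_zero, ite_self, ite_self, smul_zero]
  rw [isSeparating_iso f hb, smul_ite, smul_zero]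

/-- The cobracket of `HG`. -/
noncomputable def HG.cobracket : HG k →ₗ[k] HG k ⊗[k] HG k :=
  HG.lift (graphCobracket k) fun _ _ f => graphCobracket_iso k f

@[simp]
theorem HG.cobracket_graphClass (G : OGraph) :
    HG.cobracket k (graphClass k G) = graphCobracket k G := HG.lift_graphClass _ _ _

/-- The coproduct of `HG`. -/
noncomputable def HG.coproduct : HG k →ₗ[k] HG k ⊗[k] HG k :=
  HG.lift (cop k) fun _ _ f => cop_iso k f

@[simp]
theorem HG.coproduct_graphClass (G : OGraph) :
    HG.coproduct k (graphClass k G) = cop k G := HG.lift_graphClass _ _ _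

end Cobracket

/-! ### The projection onto the quotient by graphs with a cut vertex -/

section Projection

open OGraph

universe u

variable (k : Type u) [Field k] {G G' : OGraph}

theorem OGraph.Iso.isConnected_iff (f : Iso G G') : G'.IsConnected ↔ G.IsConnected :=
  f.toSimple.connected_iff.symm

theorem graphClass_mem_connectedPart (hG : G.IsConnected) : graphClass k G ∈ connectedPart k :=
  Submodule.subset_span ⟨G, hG, rfl⟩

open Classical in
/-- The projection of `HG` onto the subspace spanned by the connected graphs. -/
noncomputable def HG.connectedProj : HG k →ₗ[k] connectedPart k :=
  HG.lift (fun G => if h : G.IsConnected then ⟨graphClass k G, graphClass_mem_connectedPart k h⟩ else 0)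
    fun G G' f => by
      by_cases h : G.IsConnected
      · rw [dif_pos h, dif_pos (f.isConnected_iff.2 h)]
        exact Subtype.ext (graphClass_iso k f)
      · rw [dif_neg h, dif_neg (mt f.isConnected_iff.1 h), smul_zero]

theorem HG.connectedProj_coe (X : connectedPart k) : HG.connectedProj k (X : HG k) = X := by
  obtain ⟨X, hX⟩ := X
  induction hX using Submodule.span_induction with
  | mem X h =>
    obtain ⟨G, hG, rfl⟩ := h
    rw [HG.connectedProj, HG.lift_graphClass, dif_pos hG]
  | zero => exact map_zero _
  | add X Y h1 h2 hX hY => exact (map_add _ _ _).trans (congrArg₂ (· + ·) hX hY)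
  | smul a X h hX => exact (map_smul _ _ _).trans (congrArg (a • ·) hX)

/-- The projection of `HG` onto the quotient of the subspace spanned by connected graphs by the
connected graphs with a cut vertex. -/
noncomputable def HG.proj : HG k →ₗ[k] GModC k := toGModC k ∘ₗ HG.connectedProj k

theorem HG.proj_coe (X : connectedPart k) : HG.proj k (X : HG k) = toGModC k X := by
  rw [HG.proj, LinearMap.comp_apply, HG.connectedProj_coe]

theorem HG.proj_graphClass (hG : G.IsConnected) : HG.proj k (graphClass k G) =
    toGModC k ⟨graphClass k G, graphClass_mem_connectedPart k hG⟩ :=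
  HG.proj_coe k ⟨graphClass k G, graphClass_mem_connectedPart k hG⟩

theorem HG.proj_of_not_isConnected (hG : ¬ G.IsConnected) : HG.proj k (graphClass k G) = 0 := by
  rw [HG.proj, LinearMap.comp_apply, HG.connectedProj, HG.lift_graphClass, dif_neg hG, map_zero]

theorem HG.proj_of_hasCutVertex (hG : G.HasCutVertex) : HG.proj k (graphClass k G) = 0 := by
  by_cases h : G.IsConnected
  · rw [HG.proj_graphClass k h, toGModC, Submodule.mkQ_apply, Submodule.Quotient.mk_eq_zero]
    exact Submodule.subset_span ⟨G, h, hG, rfl⟩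
  · exact HG.proj_of_not_isConnected k h

theorem HG.proj_of_mem_cutPart {X : HG k} (hX : X ∈ cutPart k) : HG.proj k X = 0 := by
  suffices cutPart k ≤ LinearMap.ker (HG.proj k) from this hX
  rw [cutPart, Submodule.span_le]
  rintro _ ⟨G, hG, rfl⟩
  exact HG.proj_of_hasCutVertex k hG

theorem inclGModC_toGModC (X : connectedPart k) :
    inclGModC k (toGModC k X) = (cutPart k).mkQ X := rfl

theorem inclGModC_proj (hG : G.IsConnected) :
    inclGModC k (HG.proj k (graphClass k G)) = (cutPart k).mkQ (graphClass k G) := by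
  rw [HG.proj_graphClass k hG, inclGModC_toGModC]

/-- `HG.proj` kills all graphs with a cut vertex, so it factors through the quotient by `cutPart`
and provides a left inverse. -/
theorem inclGModC_injective : Function.Injective (inclGModC k) := by
  have h : ∀ X, (cutPart k).liftQ (HG.proj k) (fun _ h => HG.proj_of_mem_cutPart k h)
      (inclGModC k X) = X := by
    intro X
    obtain ⟨X, rfl⟩ := Submodule.mkQ_surjective _ X
    exact HG.proj_coe k X
  exact Function.LeftInverse.injective h

/-- The working criterion for vanishing: edges leave `S` only towards `c`, so `c` separates `s` from
`q`. Connectedness need not be assumed, because disconnected graphs are killed as well. -/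
theorem HG.proj_of_set (c : G.V) (S : Set G.V) (hc : c ∉ S) {s q : G.V} (hs : s ∈ S) (hq : q ∉ S)
    (hqc : q ≠ c) (h : ∀ a, G.vert a ∈ S → G.vert (G.bar a) ∈ S ∨ G.vert (G.bar a) = c) :
    HG.proj k (graphClass k G) = 0 := by
  by_cases hG : G.IsConnected
  · refine HG.proj_of_hasCutVertex k ⟨c, ⟨s, fun e => hc (e ▸ hs)⟩, ⟨q, hqc⟩, hG.preconnected _ _, ?_⟩
    rintro ⟨p⟩
    have key : ∀ {u v : {u : G.V | u ≠ c}}, (G.toSimple.induce {u : G.V | u ≠ c}).Walk u v →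
        u.1 ∈ S → v.1 ∈ S := by
      intro u v p
      induction p with
      | nil => exact id
      | @cons u v w huv _ ih =>
        intro hu
        refine ih ?_
        obtain ⟨-, a, h1, h2⟩ : G.toSimple.Adj u.1 v.1 := huv
        rcases h a (h1 ▸ hu) with h3 | h3
        · exact h2 ▸ h3
        · exact absurd (h2.symm.trans h3) v.2
    exact hq (key p hs)
  · exact HG.proj_of_not_isConnected k hG

/-- Exchanging the two halves of a loop fixes all vertices and reverses one edge. In characteristic
zero a graph with a loop therefore vanishes. -/
theorem exists_iso_flip (G : OGraph) (a : G.H) (h : G.vert (G.bar a) = G.vert a) :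
    ∃ f : Iso G G, f.sign = -1 := by
  refine ⟨⟨Equiv.refl _, Equiv.swap a (G.bar a), fun b => ?_, fun b => ?_⟩, ?_⟩
  · have h1 := @G.bar_eq_iff b a
    have h3 := @G.bar_inj b a
    have h2 := G.bar_bar a
    simp only [Equiv.swap_apply_def]
    grind
  · simp only [Equiv.swap_apply_def, Equiv.refl_apply]
    split_ifs with h1 h2
    · rw [h, h1]
    · rw [h2, h]
    · rfl
  · rw [Iso.sign_eq, vertSign_of_strictMono, one_mul, dirSign_eq_mul a (G.bar a) (G.bar_ne a)]
    · simp [G.dir_bar]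
    · exact G.dir_bar a
    · simp [G.dir_bar]
    · intro b h1 h2
      change G.dir (Equiv.swap _ _ _) = _
      rw [Equiv.swap_apply_of_ne_of_ne h1 h2]
    · exact fun _ _ h => h

variable [CharZero k]

theorem graphClass_of_loop (a : G.H) (h : G.vert (G.bar a) = G.vert a) : graphClass k G = 0 := by
  obtain ⟨f, hf⟩ := exists_iso_flip G a h
  have h1 := graphClass_iso k f
  rw [hf, Units.neg_smul, one_smul] at h1
  have h2 : (2 : k) • graphClass k G = 0 := by
    rw [two_smul]
    nth_rewrite 1 [h1]
    exact neg_add_cancel _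
  exact (smul_eq_zero.1 h2).resolve_left two_ne_zero

/-- An end of a bridge is a cut vertex: its valence is at least three, so another edge leads to a
further vertex on the same side, unless that edge is a loop, in which case the graph is zero. -/
theorem graphClass_mem_cutPart_of_bridge (a : G.H) (S : Set G.V) (h1 : G.vert a ∈ S)
    (h2 : G.vert (G.bar a) ∉ S)
    (h : ∀ b, b ≠ a → b ≠ G.bar a → (G.vert (G.bar b) ∈ S ↔ G.vert b ∈ S)) :
    graphClass k G ∈ cutPart k := by
  obtain ⟨b, hb, hba⟩ : ∃ b ∈ Finset.univ.filter fun b => G.vert b = G.vert a, b ≠ a := by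
    refine Finset.exists_mem_ne ?_ a
    have := G.three_le_valence (G.vert a)
    omega
  have hb : G.vert b = G.vert a := by simpa using hb
  by_cases hl : G.vert (G.bar b) = G.vert b
  · rw [graphClass_of_loop k b hl]
    exact zero_mem _
  have hbS : G.vert (G.bar b) ∈ S :=
    (h b hba fun e => h2 (by rw [← e, hb]; exact h1)).2 (by rw [hb]; exact h1)
  have hba' : G.vert (G.bar b) ≠ G.vert a := fun e => hl (e.trans hb.symm)
  have haa : G.vert (G.bar a) ≠ G.vert a := fun e => h2 (e ▸ h1)
  refine Submodule.subset_span ⟨G, ⟨G.vert a, ⟨G.vert (G.bar b), hba'⟩, ⟨G.vert (G.bar a), haa⟩,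
    ?_, ?_⟩, rfl⟩
  · exact (reachable_bar b).symm.trans (by rw [hb]; exact reachable_bar a)
  · rintro ⟨p⟩
    have key : ∀ {u v : {u : G.V | u ≠ G.vert a}},
        (G.toSimple.induce {u : G.V | u ≠ G.vert a}).Walk u v → u.1 ∈ S → v.1 ∈ S := by
      intro u v p
      induction p with
      | nil => exact id
      | @cons u v w huv _ ih =>
        intro hu
        refine ih ?_
        obtain ⟨-, c, h3, h4⟩ : G.toSimple.Adj u.1 v.1 := huv
        rw [← h4, h c, h3]
        · exact hu
        · rintro rfl
          exact u.2 h3.symm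
        · rintro rfl
          rw [G.bar_bar] at h4
          exact v.2 h4.symm
    exact h2 (key p hbS)

/-- A graph has no bridge if a set of vertices which is closed with respect to all edges but one is
closed. -/
def OGraph.NoBridge (G : OGraph) : Prop := ∀ (a : G.H) (S : Set G.V),
  (∀ b, b ≠ a → b ≠ G.bar a → (G.vert (G.bar b) ∈ S ↔ G.vert b ∈ S)) → G.IsClosed S

theorem HG.proj_of_not_noBridge (hG : ¬ G.NoBridge) : HG.proj k (graphClass k G) = 0 := by
  apply HG.proj_of_mem_cutPart
  simp only [NoBridge, not_forall] at hG
  obtain ⟨a, S, h, hS⟩ := hG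
  by_cases h1 : G.vert a ∈ S <;> by_cases h2 : G.vert (G.bar a) ∈ S
  rotate_left
  · exact graphClass_mem_cutPart_of_bridge k a S h1 h2 h
  · refine graphClass_mem_cutPart_of_bridge k (G.bar a) S h2 (by rwa [G.bar_bar]) ?_
    rw [G.bar_bar]
    exact fun b hb hb' => h b hb' hb
  all_goals
    refine absurd (fun b => ?_) hS
    by_cases hb : b = a
    · simp [hb, h1, h2]
    · by_cases hb' : b = G.bar a
      · simp [hb', h1, h2, G.bar_bar]
      · exact h b hb hb'

end Projection

/-! ### The grading -/

section Grading

open OGraph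

universe u

variable (k : Type u) [Field k]

theorem HG.proj_mem_gradeGModC (G : OGraph) : HG.proj k (graphClass k G) ∈ gradeGModC k G.degree := by
  by_cases hG : G.IsConnected
  · exact Submodule.subset_span ⟨G, hG, rfl, HG.proj_graphClass k hG⟩
  · rw [HG.proj_of_not_isConnected k hG]
    exact zero_mem _

theorem OGraph.Iso.degree_eq {G G' : OGraph} (f : Iso G G') : G'.degree = G.degree :=
  (Fintype.card_congr f.onV).symm

/-- The map sending an element of `HG` to the homogeneous components of its projection. -/
noncomputable def HG.components : HG k →ₗ[k] ℤ →₀ GModC k :=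
  HG.lift (fun G => Finsupp.single (G.degree : ℤ) (HG.proj k (graphClass k G))) fun G G' f => by
    rw [f.degree_eq, graphClass_iso k f, LinearMap.map_smul_of_tower, Finsupp.smul_single]

theorem HG.components_graphClass (G : OGraph) : HG.components k (graphClass k G) =
    Finsupp.single (G.degree : ℤ) (HG.proj k (graphClass k G)) := HG.lift_graphClass _ _ _

theorem HG.connectedCutPart_le_ker_components :
    connectedCutPart k ≤ LinearMap.ker (HG.components k) := by
  refine Submodule.span_le.2 ?_
  rintro _ ⟨G, -, hG, rfl⟩
  rw [SetLike.mem_coe, LinearMap.mem_ker, HG.components_graphClass, HG.proj_of_hasCutVertex k hG,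
    Finsupp.single_zero]

/-- The map sending an element of the quotient to its homogeneous components. -/
noncomputable def GModC.components : GModC k →ₗ[k] ℤ →₀ GModC k :=
  Submodule.liftQ _ (HG.components k ∘ₗ (connectedPart k).subtype)
    fun _ hX => HG.connectedCutPart_le_ker_components k hX

theorem GModC.components_proj (G : OGraph) : GModC.components k (HG.proj k (graphClass k G)) =
    Finsupp.single (G.degree : ℤ) (HG.proj k (graphClass k G)) := by
  by_cases hG : G.IsConnected
  · nth_rewrite 1 [HG.proj_graphClass k hG]
    exact HG.components_graphClass k G
  · rw [HG.proj_of_not_isConnected k hG, map_zero, Finsupp.single_zero]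

theorem gradeGModC_eq (n : ℤ) : gradeGModC k n =
    Submodule.span k {X | ∃ G : OGraph, (G.degree : ℤ) = n ∧ X = HG.proj k (graphClass k G)} := by
  apply le_antisymm
  · refine Submodule.span_mono ?_
    rintro _ ⟨G, hG, hn, rfl⟩
    exact ⟨G, hn, (HG.proj_graphClass k hG).symm⟩
  · rw [Submodule.span_le]
    rintro _ ⟨G, rfl, rfl⟩
    exact HG.proj_mem_gradeGModC k G

theorem GModC.components_of_mem {n : ℤ} {X : GModC k} (hX : X ∈ gradeGModC k n) :
    GModC.components k X = Finsupp.single n X := by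
  rw [gradeGModC_eq] at hX
  induction hX using Submodule.span_induction with
  | mem X h =>
    obtain ⟨G, rfl, rfl⟩ := h
    exact GModC.components_proj k G
  | zero => rw [map_zero, Finsupp.single_zero]
  | add X Y h1 h2 hX hY => rw [map_add, hX, hY, Finsupp.single_add]
  | smul a X h hX => rw [map_smul, hX, Finsupp.smul_single]

theorem HG.proj_surjective : Function.Surjective (HG.proj k) := by
  intro X
  obtain ⟨X, rfl⟩ := Submodule.mkQ_surjective _ X
  exact ⟨X, HG.proj_coe k X⟩

theorem GModC.span_proj :
    Submodule.span k (Set.range fun G => HG.proj k (graphClass k G)) = ⊤ := by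
  have := congrArg (Submodule.map (HG.proj k)) (HG.span_graphClass (k := k))
  rw [Submodule.map_span, Submodule.map_top, LinearMap.range_eq_top.2 (HG.proj_surjective k),
    ← Set.range_comp] at this
  exact this

theorem isInternal_gradeGModC : DirectSum.IsInternal (gradeGModC k) := by
  constructor
  -- Reading off homogeneous components inverts the summation map on the left, which proves that the
  -- sum is direct.
  · have key : ∀ (d : DirectSum ℤ fun n => gradeGModC k n) n,
        GModC.components k (DirectSum.coeLinearMap (gradeGModC k) d) n = d n := by
      intro d n
      induction d using DirectSum.induction_on with
      | zero => simp
      | of m X =>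
        have : DirectSum.coeLinearMap (gradeGModC k) (DirectSum.of _ m X) = X :=
          DirectSum.coeLinearMap_of (gradeGModC k) m X
        rw [this, GModC.components_of_mem k X.2]
        by_cases h : m = n
        · subst h
          rw [Finsupp.single_eq_same, DirectSum.of_eq_same]
        · rw [Finsupp.single_eq_of_ne (Ne.symm h), DirectSum.of_eq_of_ne _ _ _ (Ne.symm h)]
          rfl
      | add d e hd he =>
        rw [map_add, map_add, Finsupp.add_apply, hd, he]
        rfl
    intro d e hde
    refine DFinsupp.ext fun n => Subtype.ext ?_
    rw [← key, ← key]
    exact congrArg (fun X => GModC.components k X n) hde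
  · have : LinearMap.range (DirectSum.coeLinearMap (gradeGModC k)) = ⊤ := by
      rw [eq_top_iff, ← GModC.span_proj, Submodule.span_le]
      rintro _ ⟨G, rfl⟩
      exact ⟨DirectSum.lof k ℤ (fun n => gradeGModC k n) G.degree ⟨_, HG.proj_mem_gradeGModC k G⟩,
        DirectSum.coeLinearMap_of (gradeGModC k) _ _⟩
    exact LinearMap.range_eq_top.1 this

end Grading

/-! ### Reduction to connected graphs without bridges -/

section Good

open OGraph

universe u

variable (k : Type u) [Field k] [CharZero k]

/-- All other generators project to zero. The restriction matters because brackets of bridgeless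
connected graphs consist of connected graphs in `HG` itself, not only modulo `cutPart`. -/
theorem gradeGModC_le {n : ℤ} {P : Submodule k (GModC k)} (h : ∀ G : OGraph, G.IsConnected →
    G.NoBridge → (G.degree : ℤ) = n → HG.proj k (graphClass k G) ∈ P) : gradeGModC k n ≤ P := by
  rw [gradeGModC_eq, Submodule.span_le]
  rintro _ ⟨G, hn, rfl⟩
  by_cases h1 : G.IsConnected
  · by_cases h2 : G.NoBridge
    · exact h G h1 h2 hn
    · rw [HG.proj_of_not_noBridge k h2]
      exact zero_mem _
  · rw [HG.proj_of_not_isConnected k h1]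
    exact zero_mem _

theorem GModC.eq_top {P : Submodule k (GModC k)} (h : ∀ G : OGraph, G.IsConnected →
    G.NoBridge → HG.proj k (graphClass k G) ∈ P) : P = ⊤ := by
  rw [eq_top_iff, ← GModC.span_proj, Submodule.span_le]
  rintro _ ⟨G, rfl⟩
  exact gradeGModC_le k (fun G h1 h2 _ => h G h1 h2) (HG.proj_mem_gradeGModC k G)

end Good

/-! ### The bracket of the quotient -/

namespace OGraph

section

variable (G : OGraph) {x y : G.H} (h : G.vert x ≠ G.vert y)

/-- The map from the vertices of a graph to those of a contraction. -/
def ctrMap (v : G.V) : (G.contract x y h).V :=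
  if hv : v = G.vert y then G.mergedV h else G.toCtrV h v hv

theorem ctrV_ctrMap (v : G.V) : G.ctrV h (G.ctrMap h v) = if v = G.vert y then G.vert x else v := by
  rw [ctrMap]
  split_ifs <;> rfl

@[simp]
theorem ctrMap_ctrV (v : (G.contract x y h).V) : G.ctrMap h (G.ctrV h v) = v :=
  G.ctrV_injective h (by rw [ctrV_ctrMap, if_neg (G.ctrV_ne h v)])

@[simp]
theorem ctrMap_left : G.ctrMap h (G.vert x) = G.mergedV h :=
  G.ctrV_injective h (by rw [ctrV_ctrMap, if_neg h]; rfl)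

@[simp]
theorem ctrMap_right : G.ctrMap h (G.vert y) = G.mergedV h :=
  G.ctrV_injective h (by rw [ctrV_ctrMap, if_pos rfl]; rfl)

theorem ctrMap_surjective : Function.Surjective (G.ctrMap h) := fun v => ⟨_, G.ctrMap_ctrV h v⟩

theorem ctrMap_eq_iff {u v : G.V} (hv : v ≠ G.vert x) (hv' : v ≠ G.vert y) :
    G.ctrMap h u = G.ctrMap h v ↔ u = v := by
  rw [← (G.ctrV_injective h).eq_iff, ctrV_ctrMap, ctrV_ctrMap, if_neg hv']
  split_ifs with hu
  · rw [hu]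
    exact ⟨fun e => absurd e.symm hv, fun e => absurd e.symm hv'⟩
  · rfl

theorem ctrMap_eq_merged {u : G.V} :
    G.ctrMap h u = G.mergedV h ↔ u = G.vert x ∨ u = G.vert y := by
  rw [← (G.ctrV_injective h).eq_iff, ctrV_ctrMap, ctrV_mergedV]
  split_ifs with hu <;> simp [hu]

theorem contract_vert (a : (G.contract x y h).H) :
    (G.contract x y h).vert a = G.ctrMap h (G.vert (G.ctrH h a)) :=
  G.ctrV_injective h (by rw [ctrV_vert, ctrV_ctrMap])

theorem contract_vert_bar (a : (G.contract x y h).H) :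
    (G.contract x y h).vert ((G.contract x y h).bar a) =
      G.ctrMap h (G.vert (if G.ctrH h a = G.bar x then G.bar y else
        if G.ctrH h a = G.bar y then G.bar x else G.bar (G.ctrH h a))) := by
  rw [contract_vert, ctrH_bar]

/-- The edges of a contraction are the uncut edges of `G` and one new edge from `G.bar y` to `G.bar
x`; closedness can be tested on these in `G`. -/
theorem contract_isClosed_iff (hb : y ≠ G.bar x) {S : Set (G.contract x y h).V} {S' : Set G.V}
    (hS : ∀ v, G.ctrMap h v ∈ S ↔ v ∈ S') : (G.contract x y h).IsClosed S ↔
      (∀ b, b ≠ x → b ≠ y → b ≠ G.bar x → b ≠ G.bar y → (G.vert (G.bar b) ∈ S' ↔ G.vert b ∈ S')) ∧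
        (G.vert (G.bar y) ∈ S' ↔ G.vert (G.bar x) ∈ S') := by
  constructor
  · intro hc
    constructor
    · intro b h1 h2 h3 h4
      have := hc (G.toCtrH h b ⟨h1, h2⟩)
      rwa [contract_vert_bar, contract_vert, ctrH_toCtrH, if_neg h3, if_neg h4, hS, hS] at this
    · have := hc (G.newH h hb)
      rwa [contract_vert_bar, contract_vert, ctrH_newH, if_pos rfl, hS, hS] at this
  · rintro ⟨h1, h2⟩ a
    rw [contract_vert_bar, contract_vert, hS, hS]
    obtain ⟨h3, h4⟩ := G.ctrH_ne h a
    split_ifs with h5 h6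
    · rwa [h5]
    · rw [h6, h2]
    · exact h1 _ h3 h4 h5 h6

end

/-- No edge joins the two sides of a cut vertex, so at least one side avoids both ends of the edge
of `x`. -/
theorem IsCutVertex.exists_set {G : OGraph} {c : G.V} (hc : G.IsCutVertex c) (x : G.H) :
    ∃ S : Set G.V, c ∉ S ∧ S.Nonempty ∧ (∃ q, q ∉ S ∧ q ≠ c) ∧
      (∀ a, G.vert a ∈ S → G.vert (G.bar a) ∈ S ∨ G.vert (G.bar a) = c) ∧
      G.vert x ∉ S ∧ G.vert (G.bar x) ∉ S := by
  obtain ⟨a, b, -, hab⟩ := hc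
  let S : Set G.V := {u | ∃ hu : u ≠ c, (G.toSimple.induce {u : G.V | u ≠ c}).Reachable a ⟨u, hu⟩}
  have h1 : c ∉ S := fun h => h.1 rfl
  have h2 : a.1 ∈ S := ⟨a.2, SimpleGraph.Reachable.refl _⟩
  have h3 : b.1 ∉ S := fun h => hab h.2
  have h4 : ∀ h, G.vert h ∈ S → G.vert (G.bar h) ∈ S ∨ G.vert (G.bar h) = c := by
    rintro h ⟨hu, hr⟩
    by_cases hc : G.vert (G.bar h) = c
    · exact Or.inr hc
    refine Or.inl ⟨hc, ?_⟩
    by_cases e : G.vert h = G.vert (G.bar h)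
    · simpa [← e] using hr
    · refine hr.trans (SimpleGraph.Adj.reachable ?_)
      exact ⟨e, h, rfl, rfl⟩
  by_cases hx : G.vert x ∈ S ∨ G.vert (G.bar x) ∈ S
  · have h5 : ∀ h, G.vert h ∈ S → ¬ (G.vert (G.bar h) ∉ S ∧ G.vert (G.bar h) ≠ c) := by
      intro h hh hn
      exact (h4 h hh).elim hn.1 hn.2
    -- The component `S` of `a` meets the edge of `x`, so everything outside `S` except `c` is taken
    -- instead.
    refine ⟨{u | u ∉ S ∧ u ≠ c}, fun h => h.2 rfl, ⟨b, h3, b.2⟩, ⟨a, fun h => h.1 h2, a.2⟩, ?_, ?_, ?_⟩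
    · intro h hh
      have := h5 (G.bar h)
      rw [G.bar_bar] at this
      by_cases e : G.vert (G.bar h) = c
      · exact Or.inr e
      · exact Or.inl ⟨fun hS => this hS hh, e⟩
    · rcases hx with hx | hx
      · exact fun h => h.1 hx
      · have := h5 _ hx
        rwa [G.bar_bar] at this
    · rcases hx with hx | hx
      · exact h5 _ hx
      · exact fun h => h.1 hx
  · rw [not_or] at hx
    exact ⟨S, h1, ⟨a, h2⟩, ⟨b, h3, b.2⟩, h4, hx.1, hx.2⟩

/-- Cutting one edge does not disconnect `X` or `Y`, as neither has a bridge, and the two graphs are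
then joined at the merged vertex. -/
theorem contract_isConnected {X Y : OGraph} (hX : X.IsConnected) (hY : Y.IsConnected)
    (hX' : X.NoBridge) (hY' : Y.NoBridge) (x : X.H) (y : Y.H)
    (h : (X.disjUnion Y).vert (inlH X Y x) ≠ (X.disjUnion Y).vert (inrH X Y y)) :
    ((X.disjUnion Y).contract (inlH X Y x) (inrH X Y y) h).IsConnected := by
  rw [isConnected_iff]
  refine ⟨⟨mergedV _ h⟩, fun S hS ⟨s, hs⟩ => ?_⟩
  have hb : inrH X Y y ≠ (X.disjUnion Y).bar (inlH X Y x) := by simp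
  rw [contract_isClosed_iff _ h hb (S := S) (S' := {v | ctrMap _ h v ∈ S}) fun v => Iff.rfl] at hS
  simp only [forall_disjUnionH, bar_inlH, bar_inrH, vert_inlH, vert_inrH, ne_eq, inlH_inj,
    inlH_ne_inrH, inrH_ne_inlH, inrH_inj, not_false_eq_true, true_imp_iff] at hS
  obtain ⟨⟨h1, h2⟩, h3⟩ := hS
  have c1 := hX' x {v | ctrMap _ h (inlV X Y v) ∈ S} fun b e e' => h1 b e e'
  have c2 := hY' y {v | ctrMap _ h (inrV X Y v) ∈ S} fun b e e' => h2 b e e'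
  have hm : ctrMap _ h (inlV X Y (X.vert x)) = ctrMap _ h (inrV X Y (Y.vert y)) := by
    rw [← vert_inlH, ← vert_inrH, ctrMap_left, ctrMap_right]
  rw [isConnected_iff] at hX hY
  have d1 := hX.2 _ c1
  have d2 := hY.2 _ c2
  have e : (∃ v, ctrMap _ h (inlV X Y v) ∈ S) ∨ (∃ v, ctrMap _ h (inrV X Y v) ∈ S) := by
    obtain ⟨v, rfl⟩ := ctrMap_surjective _ h s
    exact (exists_disjUnionV (P := fun v => ctrMap _ h v ∈ S)).1 ⟨v, hs⟩
  have f1 : (∃ v, ctrMap _ h (inlV X Y v) ∈ S) → ∀ v, ctrMap _ h (inlV X Y v) ∈ S :=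
    fun e v => (d1 e).ge (Set.mem_univ v)
  have f2 : (∃ v, ctrMap _ h (inrV X Y v) ∈ S) → ∀ v, ctrMap _ h (inrV X Y v) ∈ S :=
    fun e v => (d2 e).ge (Set.mem_univ v)
  have g : (∀ v, ctrMap _ h (inlV X Y v) ∈ S) ∧ (∀ v, ctrMap _ h (inrV X Y v) ∈ S) := by
    rcases e with e | e
    · exact ⟨f1 e, f2 ⟨Y.vert y, hm ▸ f1 e _⟩⟩
    · exact ⟨f1 ⟨X.vert x, hm ▸ f2 e _⟩, f2 e⟩
  refine Set.eq_univ_of_forall fun u => ?_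
  obtain ⟨v, rfl⟩ := ctrMap_surjective _ h u
  revert v
  rw [forall_disjUnionV]
  exact g

end OGraph

section QuotientBracket

open OGraph

universe u

variable (k : Type u) [Field k]

/-- A side of the cut vertex that avoids the edge of `x` is untouched by the contraction, so the
image of `c` still separates it. -/
theorem HG.proj_contr_of_hasCutVertex {X Y : OGraph} (hX : X.HasCutVertex) (x : X.H) (y : Y.H) :
    HG.proj k (contr k (X.disjUnion Y) (inlH X Y x) (inrH X Y y)) = 0 := by
  obtain ⟨c, hc⟩ := hX
  obtain ⟨S, hcS, ⟨s, hs⟩, ⟨q, hq, hqc⟩, hS, hx, hx'⟩ := hc.exists_set x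
  have h : (X.disjUnion Y).vert (inlH X Y x) ≠ (X.disjUnion Y).vert (inrH X Y y) := by simp
  have hb : inrH X Y y ≠ (X.disjUnion Y).bar (inlH X Y x) := by simp
  have hinj : ∀ u v, ctrMap _ h (inlV X Y u) = ctrMap _ h (inlV X Y v) ↔ u = v := by
    intro u v
    rw [← (ctrV_injective _ h).eq_iff, ctrV_ctrMap, ctrV_ctrMap]
    simp
  have hS' : ∀ u, ctrMap _ h u ∈ (fun v => ctrMap _ h (inlV X Y v)) '' S ↔
      ∃ v ∈ S, u = inlV X Y v := by
    rw [forall_disjUnionV]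
    constructor <;> intro u
    · simp [hinj]
    · simp only [Set.mem_image, inrV_ne_inlV, and_false, exists_false, iff_false]
      rintro ⟨v, hv, e⟩
      rw [eq_comm, ctrMap_eq_iff] at e
      · simp at e
      · simp only [vert_inlH, ne_eq, inlV_inj]
        rintro rfl
        exact hx hv
      · simp
  rw [contr_of_ne h hb, LinearMap.map_smul_of_tower,
    HG.proj_of_set k (ctrMap _ h (inlV X Y c)) ((fun v => ctrMap _ h (inlV X Y v)) '' S)
      (s := ctrMap _ h (inlV X Y s)) (q := ctrMap _ h (inlV X Y q)), smul_zero]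
  · rw [hS']
    simpa using hcS
  · exact ⟨s, hs, rfl⟩
  · rw [hS']
    simpa using hq
  · rwa [Ne, hinj]
  · intro a
    rw [contract_vert, contract_vert_bar]
    generalize ctrH _ h a = b
    revert b
    rw [forall_disjUnionH]
    constructor <;> intro b
    · simp only [bar_inlH, bar_inrH, inlH_inj, inlH_ne_inrH, if_false, vert_inlH, hS', inlV_inj,
        exists_eq_right']
      intro hbS
      have hbx : b ≠ X.bar x := by
        rintro rfl
        exact hx' hbS
      rw [if_neg hbx, vert_inlH, hinj]
      simpa using hS b hbS
    · simp [hS']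

theorem units_smul_mem {R M : Type*} [CommRing R] [AddCommGroup M] [Module R M] {P : Submodule R M}
    (a : ℤˣ) {X : M} (hX : X ∈ P) : a • X ∈ P := by
  rcases Int.units_eq_one_or a with rfl | rfl
  · rwa [one_smul]
  · rw [Units.neg_smul, one_smul]
    exact neg_mem hX

/-- If the contraction is disconnected, the new edge lies in a component away from the merged
vertex. That component consists of a piece of `X` and a piece of `Y` joined only by the new edge,
which is therefore a bridge. -/
theorem contr_connected_or_mem_cutPart [CharZero k] {X Y : OGraph} (hX : X.IsConnected) (hY : Y.IsConnected)
    (x : X.H) (y : Y.H) : (∃ h,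
      ((X.disjUnion Y).contract (inlH X Y x) (inrH X Y y) h).IsConnected) ∨
      contr k (X.disjUnion Y) (inlH X Y x) (inrH X Y y) ∈ cutPart k := by
  have h : (X.disjUnion Y).vert (inlH X Y x) ≠ (X.disjUnion Y).vert (inrH X Y y) := by simp
  have hb : inrH X Y y ≠ (X.disjUnion Y).bar (inlH X Y x) := by simp
  by_cases hc : ((X.disjUnion Y).contract (inlH X Y x) (inrH X Y y) h).IsConnected
  · exact Or.inl ⟨h, hc⟩
  right
  obtain ⟨S, hS, hm, u, hu⟩ : ∃ S, ((X.disjUnion Y).contract _ _ h).IsClosed S ∧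
      mergedV _ h ∈ S ∧ ∃ u, u ∉ S := by
    rw [OGraph.isConnected_iff] at hc
    push Not at hc
    obtain ⟨S, hS, ⟨s, hs⟩, hS'⟩ := hc ⟨mergedV _ h⟩
    obtain ⟨u, hu⟩ := (Set.ne_univ_iff_exists_notMem _).1 hS'
    by_cases hm : mergedV _ h ∈ S
    · exact ⟨S, hS, hm, u, hu⟩
    · exact ⟨Sᶜ, hS.compl, hm, s, fun h => h hs⟩
  have hm1 : ctrMap _ h (inlV X Y (X.vert x)) = mergedV _ h := by rw [← vert_inlH, ctrMap_left]
  have hm2 : ctrMap _ h (inrV X Y (Y.vert y)) = mergedV _ h := by rw [← vert_inrH, ctrMap_right]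
  have hm1' : ctrMap _ h (inlV X Y (X.vert x)) ∈ S := by rwa [hm1]
  have hm2' : ctrMap _ h (inrV X Y (Y.vert y)) ∈ S := by rwa [hm2]
  rw [contract_isClosed_iff _ h hb (S := S) (S' := {v | ctrMap _ h v ∈ S}) fun v => Iff.rfl] at hS
  simp only [forall_disjUnionH, bar_inlH, bar_inrH, vert_inlH, vert_inrH, ne_eq, inlH_inj,
    inlH_ne_inrH, inrH_ne_inlH, inrH_inj, not_false_eq_true, true_imp_iff, Set.mem_ofPred_eq] at hS
  obtain ⟨⟨h1, h2⟩, h3⟩ := hS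
  -- Otherwise all ends of the cut edges lie in `S`, and its traces on `X` and on `Y` are closed and
  -- nonempty, hence everything.
  have hx : ctrMap _ h (inlV X Y (X.vert (X.bar x))) ∉ S := by
    intro hx
    have c1 : X.IsClosed {v | ctrMap _ h (inlV X Y v) ∈ S} := by
      intro b
      by_cases e1 : b = x
      · exact iff_of_true (by rwa [e1]) (by rw [e1]; exact hm1')
      by_cases e2 : b = X.bar x
      · exact iff_of_true (by rw [e2, X.bar_bar]; exact hm1') (by rwa [e2])
      exact h1 b e1 e2
    have c2 : Y.IsClosed {v | ctrMap _ h (inrV X Y v) ∈ S} := by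
      intro b
      by_cases e1 : b = y
      · exact iff_of_true (by rw [e1]; exact h3.2 hx) (by rw [e1]; exact hm2')
      by_cases e2 : b = Y.bar y
      · exact iff_of_true (by rw [e2, Y.bar_bar]; exact hm2') (by rw [e2]; exact h3.2 hx)
      exact h2 b e1 e2
    have d1 := (OGraph.isConnected_iff.1 hX).2 _ c1 ⟨X.vert x, hm1'⟩
    have d2 := (OGraph.isConnected_iff.1 hY).2 _ c2 ⟨Y.vert y, hm2'⟩
    obtain ⟨v, rfl⟩ := ctrMap_surjective _ h u
    revert v
    rw [forall_disjUnionV]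
    exact ⟨fun v hv => hv (d1.ge (Set.mem_univ v)), fun v hv => hv (d2.ge (Set.mem_univ v))⟩
  have hT : ∀ v, ctrMap _ h v ∈ {u | u ∉ S ∧ ∃ v, u = ctrMap _ h (inlV X Y v)} ↔
      ctrMap _ h v ∉ S ∧ ∃ w, v = inlV X Y w := by
    rw [forall_disjUnionV]
    constructor <;> intro v
    · simp only [Set.mem_ofPred_eq, inlV_inj, exists_eq', and_true, and_iff_left_iff_imp]
      exact fun _ => ⟨v, rfl⟩
    · simp only [Set.mem_ofPred_eq, inrV_ne_inlV, exists_false, and_false, iff_false, not_and,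
        not_exists]
      intro hv w e
      rw [eq_comm, ctrMap_eq_iff] at e
      · simp at e
      · simp
      · rw [vert_inrH, Ne, inrV_inj]
        rintro rfl
        exact hv (hm2')
  rw [contr_of_ne h hb]
  refine units_smul_mem _ (graphClass_mem_cutPart_of_bridge k (newH _ h hb)
    {u | u ∉ S ∧ ∃ v, u = ctrMap _ h (inlV X Y v)} ?_ ?_ ?_)
  · rw [contract_vert, ctrH_newH, bar_inlH, vert_inlH]
    exact ⟨hx, _, rfl⟩
  · rw [contract_vert_bar, ctrH_newH, if_pos rfl, bar_inrH, vert_inrH, hT]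
    simp
  · intro b hb1 hb2
    have hb1' : ctrH _ h b ≠ inlH X Y (X.bar x) := fun e => hb1 (ctrH_injective _ h e)
    have hb2' : ctrH _ h b ≠ inrH X Y (Y.bar y) := fun e => hb2 (ctrH_injective _ h (by
      rw [ctrH_bar, ctrH_newH, if_pos rfl, e, bar_inrH]))
    have hb3 := ctrH_ne _ h b
    rw [contract_vert_bar, contract_vert, bar_inlH, bar_inrH, if_neg hb1', if_neg hb2', hT, hT]
    revert hb1' hb2' hb3
    generalize ctrH _ h b = b
    revert b
    rw [forall_disjUnionH]
    constructor <;> intro b <;> intro e1 e2 e3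
    · simp only [bar_inlH, vert_inlH, inlV_inj, exists_eq', and_true]
      rw [h1 b (fun e => e3.1 (by rw [e])) fun e => e1 (by rw [e])]
    · simp

theorem connectedCutPart_le_cutPart : connectedCutPart k ≤ cutPart k :=
  Submodule.span_mono (by rintro _ ⟨G, -, h, rfl⟩; exact ⟨G, h, rfl⟩)

theorem HG.proj_graphBracket_of_hasCutVertex {X : OGraph} (Y : OGraph) (hX : X.HasCutVertex) :
    HG.proj k (graphBracket k X Y) = 0 := by
  rw [graphBracket_eq, map_sum]
  refine Finset.sum_eq_zero fun x _ => ?_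
  rw [map_sum]
  exact Finset.sum_eq_zero fun y _ => HG.proj_contr_of_hasCutVertex k hX x y

theorem HG.proj_bracket_left {X : HG k} (hX : X ∈ cutPart k) (Y : HG k) :
    HG.proj k (HG.bracket k X Y) = 0 := by
  suffices h : cutPart k ≤ LinearMap.ker ((HG.bracket k).compr₂ (HG.proj k)) from
    LinearMap.congr_fun (h hX) Y
  refine Submodule.span_le.2 ?_
  rintro _ ⟨G, hG, rfl⟩
  refine HG.hom_ext fun K => ?_
  rw [LinearMap.compr₂_apply, HG.bracket_graphClass, HG.proj_graphBracket_of_hasCutVertex k K hG]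
  rfl

theorem HG.proj_bracket_right {X : HG k} (hX : X ∈ cutPart k) (Y : HG k) :
    HG.proj k (HG.bracket k Y X) = 0 := by
  suffices h : cutPart k ≤ LinearMap.ker ((HG.bracket k).flip.compr₂ (HG.proj k)) from
    LinearMap.congr_fun (h hX) Y
  refine Submodule.span_le.2 ?_
  rintro _ ⟨G, hG, rfl⟩
  refine HG.hom_ext fun K => ?_
  rw [LinearMap.compr₂_apply, LinearMap.flip_apply, HG.bracket_graphClass, graphBracket_comm,
    LinearMap.map_smul_of_tower, HG.proj_graphBracket_of_hasCutVertex k K hG, smul_zero]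
  rfl

theorem exists_section : ∃ s : GModC k →ₗ[k] connectedPart k, ∀ X, toGModC k (s X) = X := by
  obtain ⟨s, hs⟩ := (toGModC k).exists_rightInverse_of_surjective
    (LinearMap.range_eq_top.2 (Submodule.mkQ_surjective _))
  exact ⟨s, fun X => LinearMap.congr_fun hs X⟩

/-- A linear choice of representatives. -/
noncomputable def GModC.lift : GModC k →ₗ[k] HG k :=
  (connectedPart k).subtype ∘ₗ (exists_section k).choose

theorem GModC.lift_sub_mem (X : connectedPart k) :
    GModC.lift k (toGModC k X) - X ∈ connectedCutPart k := by
  have h := (exists_section k).choose_spec (toGModC k X)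
  rw [← sub_eq_zero, ← map_sub] at h
  have h' : (exists_section k).choose (toGModC k X) - X ∈
      (connectedCutPart k).submoduleOf (connectedPart k) := (Submodule.Quotient.mk_eq_zero _).1 h
  exact h'

/-- The bracket of the quotient. -/
noncomputable def GModC.bracket : GModC k →ₗ[k] GModC k →ₗ[k] GModC k :=
  ((HG.bracket k).compl₁₂ (GModC.lift k) (GModC.lift k)).compr₂ (HG.proj k)

/-- Changing a representative by an element of the cut part changes the bracket by something that
`HG.proj` kills, so the choice made in `GModC.lift` is immaterial. -/
theorem GModC.bracket_toGModC (X Y : connectedPart k) :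
    GModC.bracket k (toGModC k X) (toGModC k Y) = HG.proj k (HG.bracket k X Y) := by
  have h1 := HG.proj_bracket_left k
    (connectedCutPart_le_cutPart k (GModC.lift_sub_mem k X)) (GModC.lift k (toGModC k Y))
  have h2 := HG.proj_bracket_right k
    (connectedCutPart_le_cutPart k (GModC.lift_sub_mem k Y)) X
  rw [map_sub, LinearMap.sub_apply, map_sub, sub_eq_zero] at h1
  rw [map_sub, map_sub, sub_eq_zero] at h2
  exact h1.trans h2

theorem GModC.bracket_proj {X Y : HG k} (hX : X ∈ connectedPart k) (hY : Y ∈ connectedPart k) :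
    GModC.bracket k (HG.proj k X) (HG.proj k Y) = HG.proj k (HG.bracket k X Y) := by
  have := GModC.bracket_toGModC k ⟨X, hX⟩ ⟨Y, hY⟩
  rwa [← HG.proj_coe, ← HG.proj_coe] at this

theorem inclGModC_proj_graphBracket [CharZero k] {X Y : OGraph} (hX : X.IsConnected) (hY : Y.IsConnected) :
    inclGModC k (HG.proj k (graphBracket k X Y)) = (cutPart k).mkQ (graphBracket k X Y) := by
  rw [graphBracket_eq]
  simp only [map_sum]
  refine Finset.sum_congr rfl fun x _ => Finset.sum_congr rfl fun y _ => ?_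
  rcases contr_connected_or_mem_cutPart k hX hY x y with ⟨h, hc⟩ | h
  · rw [contr_of_ne h (by simp), LinearMap.map_smul_of_tower, LinearMap.map_smul_of_tower,
      LinearMap.map_smul_of_tower, inclGModC_proj k hc]
  · rw [HG.proj_of_mem_cutPart k h, map_zero, Submodule.mkQ_apply,
      (Submodule.Quotient.mk_eq_zero _).2 h]

theorem inclGModC_bracket [CharZero k] (X Y : connectedPart k) :
    inclGModC k (GModC.bracket k (toGModC k X) (toGModC k Y)) =
      (cutPart k).mkQ (HG.bracket k X Y) := by
  rw [GModC.bracket_toGModC]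
  obtain ⟨X, hX⟩ := X
  obtain ⟨Y, hY⟩ := Y
  change inclGModC k (HG.proj k (HG.bracket k X Y)) = (cutPart k).mkQ (HG.bracket k X Y)
  induction hX using Submodule.span_induction with
  | zero => simp only [map_zero, LinearMap.zero_apply]
  | add X X' _ _ h h' => simp only [map_add, LinearMap.add_apply, h, h']
  | smul a X _ h => simp only [map_smul, LinearMap.smul_apply, h]
  | mem X h =>
    obtain ⟨G, hG, rfl⟩ := h
    induction hY using Submodule.span_induction with
    | zero => simp only [map_zero]
    | add X X' _ _ h h' => simp only [map_add, h, h']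
    | smul a X _ h => simp only [map_smul, h]
    | mem Y h =>
      obtain ⟨K, hK, rfl⟩ := h
      rw [HG.bracket_graphClass, inclGModC_proj_graphBracket k hG hK]

end QuotientBracket

/-! ### The cobracket of the quotient -/

section Criteria

open OGraph

universe u

variable (k : Type u) [Field k] {L : OGraph} {S : Set L.V}

theorem HG.proj_restrict_of_set (hS : L.IsClosed S) {c s q : L.V} {T : Set L.V} (hc : c ∈ S)
    (hcT : c ∉ T) (hsS : s ∈ S) (hs : s ∈ T) (hqS : q ∈ S) (hq : q ∉ T) (hqc : q ≠ c)
    (h : ∀ a, L.vert a ∈ S → L.vert a ∈ T → L.vert (L.bar a) ∈ T ∨ L.vert (L.bar a) = c) :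
    HG.proj k (graphClass k (L.restrict S hS)) = 0 := by
  refine HG.proj_of_set k (L.toResV hS c hc) {v | L.resV hS v ∈ T} hcT (s := L.toResV hS s hsS) hs
    (q := L.toResV hS q hqS) hq ?_ ?_
  · intro e
    exact hqc (congrArg (L.resV hS) e)
  · intro a ha
    have h1 := h (L.resH hS a) (L.resH_mem hS a) ha
    rcases h1 with h1 | h1
    · exact Or.inl h1
    · exact Or.inr (L.resV_injective hS h1)

variable [CharZero k]

theorem HG.proj_restrict_of_loop (hS : L.IsClosed S) {a : L.H} (ha : L.vert a ∈ S)
    (h : L.vert (L.bar a) = L.vert a) : HG.proj k (graphClass k (L.restrict S hS)) = 0 := by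
  rw [graphClass_of_loop k (L.toResH hS a ha), map_zero]
  exact L.resV_injective hS h

theorem HG.proj_restrict_of_bridge (hS : L.IsClosed S) {a : L.H} (ha : L.vert a ∈ S) {T : Set L.V}
    (h1 : L.vert a ∈ T) (h2 : L.vert (L.bar a) ∉ T) (h : ∀ b, L.vert b ∈ S → b ≠ a → b ≠ L.bar a →
      (L.vert (L.bar b) ∈ T ↔ L.vert b ∈ T)) :
    HG.proj k (graphClass k (L.restrict S hS)) = 0 := by
  refine HG.proj_of_mem_cutPart k (graphClass_mem_cutPart_of_bridge k (L.toResH hS a ha)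
    {v | L.resV hS v ∈ T} h1 h2 fun b hb hb' => h _ (L.resH_mem hS b) ?_ ?_)
  · exact fun e => hb (L.resH_injective hS e)
  · exact fun e => hb' (L.resH_injective hS e)

end Criteria

namespace OGraph

/-- A cut vertex `c` separating `R` from `Q`. -/
structure Separates (G : OGraph) (c : G.V) (R Q : Set G.V) : Prop where
  left : ∃ v, v ∈ R
  right : ∃ v, v ∈ Q
  disj : ∀ v, v ∈ R → v ∉ Q
  notMem_left : c ∉ R
  notMem_right : c ∉ Q
  cover : ∀ v, v ∈ R ∨ v ∈ Q ∨ v = c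
  bar_left : ∀ a, G.vert a ∈ R → G.vert (G.bar a) ∈ R ∨ G.vert (G.bar a) = c
  bar_right : ∀ a, G.vert a ∈ Q → G.vert (G.bar a) ∈ Q ∨ G.vert (G.bar a) = c

theorem Separates.symm {G : OGraph} {c : G.V} {R Q : Set G.V} (h : G.Separates c R Q) :
    G.Separates c Q R where
  left := h.right
  right := h.left
  disj v hv hv' := h.disj v hv' hv
  notMem_left := h.notMem_right
  notMem_right := h.notMem_left
  cover v := by rcases h.cover v with h | h | h <;> simp [h]
  bar_left := h.bar_right
  bar_right := h.bar_left

theorem IsCutVertex.exists_separates {G : OGraph} {c : G.V} (hc : G.IsCutVertex c) :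
    ∃ R Q, G.Separates c R Q := by
  -- Any half-edge will do here; it is only an argument for `exists_set`.
  obtain ⟨x, -⟩ : ∃ x : G.H, x ∈ Finset.univ.filter fun h => G.vert h = c := by
    refine Finset.card_pos.1 ?_
    have := G.three_le_valence c
    omega
  obtain ⟨S, h1, ⟨s, hs⟩, ⟨q, h2, h3⟩, h4, -⟩ := hc.exists_set x
  refine ⟨S, {v | v ∉ S ∧ v ≠ c}, ⟨s, hs⟩, ⟨q, h2, h3⟩, fun v hv hv' => hv'.1 hv, h1,
    fun h => h.2 rfl, fun v => ?_, h4, fun a ha => ?_⟩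
  · by_cases hv : v ∈ S
    · exact Or.inl hv
    · by_cases hv' : v = c
      · exact Or.inr (Or.inr hv')
      · exact Or.inr (Or.inl ⟨hv, hv'⟩)
  · by_cases e : G.vert (G.bar a) = c
    · exact Or.inr e
    · refine Or.inl ⟨fun h => ?_, e⟩
      have := h4 _ h
      rw [G.bar_bar] at this
      exact this.elim ha.1 ha.2

theorem exists_ne_vert (G : OGraph) (x : G.H) : ∃ a, a ≠ x ∧ G.vert a = G.vert x := by
  obtain ⟨b, hb, hba⟩ : ∃ b ∈ Finset.univ.filter fun b => G.vert b = G.vert x, b ≠ x := by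
    refine Finset.exists_mem_ne ?_ x
    have := G.three_le_valence (G.vert x)
    omega
  exact ⟨b, hba, by simpa using hb⟩

/-- A closed set of vertices of a contraction separating the merged vertex from the new edge, in
terms of its preimage `A`. -/
structure SeparatedBy (G : OGraph) (x y : G.H) (A : Set G.V) : Prop where
  left : G.vert x ∈ A
  right : G.vert y ∈ A
  bar_left : G.vert (G.bar x) ∉ A
  bar_right : G.vert (G.bar y) ∉ A
  closed : ∀ b, b ≠ x → b ≠ y → b ≠ G.bar x → b ≠ G.bar y → (G.vert (G.bar b) ∈ A ↔ G.vert b ∈ A)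

section

variable {G : OGraph} {x y : G.H} {A : Set G.V}

theorem SeparatedBy.closed_of_mem (hA : G.SeparatedBy x y A) {b : G.H} (h1 : b ≠ x) (h2 : b ≠ y)
    (h : G.vert b ∈ A) : b ≠ G.bar x ∧ b ≠ G.bar y ∧ G.vert (G.bar b) ∈ A := by
  have h3 : b ≠ G.bar x := by
    rintro rfl
    exact hA.bar_left h
  have h4 : b ≠ G.bar y := by
    rintro rfl
    exact hA.bar_right h
  exact ⟨h3, h4, (hA.closed b h1 h2 h3 h4).2 h⟩

theorem SeparatedBy.closed_of_notMem (hA : G.SeparatedBy x y A) {b : G.H} (h1 : b ≠ G.bar x)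
    (h2 : b ≠ G.bar y) (h : G.vert b ∉ A) : b ≠ x ∧ b ≠ y ∧ G.vert (G.bar b) ∉ A := by
  have h3 : b ≠ x := by
    rintro rfl
    exact h hA.left
  have h4 : b ≠ y := by
    rintro rfl
    exact h hA.right
  exact ⟨h3, h4, fun e => h ((hA.closed b h3 h4 h1 h2).1 e)⟩

variable (h : G.vert x ≠ G.vert y)

theorem exists_contract_half {b : G.H} (h1 : b ≠ x) (h2 : b ≠ y) (h3 : b ≠ G.bar x)
    (h4 : b ≠ G.bar y) : ∃ a, (G.contract x y h).vert a = G.ctrMap h (G.vert b) ∧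
      (G.contract x y h).vert ((G.contract x y h).bar a) = G.ctrMap h (G.vert (G.bar b)) := by
  refine ⟨G.toCtrH h b ⟨h1, h2⟩, ?_, ?_⟩
  · rw [contract_vert, ctrH_toCtrH]
  · rw [contract_vert_bar, ctrH_toCtrH, if_neg h3, if_neg h4]

theorem SeparatedBy.ctrMap_eq_iff (hA : G.SeparatedBy x y A) {u v : G.V} (hv : v ∉ A) :
    G.ctrMap h u = G.ctrMap h v ↔ u = v :=
  OGraph.ctrMap_eq_iff G h (fun e => hv (e ▸ hA.left)) fun e => hv (e ▸ hA.right)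

theorem SeparatedBy.of_mem (hA : G.SeparatedBy x y A) {S : Set (G.contract x y h).V}
    (hS : ∀ v, G.ctrMap h v ∈ S ↔ v ∈ A) {a : (G.contract x y h).H}
    (ha : (G.contract x y h).vert a ∈ S) : ∃ b, b ≠ x ∧ b ≠ y ∧ b ≠ G.bar x ∧ b ≠ G.bar y ∧
      G.vert b ∈ A ∧ G.vert (G.bar b) ∈ A ∧
      (G.contract x y h).vert a = G.ctrMap h (G.vert b) ∧
      (G.contract x y h).vert ((G.contract x y h).bar a) = G.ctrMap h (G.vert (G.bar b)) := by
  obtain ⟨h1, h2⟩ := G.ctrH_ne h a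
  rw [contract_vert, hS] at ha
  obtain ⟨h3, h4, h5⟩ := hA.closed_of_mem h1 h2 ha
  exact ⟨G.ctrH h a, h1, h2, h3, h4, ha, h5, G.contract_vert h a,
    by rw [contract_vert_bar, if_neg h3, if_neg h4]⟩

theorem SeparatedBy.of_notMem (hA : G.SeparatedBy x y A) (hb : y ≠ G.bar x)
    {S : Set (G.contract x y h).V}
    (hS : ∀ v, G.ctrMap h v ∈ S ↔ v ∈ A) {a : (G.contract x y h).H}
    (ha : (G.contract x y h).vert a ∉ S) (ha1 : a ≠ G.newH h hb)
    (ha2 : a ≠ (G.contract x y h).bar (G.newH h hb)) :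
    ∃ b, b ≠ x ∧ b ≠ y ∧ b ≠ G.bar x ∧ b ≠ G.bar y ∧
      G.vert b ∉ A ∧ G.vert (G.bar b) ∉ A ∧
      (G.contract x y h).vert a = G.ctrMap h (G.vert b) ∧
      (G.contract x y h).vert ((G.contract x y h).bar a) = G.ctrMap h (G.vert (G.bar b)) := by
  obtain ⟨h1, h2⟩ := G.ctrH_ne h a
  rw [contract_vert, hS] at ha
  have h3 : G.ctrH h a ≠ G.bar x := fun e => ha1 (G.ctrH_injective h e)
  have h4 : G.ctrH h a ≠ G.bar y := fun e => ha2 (G.ctrH_injective h (by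
    rw [ctrH_bar, ctrH_newH, if_pos rfl, e]))
  obtain ⟨-, -, h5⟩ := hA.closed_of_notMem h3 h4 ha
  exact ⟨G.ctrH h a, h1, h2, h3, h4, ha, h5, G.contract_vert h a,
    by rw [contract_vert_bar, if_neg h3, if_neg h4]⟩

end

end OGraph

/-! ### Splittings of a graph with a cut vertex have a vanishing factor -/

section CutVertex

open OGraph

universe u

variable (k : Type u) [Field k] [CharZero k] {G : OGraph} {x y : G.H} {A R Q : Set G.V} {c : G.V}

/-- The cut vertex lies on the side `A` of the merged vertex. If `Q` extends beyond `A`, the new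
edge is a bridge of the other part. If `Q ⊆ A`, then `c` still separates `Q` within the part of `A`,
unless the rest of `A` collapses to one point, and then a loop appears. -/
theorem HG.proj_restrict_of_cut_mem (hG : G.IsConnected) (h : G.vert x ≠ G.vert y)
    (hb : y ≠ G.bar x) (hA : G.SeparatedBy x y A) {S : Set (G.contract x y h).V}
    (hS : ∀ v, G.ctrMap h v ∈ S ↔ v ∈ A) (hc : (G.contract x y h).IsClosed S)
    (hsep : G.Separates c R Q) (hcA : c ∈ A) (hx : G.vert (G.bar x) ∈ R) :
    HG.proj k (graphClass k ((G.contract x y h).restrict S hc)) = 0 ∨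
      HG.proj k (graphClass k ((G.contract x y h).restrict Sᶜ hc.compl)) = 0 := by
  by_cases hQ : ∃ v ∈ Q, v ∉ A
  · right
    obtain ⟨v, hvQ, hvA⟩ := hQ
    -- If both ends of the new edge were in `R`, no edge would leave the portion of `Q` outside `A`,
    -- against the connectedness of `G`.
    have hy : G.vert (G.bar y) ∉ R := by
      intro hy
      have hcl : G.IsClosed {v | v ∈ Q ∧ v ∉ A} := by
        have key : ∀ b, G.vert b ∈ Q ∧ G.vert b ∉ A → G.vert (G.bar b) ∈ Q ∧ G.vert (G.bar b) ∉ A := by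
          rintro b ⟨h1, h2⟩
          obtain ⟨-, -, h3⟩ := hA.closed_of_notMem (b := b)
            (by rintro rfl; exact hsep.disj _ hx h1) (by rintro rfl; exact hsep.disj _ hy h1) h2
          refine ⟨(hsep.bar_right b h1).resolve_right fun e => h3 (e ▸ hcA), h3⟩
        refine fun b => ⟨fun hb => ?_, key b⟩
        simpa [G.bar_bar] using key _ hb
      have := (OGraph.isConnected_iff.1 hG).2 _ hcl ⟨v, hvQ, hvA⟩
      exact (this.ge (Set.mem_univ c)).2 hcA
    refine HG.proj_restrict_of_bridge k hc.compl (a := G.newH h hb)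
      (T := {u | ∃ v, v ∉ A ∧ v ∈ R ∧ u = G.ctrMap h v}) ?_ ?_ ?_ ?_
    · rw [contract_vert, ctrH_newH]
      exact fun e => hA.bar_left ((hS _).1 e)
    · rw [contract_vert, ctrH_newH]
      exact ⟨_, hA.bar_left, hx, rfl⟩
    · rw [contract_vert_bar, ctrH_newH, if_pos rfl]
      rintro ⟨v, h1, h2, h3⟩
      rw [hA.ctrMap_eq_iff h h1] at h3
      exact hy (h3 ▸ h2)
    · intro a ha ha1 ha2
      obtain ⟨b, -, -, -, -, h5, h6, h7, h8⟩ := hA.of_notMem h hb hS ha ha1 ha2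
      rw [h7, h8]
      constructor
      · rintro ⟨v, h1, h2, h3⟩
        rw [hA.ctrMap_eq_iff h h1] at h3
        have := hsep.bar_left (G.bar b) (h3 ▸ h2)
        rw [G.bar_bar] at this
        exact ⟨_, h5, this.resolve_right fun e => h5 (e ▸ hcA), rfl⟩
      · rintro ⟨v, h1, h2, h3⟩
        rw [hA.ctrMap_eq_iff h h1] at h3
        have := hsep.bar_left b (h3 ▸ h2)
        exact ⟨_, h6, this.resolve_right fun e => h6 (e ▸ hcA), rfl⟩
  · left
    push Not at hQ
    have hR : ∀ v, v ∉ A → v ∈ R := by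
      intro v hv
      rcases hsep.cover v with h1 | h1 | h1
      · exact h1
      · exact absurd (hQ v h1) hv
      · exact absurd (h1 ▸ hcA) hv
    have hx' : G.vert x ∉ Q := by
      intro e
      rcases hsep.bar_right _ e with h1 | h1
      · exact hsep.disj _ hx h1
      · exact hsep.notMem_left (h1 ▸ hx)
    have hy' : G.vert y ∉ Q := by
      intro e
      rcases hsep.bar_right _ e with h1 | h1
      · exact hsep.disj _ (hR _ hA.bar_right) h1
      · exact hsep.notMem_left (h1 ▸ hR _ hA.bar_right)
    have hinj : ∀ {u v}, v ∈ Q → (G.ctrMap h u = G.ctrMap h v ↔ u = v) := fun hv =>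
      ctrMap_eq_iff G h (fun e => hx' (e ▸ hv)) fun e => hy' (e ▸ hv)
    obtain ⟨s, hs⟩ := hsep.right
    -- The contraction may identify points of `R` with `c`, so a witness on the `R` side has to stay
    -- different from `c` after contraction.
    by_cases hq : ∃ q, q ∈ R ∧ q ∈ A ∧ G.ctrMap h q ≠ G.ctrMap h c
    · obtain ⟨q, hqR, hqA, hqc⟩ := hq
      refine HG.proj_restrict_of_set k hc (c := G.ctrMap h c) (s := G.ctrMap h s)
        (q := G.ctrMap h q) (T := {u | ∃ v, v ∈ Q ∧ u = G.ctrMap h v})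
        ((hS _).2 hcA) ?_ ((hS _).2 (hQ s hs)) ⟨s, hs, rfl⟩ ((hS _).2 hqA) ?_ hqc ?_
      · rintro ⟨v, h1, h2⟩
        rw [hinj h1] at h2
        exact hsep.notMem_right (h2 ▸ h1)
      · rintro ⟨v, h1, h2⟩
        rw [hinj h1] at h2
        exact hsep.disj _ hqR (h2 ▸ h1)
      · rintro a ha ⟨v, h1, h2⟩
        obtain ⟨b, -, -, -, -, h5, h6, h7, h8⟩ := hA.of_mem h hS ha
        rw [h8]
        rw [h7, hinj h1] at h2
        rcases hsep.bar_right b (h2 ▸ h1) with h3 | h3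
        · exact Or.inl ⟨_, h3, rfl⟩
        · exact Or.inr (by rw [h3])
    · push Not at hq
      have hcx : G.ctrMap h c = G.mergedV h := by
        by_cases e : c = G.vert x
        · rw [e, ctrMap_left]
        · rw [← hq (G.vert x) _ hA.left, ctrMap_left]
          rcases hsep.cover (G.vert x) with h1 | h1 | h1
          · exact h1
          · exact absurd h1 hx'
          · exact absurd h1.symm e
      have hall : ∀ v, v ∈ A → v ∉ Q → G.ctrMap h v = G.mergedV h := by
        intro v hv hv'
        rcases hsep.cover v with h1 | h1 | h1
        · rw [hq v h1 hv, hcx]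
        · exact absurd h1 hv'
        · rw [h1, hcx]
      -- One of the two merged vertices is different from `c`. Every half-edge at it other than `x`
      -- and `y` has both ends collapsed to the merged vertex, so it becomes part of a loop.
      obtain ⟨z, hzA, hzR, b, hb1, hb2, hbz⟩ : ∃ z, z ∈ A ∧ z ∈ R ∧ ∃ b, b ≠ x ∧ b ≠ y ∧
          G.vert b = z := by
        by_cases e : c = G.vert x
        · obtain ⟨b, h1, h2⟩ := G.exists_ne_vert y
          refine ⟨G.vert y, hA.right, ?_, b, ?_, h1, h2⟩
          · rcases hsep.cover (G.vert y) with h1 | h1 | h1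
            · exact h1
            · exact absurd h1 hy'
            · exact absurd (h1.trans e).symm h
          · rintro rfl
            exact h h2
        · obtain ⟨b, h1, h2⟩ := G.exists_ne_vert x
          refine ⟨G.vert x, hA.left, ?_, b, h1, ?_, h2⟩
          · rcases hsep.cover (G.vert x) with h1 | h1 | h1
            · exact h1
            · exact absurd h1 hx'
            · exact absurd h1.symm e
          · rintro rfl
            exact h h2.symm
      rw [← hbz] at hzA hzR
      obtain ⟨h3, h4, h5⟩ := hA.closed_of_mem hb1 hb2 hzA
      obtain ⟨a, h6, h7⟩ := exists_contract_half h hb1 hb2 h3 h4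
      have h8 : G.vert (G.bar b) ∉ Q := by
        rcases hsep.bar_left b hzR with h1 | h1
        · exact hsep.disj _ h1
        · rw [h1]
          exact hsep.notMem_right
      refine HG.proj_restrict_of_loop k hc (a := a) ?_ ?_
      · rw [h6, hS]
        exact hzA
      · rw [h6, h7, hall _ hzA (hsep.disj _ hzR), hall _ h5 h8]

/-- The cut vertex lies on the side of the new edge. If `Q` meets `A`, then `A` consists of a piece
of `R` and a piece of `Q` which are glued at the merged vertex; this is a new cut vertex, or a piece
reduces to one point and carries a loop. If `Q` is disjoint from `A`, then `c` separates `Q` in the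
other part, or the new edge is a loop at `c`. -/
theorem HG.proj_restrict_of_cut_notMem (hG : G.IsConnected) (h : G.vert x ≠ G.vert y)
    (hb : y ≠ G.bar x) (hA : G.SeparatedBy x y A) {S : Set (G.contract x y h).V}
    (hS : ∀ v, G.ctrMap h v ∈ S ↔ v ∈ A) (hc : (G.contract x y h).IsClosed S)
    (hsep : G.Separates c R Q) (hcA : c ∉ A) (hx : G.vert x ∈ R) :
    HG.proj k (graphClass k ((G.contract x y h).restrict S hc)) = 0 ∨
      HG.proj k (graphClass k ((G.contract x y h).restrict Sᶜ hc.compl)) = 0 := by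
  have hx' : G.vert (G.bar x) ∉ Q := by
    rcases hsep.bar_left _ hx with h1 | h1
    · exact hsep.disj _ h1
    · rw [h1]
      exact hsep.notMem_right
  by_cases hQ : ∃ v ∈ Q, v ∈ A
  · left
    obtain ⟨v, hvQ, hvA⟩ := hQ
    -- If `x` and `y` both ended in `R`, the portion of `Q` inside `A` would be a union of
    -- components of `G`.
    have hy : G.vert y ∉ R := by
      intro hy
      have hcl : G.IsClosed {v | v ∈ Q ∧ v ∈ A} := by
        have key : ∀ b, G.vert b ∈ Q ∧ G.vert b ∈ A → G.vert (G.bar b) ∈ Q ∧ G.vert (G.bar b) ∈ A := by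
          rintro b ⟨h1, h2⟩
          obtain ⟨-, -, h3⟩ := hA.closed_of_mem (b := b)
            (by rintro rfl; exact hsep.disj _ hx h1) (by rintro rfl; exact hsep.disj _ hy h1) h2
          refine ⟨(hsep.bar_right b h1).resolve_right fun e => hcA (e ▸ h3), h3⟩
        refine fun b => ⟨fun hb => ?_, key b⟩
        simpa [G.bar_bar] using key _ hb
      have := (OGraph.isConnected_iff.1 hG).2 _ hcl ⟨v, hvQ, hvA⟩
      exact hcA (this.ge (Set.mem_univ c)).2
    have hyQ : G.vert y ∈ Q := by
      rcases hsep.cover (G.vert y) with h1 | h1 | h1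
      · exact absurd h1 hy
      · exact h1
      · exact absurd (h1 ▸ hA.right) hcA
    by_cases hs : ∃ s, s ∈ R ∧ s ∈ A ∧ s ≠ G.vert x
    · by_cases hq : ∃ q, q ∈ Q ∧ q ∈ A ∧ q ≠ G.vert y
      · obtain ⟨s, hsR, hsA, hsx⟩ := hs
        obtain ⟨q, hqQ, hqA, hqy⟩ := hq
        have hne : ∀ v ∈ R, v ≠ G.vert y := fun v hv e => hy (e ▸ hv)
        have hinj : ∀ {u v}, v ∈ R → v ≠ G.vert x → (G.ctrMap h u = G.ctrMap h v ↔ u = v) :=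
          fun hv hv' => ctrMap_eq_iff G h hv' (hne _ hv)
        have hqx : q ≠ G.vert x := fun e => hsep.disj _ hx (e ▸ hqQ)
        refine HG.proj_restrict_of_set k hc (c := G.mergedV h) (s := G.ctrMap h s)
          (q := G.ctrMap h q) (T := {u | ∃ v, v ∈ R ∧ v ∈ A ∧ v ≠ G.vert x ∧ u = G.ctrMap h v})
          ?_ ?_ ((hS _).2 hsA) ⟨s, hsR, hsA, hsx, rfl⟩ ((hS _).2 hqA) ?_ ?_ ?_
        · rw [← ctrMap_left, hS]
          exact hA.left
        · rintro ⟨v, h1, h2, h3, h4⟩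
          rw [← ctrMap_left, hinj h1 h3] at h4
          exact h3 h4.symm
        · rintro ⟨v, h1, h2, h3, h4⟩
          rw [hinj h1 h3] at h4
          exact hsep.disj _ h1 (h4 ▸ hqQ)
        · rw [Ne, ctrMap_eq_merged]
          exact fun e => e.elim hqx hqy
        · rintro a ha ⟨v, h1, h2, h3, h4⟩
          obtain ⟨b, -, -, -, -, h5, h6, h7, h8⟩ := hA.of_mem h hS ha
          rw [h8]
          rw [h7, hinj h1 h3] at h4
          have h9 := (hsep.bar_left b (h4 ▸ h1)).resolve_right fun e => hcA (e ▸ h6)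
          by_cases e : G.vert (G.bar b) = G.vert x
          · exact Or.inr (by rw [e, ctrMap_left])
          · exact Or.inl ⟨_, h9, h6, e, rfl⟩
      -- The piece of `Q` in `A` is the single vertex `G.vert y`; a further half-edge there can only
      -- belong to a loop.
      · push Not at hq
        obtain ⟨b, h1, h2⟩ := G.exists_ne_vert y
        have hbx : b ≠ x := by
          rintro rfl
          exact h h2
        obtain ⟨h3, h4, h5⟩ := hA.closed_of_mem hbx h1 (h2 ▸ hA.right)
        obtain ⟨a, h6, h7⟩ := exists_contract_half h hbx h1 h3 h4
        have h8 := (hsep.bar_right b (h2 ▸ hyQ)).resolve_right fun e => hcA (e ▸ h5)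
        refine HG.proj_restrict_of_loop k hc (a := a) ?_ ?_
        · rw [h6, hS, h2]
          exact hA.right
        · rw [h6, h7, hq _ h8 h5, h2]
    · push Not at hs
      obtain ⟨b, h1, h2⟩ := G.exists_ne_vert x
      have hbx : b ≠ y := by
        rintro rfl
        exact h h2.symm
      obtain ⟨h3, h4, h5⟩ := hA.closed_of_mem h1 hbx (h2 ▸ hA.left)
      obtain ⟨a, h6, h7⟩ := exists_contract_half h h1 hbx h3 h4
      have h8 := (hsep.bar_left b (h2 ▸ hx)).resolve_right fun e => hcA (e ▸ h5)
      refine HG.proj_restrict_of_loop k hc (a := a) ?_ ?_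
      · rw [h6, hS, h2]
        exact hA.left
      · rw [h6, h7, hs _ h8 h5, h2]
  · right
    push Not at hQ
    have hyR : G.vert y ∈ R := by
      rcases hsep.cover (G.vert y) with h1 | h1 | h1
      · exact h1
      · exact absurd hA.right (hQ _ h1)
      · exact absurd (h1 ▸ hA.right) hcA
    have hy' : G.vert (G.bar y) ∉ Q := by
      rcases hsep.bar_left _ hyR with h1 | h1
      · exact hsep.disj _ h1
      · rw [h1]
        exact hsep.notMem_right
    by_cases hq : ∃ q, q ∈ R ∧ q ∉ A
    · obtain ⟨q, hqR, hqA⟩ := hq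
      obtain ⟨s, hs⟩ := hsep.right
      refine HG.proj_restrict_of_set k hc.compl (c := G.ctrMap h c) (s := G.ctrMap h s)
        (q := G.ctrMap h q) (T := {u | ∃ v, v ∈ Q ∧ u = G.ctrMap h v})
        (fun e => hcA ((hS _).1 e)) ?_ (fun e => hQ s hs ((hS _).1 e)) ⟨s, hs, rfl⟩
        (fun e => hqA ((hS _).1 e)) ?_ ?_ ?_
      · rintro ⟨v, h1, h2⟩
        rw [hA.ctrMap_eq_iff h (hQ v h1)] at h2
        exact hsep.notMem_right (h2 ▸ h1)
      · rintro ⟨v, h1, h2⟩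
        rw [hA.ctrMap_eq_iff h (hQ v h1)] at h2
        exact hsep.disj _ hqR (h2 ▸ h1)
      · rw [Ne, hA.ctrMap_eq_iff h hcA]
        exact fun e => hsep.notMem_left (e ▸ hqR)
      · rintro a ha ⟨v, h1, h2⟩
        have ha1 : a ≠ G.newH h hb := by
          rintro rfl
          rw [contract_vert, ctrH_newH, hA.ctrMap_eq_iff h (hQ v h1)] at h2
          exact hx' (h2 ▸ h1)
        have ha2 : a ≠ (G.contract x y h).bar (G.newH h hb) := by
          rintro rfl
          rw [contract_vert_bar, ctrH_newH, if_pos rfl, hA.ctrMap_eq_iff h (hQ v h1)] at h2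
          exact hy' (h2 ▸ h1)
        obtain ⟨b, -, -, -, -, h5, h6, h7, h8⟩ := hA.of_notMem h hb hS ha ha1 ha2
        rw [h8]
        rw [h7, hA.ctrMap_eq_iff h (hQ v h1)] at h2
        rcases hsep.bar_right b (h2 ▸ h1) with h3 | h3
        · exact Or.inl ⟨_, h3, rfl⟩
        · exact Or.inr (by rw [h3])
    · push Not at hq
      -- Neither end of the new edge lies in `Q` or in `A`, so both ends are `c`.
      have hc' : ∀ v, v ∉ A → v ∉ Q → v = c := by
        intro v h1 h2
        rcases hsep.cover v with h3 | h3 | h3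
        · exact absurd (hq v h3) h1
        · exact absurd h3 h2
        · exact h3
      refine HG.proj_restrict_of_loop k hc.compl (a := G.newH h hb) ?_ ?_
      · rw [contract_vert, ctrH_newH]
        exact fun e => hA.bar_left ((hS _).1 e)
      · rw [contract_vert_bar, contract_vert, ctrH_newH, if_pos rfl, hc' _ hA.bar_left hx',
          hc' _ hA.bar_right hy']

end CutVertex

namespace OGraph

variable {G : OGraph} {x y : G.H}

theorem mem_vert_newH (h : G.vert x ≠ G.vert y) (hb : y ≠ G.bar x) :
    (G.contract x y h).vert (G.newH h hb) = G.ctrMap h (G.vert (G.bar x)) := by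
  rw [contract_vert, ctrH_newH]

/-- Closed sets which do not separate the merged vertex from the new edge come from closed sets of
the graph before the contraction. -/
theorem IsClosed.preimage_ctrMap {h : G.vert x ≠ G.vert y} (hb : y ≠ G.bar x)
    {S : Set (G.contract x y h).V} (hS : (G.contract x y h).IsClosed S)
    (hm : G.mergedV h ∈ S ↔ (G.contract x y h).vert (G.newH h hb) ∈ S) :
    G.IsClosed {v | G.ctrMap h v ∈ S} := by
  rw [contract_isClosed_iff G h hb (S := S) (S' := {v | G.ctrMap h v ∈ S}) fun v => Iff.rfl] at hS
  obtain ⟨h1, h2⟩ := hS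
  simp only [Set.mem_ofPred_eq] at h1 h2
  rw [mem_vert_newH] at hm
  have e1 := ctrMap_left G h
  have e2 := ctrMap_right G h
  intro b
  simp only [Set.mem_ofPred_eq]
  by_cases b1 : b = x
  · rw [b1, e1, hm]
  by_cases b2 : b = y
  · rw [b2, e2, hm, h2]
  by_cases b3 : b = G.bar x
  · rw [b3, G.bar_bar, e1, hm]
  by_cases b4 : b = G.bar y
  · rw [b4, G.bar_bar, e2, hm, h2]
  exact h1 b b1 b2 b3 b4

/-- If every component of a graph contains `vert x` or `vert y`, then every component of its
contraction contains the merged vertex or an end of the new edge. -/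
theorem IsClosed.eq_empty_of_contract (hG : ∀ S, G.IsClosed S → G.vert x ∉ S → G.vert y ∉ S → S = ∅)
    {h : G.vert x ≠ G.vert y} (hb : y ≠ G.bar x) {S : Set (G.contract x y h).V}
    (hS : (G.contract x y h).IsClosed S) (hm : G.mergedV h ∉ S)
    (hu : (G.contract x y h).vert (G.newH h hb) ∉ S) : S = ∅ := by
  have h1 := hG _ (hS.preimage_ctrMap hb (iff_of_false hm hu))
    (by rwa [Set.mem_ofPred_eq, ctrMap_left]) (by rwa [Set.mem_ofPred_eq, ctrMap_right])
  refine Set.eq_empty_of_forall_notMem fun s hs => ?_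
  obtain ⟨v, rfl⟩ := G.ctrMap_surjective h s
  exact h1.le hs

theorem IsConnected.eq_empty_of_notMem (hG : G.IsConnected) {S : Set G.V} (hS : G.IsClosed S)
    {m : G.V} (hm : m ∉ S) : S = ∅ := by
  by_contra hne
  exact hm (((isConnected_iff.1 hG).2 _ hS (Set.nonempty_iff_ne_empty.2 hne)).ge (Set.mem_univ m))

theorem eq_empty_of_isClosed_contract (hG : G.IsConnected) {h : G.vert x ≠ G.vert y}
    (hb : y ≠ G.bar x) {S : Set (G.contract x y h).V} (hS : (G.contract x y h).IsClosed S)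
    (hm : G.mergedV h ∉ S) (hu : (G.contract x y h).vert (G.newH h hb) ∉ S) : S = ∅ :=
  hS.eq_empty_of_contract (fun _ hT hx _ => hG.eq_empty_of_notMem hT hx) hb hm hu

/-- If every component of a graph contains one of two vertices, then a union of components that
contains exactly one of the two is connected. -/
theorem restrict_isConnected {m u : G.V}
    (hG : ∀ S, G.IsClosed S → m ∉ S → u ∉ S → S = ∅) {S : Set G.V} (hS : G.IsClosed S)
    (hx : Xor (m ∈ S) (u ∈ S)) : (G.restrict S hS).IsConnected := by
  rw [isConnected_iff]
  constructor
  · rcases hx with hx | hx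
    · exact ⟨toResV _ hS _ hx.1⟩
    · exact ⟨toResV _ hS _ hx.1⟩
  · intro T hT hne
    have h1 : G.IsClosed (resV _ hS '' T) := by
      intro a
      by_cases ha : G.vert a ∈ S
      · have e : ∀ b (hb : G.vert b ∈ S), G.vert b ∈
            resV _ hS '' T ↔ (restrict _ S hS).vert (toResH _ hS b hb) ∈ T := by
          intro b hb
          constructor
          · rintro ⟨t, ht, e⟩
            have : t = (restrict _ S hS).vert (toResH _ hS b hb) := resV_injective _ hS e
            rwa [← this]
          · exact fun ht => ⟨_, ht, rfl⟩
        rw [e _ ha, e _ ((hS a).2 ha)]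
        exact hT (toResH _ hS a ha)
      · refine iff_of_false ?_ ?_
        · rintro ⟨t, -, e⟩
          exact ha ((hS a).1 (e ▸ resV_mem _ hS t))
        · rintro ⟨t, -, e⟩
          exact ha (e ▸ resV_mem _ hS t)
    have h2 : G.IsClosed (S \ resV _ hS '' T) := fun a => and_congr (hS a) (not_congr (h1 a))
    have h3 : resV _ hS '' T ⊆ S := by
      rintro _ ⟨t, -, rfl⟩
      exact resV_mem _ hS t
    -- If `T` were proper, both `T` and the rest of `S` would have to contain `m` or `u`, but `S`
    -- contains only one of these.
    have h4 : S \ resV _ hS '' T = ∅ := by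
      by_contra h4
      have h5 : resV _ hS '' T ≠ ∅ := (hne.image _).ne_empty
      have key : ∀ U, G.IsClosed U → U ≠ ∅ → U ⊆ S → (m ∈ U ∧ m ∈ S ∨ u ∈ U ∧ u ∈ S) := by
        intro U hU hne hUS
        by_contra hn
        rw [not_or] at hn
        exact hne (hG _ hU (fun e => hn.1 ⟨e, hUS e⟩) fun e => hn.2 ⟨e, hUS e⟩)
      have k1 := key _ h1 h5 h3
      have k2 := key _ h2 h4 Set.sdiff_subset
      rcases hx with hx | hx
      · rcases k1 with k1 | k1
        · rcases k2 with k2 | k2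
          · exact k2.1.2 k1.1
          · exact hx.2 k2.2
        · exact hx.2 k1.2
      · rcases k1 with k1 | k1
        · exact hx.2 k1.2
        · rcases k2 with k2 | k2
          · exact hx.2 k2.2
          · exact k2.1.2 k1.1
    refine Set.eq_univ_of_forall fun t => ?_
    have : resV _ hS t ∈ resV _ hS '' T := by
      by_contra hn
      exact (h4.le ⟨resV_mem _ hS t, hn⟩ : _)
    obtain ⟨t', ht', e⟩ := this
    rwa [← resV_injective _ hS e]

theorem restrict_isConnected_of_xor (hG : G.IsConnected) {h : G.vert x ≠ G.vert y}
    (hb : y ≠ G.bar x) {S : Set (G.contract x y h).V} (hS : (G.contract x y h).IsClosed S)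
    (hx : Xor (G.mergedV h ∈ S) ((G.contract x y h).vert (G.newH h hb) ∈ S)) :
    ((G.contract x y h).restrict S hS).IsConnected :=
  restrict_isConnected (fun _ hS => eq_empty_of_isClosed_contract hG hb hS) hS hx

theorem xor_compl {V : Type*} {S : Set V} {m u : V} (h : Xor (m ∈ S) (u ∈ S)) :
    Xor (m ∈ Sᶜ) (u ∈ Sᶜ) := by
  rcases h with h | h
  · exact Or.inr ⟨h.2, not_not_intro h.1⟩
  · exact Or.inl ⟨h.2, not_not_intro h.1⟩

end OGraph

section QuotientCobracket

open OGraph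

universe u

variable (k : Type u) [Field k] {G : OGraph}

/-- The projection of a tensor. -/
noncomputable def HG.proj₂ : HG k ⊗[k] HG k →ₗ[k] GModC k ⊗[k] GModC k :=
  TensorProduct.map (HG.proj k) (HG.proj k)

theorem graphClass_restrict_congr {S T : Set G.V} (h : S = T) (hS : G.IsClosed S)
    (hT : G.IsClosed T) : graphClass k (G.restrict S hS) = graphClass k (G.restrict T hT) := by
  subst h
  rfl

theorem HG.proj_restrict_empty (hS : G.IsClosed ∅) :
    HG.proj k (graphClass k (G.restrict ∅ hS)) = 0 := by
  refine HG.proj_of_not_isConnected k fun h => ?_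
  obtain ⟨v⟩ := h.nonempty
  exact resV_mem _ hS v

theorem HG.proj₂_splitting_eq_zero {S : Set G.V} (h : ∀ hS : G.IsClosed S,
    HG.proj k (graphClass k (G.restrict S hS)) = 0 ∨
      HG.proj k (graphClass k (G.restrict Sᶜ hS.compl)) = 0) :
    HG.proj₂ k (splitting k G S) = 0 := by
  by_cases hS : G.IsClosed S
  · rw [splitting_of_isClosed k hS, HG.proj₂, LinearMap.map_smul_of_tower, TensorProduct.map_tmul]
    rcases h hS with h | h
    · rw [h, TensorProduct.zero_tmul, smul_zero]
    · rw [h, TensorProduct.tmul_zero, smul_zero]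
  · rw [splitting_of_not_isClosed k hS, map_zero]

theorem HG.proj₂_splitting_empty : HG.proj₂ k (splitting k G ∅) = 0 :=
  HG.proj₂_splitting_eq_zero k fun hS => Or.inl (HG.proj_restrict_empty k hS)

theorem HG.proj₂_splitting_of_compl {S : Set G.V} (h : Sᶜ = ∅) :
    HG.proj₂ k (splitting k G S) = 0 :=
  HG.proj₂_splitting_eq_zero k fun hS => Or.inr (by
    rw [graphClass_restrict_congr k h hS.compl isClosed_empty, HG.proj_restrict_empty])

/-- A closed set that separates the merged vertex from the new edge exhibits a second component. For
connected graphs the condition of being separating may thus be dropped from the cobracket. -/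
theorem separation_of_not_isSeparating (hG : G.IsConnected) {x y : G.H}
    (h : ¬ G.IsSeparating x y) : separation k G x y = 0 := by
  by_cases hv : G.vert x = G.vert y
  · exact separation_of_vert_eq k hv
  by_cases hb : y = G.bar x
  · exact separation_of_eq_bar k hb
  rw [separation_of_ne k hv hb, sepCop, Finset.sum_eq_zero, smul_zero]
  intro S _
  split_ifs with hx
  · refine splitting_of_not_isClosed k fun hS => h ⟨hv, ?_⟩
    rw [numComponents_eq_one hG]
    rcases hx with hx | hx
    · exact one_lt_numComponents hS hx.1 hx.2
    · exact one_lt_numComponents hS hx.1 hx.2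
  · rfl

theorem graphCobracket_of_isConnected (hG : G.IsConnected) :
    graphCobracket k G = (2 : k)⁻¹ • ∑ x, ∑ y, separation k G x y := by
  rw [graphCobracket]
  congr 1
  refine Finset.sum_congr rfl fun x _ => Finset.sum_congr rfl fun y _ => ?_
  split_ifs with h
  · rfl
  · rw [separation_of_not_isSeparating k hG h]

theorem map_separation_eq {M : Type*} [AddCommGroup M] [Module k M]
    {φ ψ : HG k ⊗[k] HG k →ₗ[k] M} (x y : G.H)
    (h : ∀ (h : G.vert x ≠ G.vert y) (hb : y ≠ G.bar x) (S : Set (G.contract x y h).V)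
      (_ : (G.contract x y h).IsClosed S)
      (_ : Xor (G.mergedV h ∈ S) ((G.contract x y h).vert (G.newH h hb) ∈ S)),
      φ (splitting k (G.contract x y h) S) = ψ (splitting k (G.contract x y h) S)) :
    φ (separation k G x y) = ψ (separation k G x y) := by
  by_cases hv : G.vert x = G.vert y
  · rw [separation_of_vert_eq k hv, map_zero, map_zero]
  by_cases hb : y = G.bar x
  · rw [separation_of_eq_bar k hb, map_zero, map_zero]
  rw [separation_of_ne k hv hb, LinearMap.map_smul_of_tower, LinearMap.map_smul_of_tower, sepCop,
    map_sum, map_sum]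
  congr 1
  refine Finset.sum_congr rfl fun S _ => ?_
  split_ifs with hx
  · by_cases hS : (G.contract x y hv).IsClosed S
    · exact h hv hb S hS hx
    · rw [splitting_of_not_isClosed k hS, map_zero, map_zero]
  · rw [map_zero, map_zero]

/-- The sum of all contractions of a graph. -/
noncomputable def HG.contractions : HG k →ₗ[k] HG k :=
  HG.lift (fun G => ∑ x, ∑ y, contr k G x y) fun G G' f => by
    rw [Finset.smul_sum, ← f.onH.sum_comp]
    refine Finset.sum_congr rfl fun x _ => ?_
    rw [Finset.smul_sum, ← f.onH.sum_comp]
    exact Finset.sum_congr rfl fun y _ => contr_iso f x y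

theorem HG.contractions_graphClass (G : OGraph) :
    HG.contractions k (graphClass k G) = ∑ x, ∑ y, contr k G x y := HG.lift_graphClass _ _ _

/-- The projection of the coproduct. -/
noncomputable def HG.projCoproduct : HG k →ₗ[k] GModC k ⊗[k] GModC k :=
  HG.proj₂ k ∘ₗ HG.coproduct k

theorem HG.projCoproduct_graphClass (G : OGraph) :
    HG.projCoproduct k (graphClass k G) = ∑ S, HG.proj₂ k (splitting k G S) := by
  rw [HG.projCoproduct, LinearMap.comp_apply, HG.coproduct_graphClass, cop, map_sum]

/-- Every component of the contraction contains the merged vertex or the new edge. A closed set that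
does not separate them is empty or everything, and such splittings are killed by the projection. -/
theorem HG.proj₂_separation (hG : G.IsConnected) (x y : G.H) :
    HG.proj₂ k (separation k G x y) = HG.projCoproduct k (contr k G x y) := by
  by_cases hv : G.vert x = G.vert y
  · rw [separation_of_vert_eq k hv, contr_of_vert_eq hv, map_zero, map_zero]
  by_cases hb : y = G.bar x
  · rw [separation_of_eq_bar k hb, contr_of_eq_bar hb, map_zero, map_zero]
  rw [separation_of_ne k hv hb, contr_of_ne hv hb, LinearMap.map_smul_of_tower,
    LinearMap.map_smul_of_tower, HG.projCoproduct_graphClass, sepCop, map_sum]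
  congr 1
  refine Finset.sum_congr rfl fun S _ => ?_
  split_ifs with hx
  · rfl
  · rw [map_zero]
    by_cases hS : (G.contract x y hv).IsClosed S
    · by_cases hm : G.mergedV hv ∈ S
      · have hu : (G.contract x y hv).vert (G.newH hv hb) ∈ S := by
          by_contra hu
          exact hx (Or.inl ⟨hm, hu⟩)
        rw [HG.proj₂_splitting_of_compl k]
        exact eq_empty_of_isClosed_contract hG hb hS.compl (not_not_intro hm) (not_not_intro hu)
      · have hu : (G.contract x y hv).vert (G.newH hv hb) ∉ S := fun hu => hx (Or.inr ⟨hu, hm⟩)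
        rw [eq_empty_of_isClosed_contract hG hb hS hm hu, HG.proj₂_splitting_empty]
    · rw [splitting_of_not_isClosed k hS, map_zero]

/-- This factorization through `HG.contractions` and the coproduct is the form in which the axioms
of the cobracket are proved. -/
theorem HG.proj₂_cobracket (hG : G.IsConnected) : HG.proj₂ k (graphCobracket k G) =
    (2 : k)⁻¹ • HG.projCoproduct k (HG.contractions k (graphClass k G)) := by
  rw [graphCobracket_of_isConnected k hG, map_smul, HG.contractions_graphClass]
  simp only [map_sum, HG.proj₂_separation k hG]

theorem separatedBy_of_isClosed {x y : G.H} {h : G.vert x ≠ G.vert y} (hb : y ≠ G.bar x)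
    {S : Set (G.contract x y h).V} (hS : (G.contract x y h).IsClosed S) (hm : G.mergedV h ∈ S)
    (hu : (G.contract x y h).vert (G.newH h hb) ∉ S) :
    G.SeparatedBy x y {v | G.ctrMap h v ∈ S} := by
  rw [contract_isClosed_iff G h hb (S := S) (S' := {v | G.ctrMap h v ∈ S}) fun v => Iff.rfl] at hS
  rw [mem_vert_newH] at hu
  refine ⟨?_, ?_, hu, fun e => hu (hS.2.1 e), hS.1⟩
  · rw [Set.mem_ofPred_eq, ctrMap_left]
    exact hm
  · rw [Set.mem_ofPred_eq, ctrMap_right]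
    exact hm

theorem HG.proj_restrict_of_isCutVertex [CharZero k] (hG : G.IsConnected) (hc : G.HasCutVertex)
    {x y : G.H} {h : G.vert x ≠ G.vert y} (hb : y ≠ G.bar x)
    {S : Set (G.contract x y h).V} (hS : (G.contract x y h).IsClosed S) (hm : G.mergedV h ∈ S)
    (hu : (G.contract x y h).vert (G.newH h hb) ∉ S) :
    HG.proj k (graphClass k ((G.contract x y h).restrict S hS)) = 0 ∨
      HG.proj k (graphClass k ((G.contract x y h).restrict Sᶜ hS.compl)) = 0 := by
  obtain ⟨c, hc⟩ := hc
  obtain ⟨R, Q, hsep⟩ := hc.exists_separates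
  have hA := separatedBy_of_isClosed hb hS hm hu
  by_cases hcA : c ∈ {v | G.ctrMap h v ∈ S}
  · rcases hsep.cover (G.vert (G.bar x)) with h1 | h1 | h1
    · exact HG.proj_restrict_of_cut_mem k hG h hb hA (fun v => Iff.rfl) hS hsep hcA h1
    · exact HG.proj_restrict_of_cut_mem k hG h hb hA (fun v => Iff.rfl) hS hsep.symm hcA h1
    · exact absurd (h1 ▸ hcA) hA.bar_left
  · rcases hsep.cover (G.vert x) with h1 | h1 | h1
    · exact HG.proj_restrict_of_cut_notMem k hG h hb hA (fun v => Iff.rfl) hS hsep hcA h1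
    · exact HG.proj_restrict_of_cut_notMem k hG h hb hA (fun v => Iff.rfl) hS hsep.symm hcA h1
    · exact absurd (h1 ▸ hA.left) hcA

theorem HG.proj₂_cobracket_of_hasCutVertex [CharZero k] (hG : G.IsConnected)
    (hc : G.HasCutVertex) : HG.proj₂ k (graphCobracket k G) = 0 := by
  rw [graphCobracket_of_isConnected k hG, map_smul, map_sum, Finset.sum_eq_zero, smul_zero]
  intro x _
  rw [map_sum]
  refine Finset.sum_eq_zero fun y _ => ?_
  refine map_separation_eq k (ψ := 0) x y fun h hb S hS hx => ?_
  rw [LinearMap.zero_apply]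
  refine HG.proj₂_splitting_eq_zero k fun _ => ?_
  rcases hx with hx | hx
  · exact HG.proj_restrict_of_isCutVertex k hG hc hb hS hx.1 hx.2
  -- Here the merged vertex lies outside `S`; the complement takes its place and the two
  -- alternatives are exchanged.
  · have := HG.proj_restrict_of_isCutVertex k hG hc hb hS.compl hx.2 (not_not_intro hx.1)
    rw [graphClass_restrict_congr k (compl_compl S) _ hS] at this
    exact this.symm

/-- The cobracket of the quotient. -/
noncomputable def GModC.cobracket : GModC k →ₗ[k] GModC k ⊗[k] GModC k :=
  HG.proj₂ k ∘ₗ HG.cobracket k ∘ₗ GModC.lift k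

variable [CharZero k]

theorem GModC.cobracket_toGModC (X : connectedPart k) :
    GModC.cobracket k (toGModC k X) = HG.proj₂ k (HG.cobracket k X) := by
  have h : connectedCutPart k ≤ LinearMap.ker (HG.proj₂ k ∘ₗ HG.cobracket k) := by
    refine Submodule.span_le.2 ?_
    rintro _ ⟨G, hG, hc, rfl⟩
    rw [SetLike.mem_coe, LinearMap.mem_ker, LinearMap.comp_apply, HG.cobracket_graphClass,
      HG.proj₂_cobracket_of_hasCutVertex k hG hc]
  have h1 := h (GModC.lift_sub_mem k X)
  rw [LinearMap.mem_ker, map_sub, sub_eq_zero] at h1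
  exact h1

theorem GModC.cobracket_proj_graphClass (hG : G.IsConnected) :
    GModC.cobracket k (HG.proj k (graphClass k G)) = HG.proj₂ k (graphCobracket k G) := by
  rw [HG.proj_graphClass k hG, GModC.cobracket_toGModC, HG.cobracket_graphClass]

theorem GModC.cobracket_proj (hG : G.IsConnected) :
    GModC.cobracket k (HG.proj k (graphClass k G)) =
      (2 : k)⁻¹ • HG.projCoproduct k (HG.contractions k (graphClass k G)) := by
  rw [GModC.cobracket_proj_graphClass k hG, HG.proj₂_cobracket k hG]

/-- For connected `G` both parts of a separating splitting are connected, so the projection loses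
nothing beyond the cut part. -/
theorem map_inclGModC_cobracket (X : connectedPart k) :
    TensorProduct.map (inclGModC k) (inclGModC k) (GModC.cobracket k (toGModC k X)) =
      TensorProduct.map (cutPart k).mkQ (cutPart k).mkQ (HG.cobracket k X) := by
  rw [GModC.cobracket_toGModC]
  suffices h : connectedPart k ≤ LinearMap.ker
      ((TensorProduct.map (inclGModC k) (inclGModC k) ∘ₗ HG.proj₂ k ∘ₗ HG.cobracket k) -
        TensorProduct.map (cutPart k).mkQ (cutPart k).mkQ ∘ₗ HG.cobracket k) from
    sub_eq_zero.1 (h X.2)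
  refine Submodule.span_le.2 ?_
  rintro _ ⟨G, hG, rfl⟩
  rw [SetLike.mem_coe, LinearMap.mem_ker, LinearMap.sub_apply, sub_eq_zero, LinearMap.comp_apply,
    LinearMap.comp_apply, LinearMap.comp_apply, HG.cobracket_graphClass,
    graphCobracket_of_isConnected k hG]
  simp only [map_smul, map_sum]
  congr 1
  refine Finset.sum_congr rfl fun x _ => Finset.sum_congr rfl fun y _ => ?_
  refine map_separation_eq k (φ := TensorProduct.map (inclGModC k) (inclGModC k) ∘ₗ HG.proj₂ k)
    x y fun h hb S hS hx => ?_
  rw [splitting_of_isClosed k hS, LinearMap.map_smul_of_tower, LinearMap.map_smul_of_tower,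
    LinearMap.comp_apply, HG.proj₂, TensorProduct.map_tmul, TensorProduct.map_tmul,
    TensorProduct.map_tmul, inclGModC_proj k (restrict_isConnected_of_xor hG hb hS hx),
    inclGModC_proj k (restrict_isConnected_of_xor hG hb hS.compl (xor_compl hx))]

end QuotientCobracket

/-! ### Degrees, the bracket axioms and symmetry of the cobracket -/

namespace OGraph

theorem degree_contract (G : OGraph) {x y : G.H} (h : G.vert x ≠ G.vert y) :
    ((G.contract x y h).degree : ℤ) = G.degree - 1 := by
  have h1 : (G.contract x y h).degree = Fintype.card {u : G.V // ¬ u = G.vert y} :=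
    Fintype.card_congr (Equiv.refl _)
  have h2 : 0 < G.degree := Fintype.card_pos_iff.2 ⟨G.vert x⟩
  rw [h1, Fintype.card_subtype_compl, Fintype.card_subtype_eq, degree]
  rw [degree] at h2
  omega

theorem degree_disjUnion (G K : OGraph) : (G.disjUnion K).degree = G.degree + K.degree :=
  Fintype.card_sum

theorem degree_restrict (G : OGraph) {S : Set G.V} (hS : G.IsClosed S) :
    (G.restrict S hS).degree + (G.restrict Sᶜ hS.compl).degree = G.degree := by
  rw [degree, degree, ← Fintype.card_sum]
  exact Fintype.card_congr (Equiv.ofBijective _ (bijective_resV hS))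

theorem shuffleSign_compl (G : OGraph) {S : Set G.V} (hS : G.IsClosed S) :
    G.shuffleSign Sᶜ = (-1) ^ ((G.restrict S hS).degree * (G.restrict Sᶜ hS.compl).degree) *
      G.shuffleSign S := by
  have h := G.shuffleSign_eq (S := Sᶜ) (G.resV_injective hS.compl) (G.resV_injective hS)
    (G.exists_resV _) (fun v => by rw [exists_resV, Set.mem_compl_iff, not_not])
  rw [h, shuffleSign_eq_res hS, Finset.prod_comm]
  have h2 : ∀ a b, ordSign (G.resV hS.compl b) (G.resV hS a) =
      -1 * ordSign (G.resV hS a) (G.resV hS.compl b) := by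
    intro a b
    rw [ordSign_swap, neg_one_mul]
    intro e
    exact G.resV_mem hS.compl b (e ▸ G.resV_mem hS a)
  simp only [h2, Finset.prod_mul_distrib, Finset.prod_const, Finset.card_univ, ← pow_mul]
  rw [mul_comm (G.restrict S hS).degree]
  rfl

end OGraph

section Axioms

open OGraph

universe u

variable (k : Type u) [Field k]

theorem negOnePow_natCast (n : ℕ) : (n : ℤ).negOnePow = (-1) ^ n := by
  rw [Int.negOnePow_def, zpow_natCast]

theorem HG.proj_contr_mem (G : OGraph) (x y : G.H) :
    HG.proj k (contr k G x y) ∈ gradeGModC k (G.degree - 1) := by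
  by_cases hv : G.vert x = G.vert y
  · rw [contr_of_vert_eq hv, map_zero]
    exact zero_mem _
  by_cases hb : y = G.bar x
  · rw [contr_of_eq_bar hb, map_zero]
    exact zero_mem _
  rw [contr_of_ne hv hb, LinearMap.map_smul_of_tower]
  refine units_smul_mem _ ?_
  rw [← G.degree_contract hv]
  exact HG.proj_mem_gradeGModC k _

theorem HG.proj_graphBracket_mem (X Y : OGraph) :
    HG.proj k (graphBracket k X Y) ∈ gradeGModC k (X.degree + Y.degree - 1) := by
  rw [graphBracket_eq]
  simp only [map_sum]
  refine sum_mem fun x _ => sum_mem fun y _ => ?_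
  have := HG.proj_contr_mem k (X.disjUnion Y) (inlH X Y x) (inrH X Y y)
  rwa [degree_disjUnion, Nat.cast_add] at this

theorem graphBracket_mem_connectedPart {X Y : OGraph} (hX : X.IsConnected) (hY : Y.IsConnected)
    (hX' : X.NoBridge) (hY' : Y.NoBridge) : graphBracket k X Y ∈ connectedPart k := by
  rw [graphBracket_eq]
  refine sum_mem fun x _ => sum_mem fun y _ => ?_
  have h : (X.disjUnion Y).vert (inlH X Y x) ≠ (X.disjUnion Y).vert (inrH X Y y) := by simp
  rw [contr_of_ne h (by simp)]
  exact units_smul_mem _ (graphClass_mem_connectedPart k (contract_isConnected hX hY hX' hY' x y h))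

/-- The tensors of total degree `n`. -/
noncomputable def tensorGrade (n : ℤ) : Submodule k (GModC k ⊗[k] GModC k) :=
  ⨆ a : ℤ, LinearMap.range
    (TensorProduct.map (gradeGModC k a).subtype (gradeGModC k (n - a)).subtype)

theorem tmul_mem_tensorGrade {a b n : ℤ} (h : a + b = n) {A B : GModC k} (hA : A ∈ gradeGModC k a)
    (hB : B ∈ gradeGModC k b) : A ⊗ₜ[k] B ∈ tensorGrade k n := by
  obtain rfl : b = n - a := by omega
  exact Submodule.mem_iSup_of_mem a ⟨⟨A, hA⟩ ⊗ₜ ⟨B, hB⟩, rfl⟩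

theorem HG.proj₂_splitting_mem (G : OGraph) (S : Set G.V) :
    HG.proj₂ k (splitting k G S) ∈ tensorGrade k G.degree := by
  by_cases hS : G.IsClosed S
  · rw [splitting_of_isClosed k hS, HG.proj₂, LinearMap.map_smul_of_tower, TensorProduct.map_tmul]
    refine units_smul_mem _ (tmul_mem_tensorGrade k ?_ (HG.proj_mem_gradeGModC k _)
      (HG.proj_mem_gradeGModC k _))
    rw [← G.degree_restrict hS, Nat.cast_add]
  · rw [splitting_of_not_isClosed k hS, map_zero]
    exact zero_mem _

/-- Passing from `S` to its complement exchanges the factors, and the two shuffle signs differ by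
the Koszul sign. -/
theorem koszulSwap_projCoproduct (X : HG k) :
    koszulSwap (isInternal_gradeGModC k) (HG.projCoproduct k X) = HG.projCoproduct k X := by
  suffices h : koszulSwap (isInternal_gradeGModC k) ∘ₗ HG.projCoproduct k = HG.projCoproduct k from
    LinearMap.congr_fun h X
  refine HG.hom_ext fun G => ?_
  rw [LinearMap.comp_apply, HG.projCoproduct_graphClass, map_sum]
  refine Fintype.sum_equiv (Equiv.ofBijective _ compl_bijective) _ _ fun S => ?_
  by_cases hS : G.IsClosed S
  · have h1 := koszulSwap_tmul (isInternal_gradeGModC k)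
      (HG.proj_mem_gradeGModC k (G.restrict S hS)) (HG.proj_mem_gradeGModC k (G.restrict Sᶜ hS.compl))
    rw [Equiv.ofBijective_apply, splitting_of_isClosed k hS, splitting_of_isClosed k hS.compl,
      graphClass_restrict_congr k (compl_compl S) _ hS, LinearMap.map_smul_of_tower,
      LinearMap.map_smul_of_tower, LinearMap.map_smul_of_tower, HG.proj₂, TensorProduct.map_tmul,
      TensorProduct.map_tmul, h1, shuffleSign_compl _ hS, smul_smul, mul_comm, ← Nat.cast_mul,
      negOnePow_natCast]
  · have hS' : ¬ G.IsClosed Sᶜ := fun h => hS (by simpa using h.compl)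
    rw [Equiv.ofBijective_apply, splitting_of_not_isClosed k hS, splitting_of_not_isClosed k hS',
      map_zero, map_zero]

theorem GModC.bracket_graphClass {X Y : OGraph} (hX : X.IsConnected) (hY : Y.IsConnected) :
    GModC.bracket k (HG.proj k (graphClass k X)) (HG.proj k (graphClass k Y)) =
      HG.proj k (graphBracket k X Y) := by
  rw [GModC.bracket_proj k (graphClass_mem_connectedPart k hX) (graphClass_mem_connectedPart k hY),
    HG.bracket_graphClass]

/-- The absence of bridges puts the inner bracket into `connectedPart`, so that it may serve as a
representative for the outer one. -/
theorem GModC.bracket_bracket {X Y Z : OGraph} (hX : X.IsConnected) (hY : Y.IsConnected)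
    (hZ : Z.IsConnected) (hX' : X.NoBridge) (hY' : Y.NoBridge) :
    GModC.bracket k (GModC.bracket k (HG.proj k (graphClass k X)) (HG.proj k (graphClass k Y)))
      (HG.proj k (graphClass k Z)) =
    HG.proj k (HG.bracket k (HG.bracket k (graphClass k X) (graphClass k Y)) (graphClass k Z)) := by
  rw [GModC.bracket_graphClass k hX hY, GModC.bracket_proj k
    (graphBracket_mem_connectedPart k hX hY hX' hY') (graphClass_mem_connectedPart k hZ),
    HG.bracket_graphClass X Y]

variable [CharZero k]

theorem GModC.ext_grade {M : Type*} [AddCommGroup M] [Module k M] {n : ℤ} {φ ψ : GModC k →ₗ[k] M}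
    (h : ∀ G : OGraph, G.IsConnected → G.NoBridge → (G.degree : ℤ) = n →
      φ (HG.proj k (graphClass k G)) = ψ (HG.proj k (graphClass k G)))
    {X : GModC k} (hX : X ∈ gradeGModC k n) : φ X = ψ X :=
  gradeGModC_le k (P := LinearMap.eqLocus φ ψ) h hX

theorem GModC.bracket_degree (p q : ℤ) (X : GModC k) (hX : X ∈ gradeGModC k p) (Y : GModC k)
    (hY : Y ∈ gradeGModC k q) : GModC.bracket k X Y ∈ gradeGModC k (p + q - 1) := by
  refine gradeGModC_le k (P := (gradeGModC k (p + q - 1)).comap ((GModC.bracket k).flip Y)) ?_ hX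
  rintro G hG - rfl
  refine gradeGModC_le k (P := (gradeGModC k (G.degree + q - 1)).comap
    (GModC.bracket k (HG.proj k (graphClass k G)))) ?_ hY
  rintro K hK - rfl
  rw [Submodule.mem_comap, GModC.bracket_graphClass k hG hK]
  exact HG.proj_graphBracket_mem k G K

theorem GModC.bracket_symm (p q : ℤ) (X : GModC k) (hX : X ∈ gradeGModC k p) (Y : GModC k)
    (hY : Y ∈ gradeGModC k q) :
    GModC.bracket k X Y = (p * q).negOnePow • GModC.bracket k Y X := by
  refine GModC.ext_grade k (φ := (GModC.bracket k).flip Y)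
    (ψ := (p * q).negOnePow • GModC.bracket k Y) ?_ hX
  rintro G hG - rfl
  refine GModC.ext_grade k (φ := GModC.bracket k (HG.proj k (graphClass k G)))
    (ψ := (G.degree * q).negOnePow • (GModC.bracket k).flip (HG.proj k (graphClass k G))) ?_ hY
  rintro K hK - rfl
  rw [LinearMap.smul_apply, LinearMap.flip_apply, GModC.bracket_graphClass k hG hK,
    GModC.bracket_graphClass k hK hG, graphBracket_comm, LinearMap.map_smul_of_tower,
    ← Nat.cast_mul, negOnePow_natCast]

theorem GModC.jacobi (p q r : ℤ) (X : GModC k) (hX : X ∈ gradeGModC k p) (Y : GModC k)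
    (hY : Y ∈ gradeGModC k q) (Z : GModC k) (hZ : Z ∈ gradeGModC k r) :
    GModC.bracket k (GModC.bracket k X Y) Z +
      (p * (q + r)).negOnePow • GModC.bracket k (GModC.bracket k Y Z) X +
      (r * (p + q)).negOnePow • GModC.bracket k (GModC.bracket k Z X) Y = 0 := by
  -- The identity is linear in each variable; the three variables are replaced one at a time by
  -- bridgeless connected graphs.
  refine GModC.ext_grade k (φ := (GModC.bracket k).flip Z ∘ₗ (GModC.bracket k).flip Y +
    (p * (q + r)).negOnePow • GModC.bracket k (GModC.bracket k Y Z) +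
    (r * (p + q)).negOnePow • (GModC.bracket k).flip Y ∘ₗ GModC.bracket k Z) (ψ := 0) ?_ hX
  rintro G hG hG' rfl
  refine GModC.ext_grade k (φ := (GModC.bracket k).flip Z ∘ₗ
    GModC.bracket k (HG.proj k (graphClass k G)) +
    (G.degree * (q + r)).negOnePow • (GModC.bracket k).flip (HG.proj k (graphClass k G)) ∘ₗ
      (GModC.bracket k).flip Z +
    (r * (G.degree + q)).negOnePow • GModC.bracket k
      (GModC.bracket k Z (HG.proj k (graphClass k G)))) (ψ := 0) ?_ hY
  rintro K hK hK' rfl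
  refine GModC.ext_grade k (φ :=
    GModC.bracket k (GModC.bracket k (HG.proj k (graphClass k G)) (HG.proj k (graphClass k K))) +
    (G.degree * (K.degree + r)).negOnePow • (GModC.bracket k).flip (HG.proj k (graphClass k G)) ∘ₗ
      GModC.bracket k (HG.proj k (graphClass k K)) +
    (r * (G.degree + K.degree)).negOnePow • (GModC.bracket k).flip (HG.proj k (graphClass k K)) ∘ₗ
      (GModC.bracket k).flip (HG.proj k (graphClass k G))) (ψ := 0) ?_ hZ
  rintro L hL hL' rfl
  simp only [LinearMap.add_apply, LinearMap.smul_apply, LinearMap.comp_apply, LinearMap.flip_apply,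
    LinearMap.zero_apply]
  rw [GModC.bracket_bracket k hG hK hL hG' hK', GModC.bracket_bracket k hK hL hG hK' hL',
    GModC.bracket_bracket k hL hG hK hL' hG']
  simp only [← Nat.cast_add, ← Nat.cast_mul, negOnePow_natCast]
  have key := congrArg (HG.proj k) (HG.jacobi (k := k) G K L)
  rw [map_add, map_add, LinearMap.map_smul_of_tower, LinearMap.map_smul_of_tower, map_zero] at key
  exact key

theorem GModC.cobracket_degree (n : ℤ) (X : GModC k) (hX : X ∈ gradeGModC k n) :
    GModC.cobracket k X ∈ ⨆ a : ℤ, LinearMap.range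
      (TensorProduct.map (gradeGModC k a).subtype (gradeGModC k (n - 1 - a)).subtype) := by
  refine gradeGModC_le k (P := (tensorGrade k (n - 1)).comap (GModC.cobracket k)) ?_ hX
  rintro G hG - rfl
  rw [Submodule.mem_comap, GModC.cobracket_proj k hG, HG.contractions_graphClass]
  simp only [map_sum]
  refine Submodule.smul_mem _ _ (sum_mem fun x _ => sum_mem fun y _ => ?_)
  by_cases hv : G.vert x = G.vert y
  · rw [contr_of_vert_eq hv, map_zero]
    exact zero_mem _
  by_cases hb : y = G.bar x
  · rw [contr_of_eq_bar hb, map_zero]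
    exact zero_mem _
  rw [contr_of_ne hv hb, LinearMap.map_smul_of_tower, HG.projCoproduct_graphClass,
    ← G.degree_contract hv]
  exact units_smul_mem _ (sum_mem fun S _ => HG.proj₂_splitting_mem k _ S)

theorem GModC.cobracket_symm (X : GModC k) :
    koszulSwap (isInternal_gradeGModC k) (GModC.cobracket k X) = GModC.cobracket k X := by
  have h : LinearMap.eqLocus (koszulSwap (isInternal_gradeGModC k) ∘ₗ GModC.cobracket k)
      (GModC.cobracket k) = ⊤ := by
    refine GModC.eq_top k fun G hG _ => ?_
    rw [LinearMap.mem_eqLocus, LinearMap.comp_apply, GModC.cobracket_proj k hG, map_smul,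
      koszulSwap_projCoproduct]
  exact LinearMap.congr_fun (LinearMap.eqLocus_eq_top.1 h) X

end Axioms

/-! ### The coproduct of a bracket -/

namespace OGraph

section

variable (K Y : OGraph) {x : K.H} {y : Y.H} (h : (K.disjUnion Y).vert (inlH K Y x) ≠ (K.disjUnion Y).vert (inrH K Y y))

/-- The set of vertices of a contraction of `K · Y` given by `S` and, if `S` contains the vertex at
which `K` is joined to `Y`, the vertices of `Y`. -/
def extendSet (S : Set K.V) : Set ((K.disjUnion Y).contract (inlH K Y x) (inrH K Y y) h).V :=
  {u | elimV (fun v => v ∈ S) (fun _ => K.vert x ∈ S) (ctrV _ h u)}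

theorem ctrMap_inlV_mem_extendSet {S : Set K.V} {v : K.V} :
    ctrMap _ h (inlV K Y v) ∈ extendSet K Y h S ↔ v ∈ S := by
  rw [extendSet, Set.mem_ofPred_eq, ctrV_ctrMap]
  simp

theorem ctrMap_inrV_mem_extendSet {S : Set K.V} {v : Y.V} :
    ctrMap _ h (inrV K Y v) ∈ extendSet K Y h S ↔ K.vert x ∈ S := by
  rw [extendSet, Set.mem_ofPred_eq, ctrV_ctrMap]
  split_ifs <;> simp

theorem extendSet_injective : Function.Injective (extendSet K Y h) := by
  intro S T hST
  ext v
  rw [← ctrMap_inlV_mem_extendSet K Y h, hST, ctrMap_inlV_mem_extendSet]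

theorem extendSet_compl (S : Set K.V) : extendSet K Y h Sᶜ = (extendSet K Y h S)ᶜ := by
  ext u
  obtain ⟨v, rfl⟩ := ctrMap_surjective _ h u
  revert v
  rw [forall_disjUnionV]
  constructor <;> intro v
  · rw [Set.mem_compl_iff, ctrMap_inlV_mem_extendSet, ctrMap_inlV_mem_extendSet, Set.mem_compl_iff]
  · rw [Set.mem_compl_iff, ctrMap_inrV_mem_extendSet, ctrMap_inrV_mem_extendSet, Set.mem_compl_iff]

theorem isClosed_extendSet {S : Set K.V} :
    IsClosed _ (extendSet K Y h S) ↔ K.IsClosed S := by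
  have hb : inrH K Y y ≠ (K.disjUnion Y).bar (inlH K Y x) := by simp
  rw [contract_isClosed_iff _ h hb (S := extendSet K Y h S)
    (S' := {v | ctrMap _ h v ∈ extendSet K Y h S}) fun v => Iff.rfl]
  simp only [forall_disjUnionH, bar_inlH, bar_inrH, vert_inlH, vert_inrH, ne_eq, inlH_inj,
    inlH_ne_inrH, inrH_ne_inlH, inrH_inj, not_false_eq_true, true_imp_iff, Set.mem_ofPred_eq,
    ctrMap_inlV_mem_extendSet, ctrMap_inrV_mem_extendSet, implies_true, and_true]
  constructor
  · rintro ⟨h1, h2⟩ b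
    by_cases e1 : b = x
    · rw [e1, h2]
    by_cases e2 : b = K.bar x
    · rw [e2, K.bar_bar, h2]
    exact h1 b e1 e2
  · exact fun hS => ⟨fun b _ _ => hS b, (hS x).symm⟩

/-- `Y` stays connected after the edge of `y` is cut, so a closed set contains all of `Y` or none of
it, as decided by the merged vertex. -/
theorem exists_eq_extendSet (hY : Y.IsConnected) (hY' : Y.NoBridge)
    {S : Set ((K.disjUnion Y).contract (inlH K Y x) (inrH K Y y) h).V} (hS : IsClosed _ S) :
    ∃ T, extendSet K Y h T = S := by
  have hb : inrH K Y y ≠ (K.disjUnion Y).bar (inlH K Y x) := by simp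
  rw [contract_isClosed_iff _ h hb (S := S) (S' := {v | ctrMap _ h v ∈ S}) fun v => Iff.rfl] at hS
  simp only [forall_disjUnionH, bar_inlH, bar_inrH, vert_inlH, vert_inrH, ne_eq, inlH_inj,
    inlH_ne_inrH, inrH_ne_inlH, inrH_inj, not_false_eq_true, true_imp_iff, Set.mem_ofPred_eq] at hS
  have hc := hY' y {v | ctrMap _ h (inrV K Y v) ∈ S} hS.1.2
  have hm : ctrMap _ h (inlV K Y (K.vert x)) = ctrMap _ h (inrV K Y (Y.vert y)) := by
    rw [← vert_inlH, ← vert_inrH, ctrMap_left, ctrMap_right]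
  refine ⟨{v | ctrMap _ h (inlV K Y v) ∈ S}, ?_⟩
  ext u
  obtain ⟨v, rfl⟩ := ctrMap_surjective _ h u
  revert v
  rw [forall_disjUnionV]
  constructor <;> intro v
  · rw [ctrMap_inlV_mem_extendSet]
    rfl
  · rw [ctrMap_inrV_mem_extendSet, Set.mem_ofPred_eq, hm]
    exact hc.mem_iff_of_reachable (hY.preconnected _ v)

end

section

variable {K Y : OGraph} {x : K.H} {y : Y.H} (h : (K.disjUnion Y).vert (inlH K Y x) ≠ (K.disjUnion Y).vert (inrH K Y y))
  {S : Set K.V} (hS : K.IsClosed S)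

theorem mem_extendSet_of_mem (hx : K.vert x ∈ S)
    {u : ((K.disjUnion Y).contract (inlH K Y x) (inrH K Y y) h).V} :
    u ∈ extendSet K Y h S ↔ elimV (fun v => v ∈ S) (fun _ => True) (ctrV _ h u) := by
  rw [extendSet, Set.mem_ofPred_eq]
  simp [hx]

theorem mem_extendSet_of_notMem (hx : K.vert x ∉ S)
    {u : ((K.disjUnion Y).contract (inlH K Y x) (inrH K Y y) h).V} :
    u ∈ extendSet K Y h S ↔ ∃ v ∈ S, inlV K Y v = ctrV _ h u := by
  rw [extendSet, Set.mem_ofPred_eq]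
  generalize ctrV _ h u = u
  revert u
  rw [forall_disjUnionV]
  simp [hx]

theorem graphClass_restrict_extendSet_of_notMem (k : Type*) [Field k] (hx : K.vert x ∉ S)
    (hS' : IsClosed _ (extendSet K Y h S)) :
    graphClass k (restrict _ (extendSet K Y h S) hS') = graphClass k (K.restrict S hS) := by
  have hx' : K.vert (K.bar x) ∉ S := fun e => hx ((hS x).1 e)
  have hne : ∀ b, inlH K Y (K.resH hS b) ≠ inlH K Y (K.bar x) := by
    intro b e
    rw [inlH_inj] at e
    exact hx' (e ▸ K.resH_mem hS b)
  refine graphClass_eq k (aV := fun v => ctrV _ h (resV _ hS' v)) (bV := fun v => inlV K Y (resV _ hS v))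
    (aH := fun v => ctrH _ h (resH _ hS' v)) (bH := fun v => inlH K Y (resH _ hS v))
    ((ctrV_strictMono _ h).comp (resV_strictMono _ hS'))
    ((inlV_strictMono K Y).comp (resV_strictMono _ hS))
    ((ctrH_injective _ h).comp (resH_injective _ hS'))
    ((inlH_injective K Y).comp (resH_injective _ hS)) ?_ ?_ ?_ ?_ ?_
  · intro u
    constructor
    · rintro ⟨v, rfl⟩
      obtain ⟨w, hw, e⟩ := (mem_extendSet_of_notMem h hx).1 (resV_mem _ hS' v)
      exact ⟨toResV _ hS w hw, e⟩
    · rintro ⟨v, rfl⟩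
      refine ⟨toResV _ hS' (toCtrV _ h (inlV K Y (resV _ hS v)) (by simp)) ?_, rfl⟩
      exact (mem_extendSet_of_notMem h hx).2 ⟨_, resV_mem _ hS v, rfl⟩
  · intro u
    constructor
    · rintro ⟨v, rfl⟩
      obtain ⟨w, hw, e⟩ := (mem_extendSet_of_notMem h hx).1 (resH_mem _ hS' v)
      rw [ctrV_vert] at e
      revert e
      generalize ctrH _ h (resH _ hS' v) = u
      revert u
      rw [forall_disjUnionH]
      constructor <;> intro b e
      · simp only [vert_inlH, vert_inrH, inlV_ne_inrV, if_false, inlV_inj] at e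
        exact ⟨toResH _ hS b (e ▸ hw), rfl⟩
      · exfalso
        split_ifs at e
        · rw [vert_inlH, inlV_inj] at e
          exact hx (e ▸ hw)
        · simp at e
    · rintro ⟨v, rfl⟩
      have h1 : inlH K Y (resH _ hS v) ≠ inlH K Y x ∧ inlH K Y (resH _ hS v) ≠ inrH K Y y := by
        constructor
        · rw [Ne, inlH_inj]
          rintro e
          exact hx (e ▸ K.resH_mem hS v)
        · simp
      refine ⟨toResH _ hS' (toCtrH _ h (inlH K Y (resH _ hS v)) h1) ?_, rfl⟩
      refine (mem_extendSet_of_notMem h hx).2 ⟨_, resH_mem _ hS v, ?_⟩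
      rw [ctrV_vert, ctrH_toCtrH]
      simp
  · intro a b e
    rw [resH_bar, ctrH_bar, e, resH_bar]
    simp only [bar_inlH, bar_inrH, inlH_ne_inrH, if_false]
    rw [if_neg (hne b)]
  · intro a b e
    rw [resV_vert, ctrV_vert, e, resV_vert]
    simp
  · intro a b e
    rw [restrict_dir, contract_dir, e, restrict_dir]
    simp only [bar_inlH, bar_inrH, inlH_ne_inrH, if_false]
    rw [if_neg (hne b), dir_inlH]

theorem graphClass_restrict_extendSet_of_mem (k : Type*) [Field k] (hx : K.vert x ∈ S)
    (hS' : IsClosed _ (extendSet K Y h S))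
    (h' : ((K.restrict S hS).disjUnion Y).vert (inlH _ Y (K.toResH hS x hx)) ≠
      ((K.restrict S hS).disjUnion Y).vert (inrH _ Y y)) :
    graphClass k (restrict _ (extendSet K Y h S) hS') =
      graphClass k (((K.restrict S hS).disjUnion Y).contract (inlH _ Y (K.toResH hS x hx))
        (inrH _ Y y) h') := by
  have hx' : K.vert (K.bar x) ∈ S := (hS x).2 hx
  -- Both graphs are compared inside `K · Y`; the maps `fV` and `fH` respect the vertex order, the
  -- edges and their directions.
  set fV := elimV (fun v => inlV K Y (K.resV hS v)) (inrV K Y) with hfV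
  set fH := elimH (fun v => inlH K Y (K.resH hS v)) (inrH K Y) with hfH
  have hfV' : StrictMono fV := strictMono_disjUnion ((inlV_strictMono K Y).comp (resV_strictMono _ hS))
    (inrV_strictMono K Y) (fun v w => inlV_lt_inrV _ _ _ _)
  have hfH' : Function.Injective fH := by
    intro a b
    revert a b
    simp [forall_disjUnionH, hfH, (resH_injective _ hS).eq_iff]
  have fbar : ∀ a, fH (((K.restrict S hS).disjUnion Y).bar a) = (K.disjUnion Y).bar (fH a) := by
    simp [forall_disjUnionH, hfH]
  have fdir : ∀ a, (K.disjUnion Y).dir (fH a) = ((K.restrict S hS).disjUnion Y).dir a := by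
    simp [forall_disjUnionH, hfH]
  have fvert : ∀ a, fV (((K.restrict S hS).disjUnion Y).vert a) = (K.disjUnion Y).vert (fH a) := by
    simp [forall_disjUnionH, hfH, hfV]
  have fx : inlH K Y x = fH (inlH _ Y (K.toResH hS x hx)) := by simp [hfH]
  have fy : inrH K Y y = fH (inrH _ Y y) := by simp [hfH]
  have rV : ∀ u, elimV (fun v => v ∈ S) (fun _ => True) u ↔ ∃ v, fV v = u := by
    rw [forall_disjUnionV]
    simp [exists_disjUnionV, hfV, exists_resV]
  have rH : ∀ u, elimV (fun v => v ∈ S) (fun _ => True) ((K.disjUnion Y).vert u) ↔ ∃ v, fH v = u := by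
    rw [forall_disjUnionH]
    simp [exists_disjUnionH, hfH, exists_resH]
  have rx := fvert (inlH _ Y (K.toResH hS x hx))
  have ry := fvert (inrH _ Y y)
  rw [← fx] at rx
  rw [← fy] at ry
  refine graphClass_eq k (aV := fun v => ctrV _ h (resV _ hS' v)) (bV := fun v => fV (ctrV _ h' v))
    (aH := fun v => ctrH _ h (resH _ hS' v)) (bH := fun v => fH (ctrH _ h' v))
    ((ctrV_strictMono _ h).comp (resV_strictMono _ hS'))
    (hfV'.comp (ctrV_strictMono _ h'))
    ((ctrH_injective _ h).comp (resH_injective _ hS'))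
    (hfH'.comp (ctrH_injective _ h')) ?_ ?_ ?_ ?_ ?_
  · intro u
    constructor
    · rintro ⟨v, rfl⟩
      obtain ⟨w, hw⟩ := (rV _).1 ((mem_extendSet_of_mem h hx).1 (resV_mem _ hS' v))
      refine ⟨toCtrV _ h' w ?_, hw⟩
      rintro rfl
      exact ctrV_ne _ h _ (hw.symm.trans ry)
    · rintro ⟨v, rfl⟩
      refine ⟨toResV _ hS' (toCtrV _ h (fV (ctrV _ h' v)) ?_) ?_, rfl⟩
      · rw [← ry]
        exact fun e => ctrV_ne _ h' v (hfV'.injective e)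
      · rw [mem_extendSet_of_mem h hx, ctrV_toCtrV, rV]
        exact ⟨_, rfl⟩
  · intro u
    constructor
    · rintro ⟨v, rfl⟩
      have h1 := (mem_extendSet_of_mem h hx).1 (resH_mem _ hS' v)
      have h2 : elimV (fun v => v ∈ S) (fun _ => True)
          ((K.disjUnion Y).vert (ctrH _ h (resH _ hS' v))) := by
        rw [ctrV_vert] at h1
        split_ifs at h1 with h3
        · rw [h3]
          simp
        · exact h1
      obtain ⟨w, hw⟩ := (rH _).1 h2
      have h3 := ctrH_ne _ h (resH _ hS' v)
      refine ⟨toCtrH _ h' w ⟨?_, ?_⟩, hw⟩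
      · rintro rfl
        exact h3.1 (hw.symm.trans fx.symm)
      · rintro rfl
        exact h3.2 (hw.symm.trans fy.symm)
    · rintro ⟨v, rfl⟩
      have h3 := ctrH_ne _ h' v
      refine ⟨toResH _ hS' (toCtrH _ h (fH (ctrH _ h' v)) ⟨?_, ?_⟩) ?_, rfl⟩
      · rw [fx]
        exact fun e => h3.1 (hfH' e)
      · rw [fy]
        exact fun e => h3.2 (hfH' e)
      · rw [mem_extendSet_of_mem h hx, ctrV_vert, ctrH_toCtrH]
        split_ifs
        · simpa using hx
        · rw [rH]
          exact ⟨_, rfl⟩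
  · intro a b e
    rw [resH_bar, ctrH_bar, e, ctrH_bar, fx, fy, ← fbar, ← fbar, ← fbar]
    simp only [hfH'.eq_iff]
    split_ifs <;> rfl
  · intro a b e
    rw [resV_vert, ctrV_vert, e, ctrV_vert, ← rx, ← ry, ← fvert]
    simp only [hfV'.injective.eq_iff]
    split_ifs <;> rfl
  · intro a b e
    rw [restrict_dir, contract_dir, e, contract_dir, fx, fy, ← fbar, ← fbar, fdir]
    simp only [hfH'.eq_iff]

end

end OGraph

theorem ordSign_map {V W : Type*} [LinearOrder V] [LinearOrder W] {f : V → W} (hf : StrictMono f)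
    (a b : V) : ordSign (f a) (f b) = ordSign a b := by
  simp [ordSign, hf.lt_iff_lt]

namespace OGraph

variable {K Y : OGraph} {x : K.H} {y : Y.H} (h : (K.disjUnion Y).vert (inlH K Y x) ≠ (K.disjUnion Y).vert (inrH K Y y))
  {S : Set K.V}

theorem inlV_ne_vert_inrH (v : K.V) : inlV K Y v ≠ (K.disjUnion Y).vert (inrH K Y y) := by simp

theorem inrV_ne_vert_inrH (v : {v : Y.V // v ≠ Y.vert y}) :
    inrV K Y v ≠ (K.disjUnion Y).vert (inrH K Y y) := by simpa using v.2

/-- The vertices of `K` in a contraction of `K · Y`. -/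
def inlCtrV (v : K.V) : ((K.disjUnion Y).contract (inlH K Y x) (inrH K Y y) h).V :=
  toCtrV _ h (inlV K Y v) (inlV_ne_vert_inrH v)

/-- The vertices of `Y` in a contraction of `K · Y`. -/
def inrCtrV (v : {v : Y.V // v ≠ Y.vert y}) :
    ((K.disjUnion Y).contract (inlH K Y x) (inrH K Y y) h).V :=
  toCtrV _ h (inrV K Y v) (inrV_ne_vert_inrH v)

theorem inlCtrV_strictMono : StrictMono (inlCtrV h) := fun _ _ hab =>
  (ctrV_strictMono _ h).lt_iff_lt.1 (inlV_strictMono K Y hab)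

theorem inrCtrV_injective : Function.Injective (inrCtrV h) := fun _ _ hab =>
  Subtype.ext (inrV_injective K Y (congrArg (ctrV _ h) hab))

theorem inlCtrV_lt_inrCtrV (v : K.V) (w : {v : Y.V // v ≠ Y.vert y}) : inlCtrV h v < inrCtrV h w :=
  (ctrV_strictMono _ h).lt_iff_lt.1 (inlV_lt_inrV K Y v w)

theorem inlCtrV_mem : inlCtrV h v ∈ extendSet K Y h S ↔ v ∈ S := by
  rw [extendSet, Set.mem_ofPred_eq, inlCtrV, ctrV_toCtrV, elimV_inlV]

theorem inrCtrV_mem : inrCtrV h v ∈ extendSet K Y h S ↔ K.vert x ∈ S := by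
  rw [extendSet, Set.mem_ofPred_eq, inrCtrV, ctrV_toCtrV, elimV_inrV]

theorem exists_inlCtrV_or (u) : (∃ v, inlCtrV h v = u) ∨ ∃ v, inrCtrV h v = u := by
  have h1 := ctrV_ne _ h u
  have key : ∀ w, w = ctrV _ h u → (∃ v, inlCtrV h v = u) ∨ ∃ v, inrCtrV h v = u := by
    rw [forall_disjUnionV]
    constructor <;> intro w hw
    · exact Or.inl ⟨w, ctrV_injective _ h hw⟩
    · refine Or.inr ⟨⟨w, ?_⟩, ctrV_injective _ h hw⟩
      rintro rfl
      exact h1 (hw.symm.trans (vert_inrH ..).symm)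
  exact key _ rfl

theorem card_ne_vert (y : Y.H) : Fintype.card {v : Y.V // v ≠ Y.vert y} = Y.degree - 1 := by
  rw [Fintype.card_subtype_compl, Fintype.card_subtype_eq]
  rfl

/-- The vertices of `Y` belong to the complement and come after all vertices of `K`, so they create
no inversions. -/
theorem shuffleSign_extendSet_of_notMem (hS : K.IsClosed S) (hx : K.vert x ∉ S) :
    shuffleSign _ (extendSet K Y h S) = K.shuffleSign S := by
  rw [shuffleSign_eq_res hS, shuffleSign_eq
    (i := fun a => inlCtrV h (K.resV hS a))
    (j := Sum.elim (fun a => inlCtrV h (K.resV hS.compl a)) (inrCtrV h))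
    ((inlCtrV_strictMono h).injective.comp (resV_injective _ hS))
    (Function.Injective.sumElim ((inlCtrV_strictMono h).injective.comp (resV_injective _ _))
      (inrCtrV_injective h) fun a b => (inlCtrV_lt_inrCtrV h _ b).ne)]
  · simp only [Fintype.prod_sum_type, Sum.elim_inl, Sum.elim_inr, ordSign_map (inlCtrV_strictMono h)]
    refine Finset.prod_congr rfl fun a _ => ?_
    exact (congrArg _ (Finset.prod_eq_one fun b _ => if_pos (inlCtrV_lt_inrCtrV h _ b))).trans
      (mul_one _)
  · intro u
    constructor
    · rintro ⟨a, rfl⟩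
      exact (inlCtrV_mem h).2 (K.resV_mem hS a)
    · intro hu
      rcases exists_inlCtrV_or h u with ⟨v, rfl⟩ | ⟨v, rfl⟩
      · exact ⟨K.toResV hS v ((inlCtrV_mem h).1 hu), rfl⟩
      · exact absurd ((inrCtrV_mem h).1 hu) hx
  · intro u
    constructor
    · rintro ⟨a | a, rfl⟩
      · exact mt (inlCtrV_mem h).1 (K.resV_mem hS.compl a)
      · exact mt (inrCtrV_mem h).1 hx
    · intro hu
      rcases exists_inlCtrV_or h u with ⟨v, rfl⟩ | ⟨v, rfl⟩
      · exact ⟨.inl (K.toResV hS.compl v (mt (inlCtrV_mem h).2 hu)), rfl⟩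
      · exact ⟨.inr v, rfl⟩

/-- Each vertex of `Y` has to move past every vertex of `K` outside `S`. Only `Y.degree - 1` of them
remain, since the end of `y` has been merged into `K`. -/
theorem shuffleSign_extendSet_of_mem (hS : K.IsClosed S) (hx : K.vert x ∈ S) :
    shuffleSign _ (extendSet K Y h S) =
      (-1) ^ ((K.restrict Sᶜ hS.compl).degree * (Y.degree - 1)) * K.shuffleSign S := by
  rw [shuffleSign_eq_res hS, shuffleSign_eq
    (i := Sum.elim (fun a => inlCtrV h (K.resV hS a)) (inrCtrV h))
    (j := fun a => inlCtrV h (K.resV hS.compl a))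
    (Function.Injective.sumElim ((inlCtrV_strictMono h).injective.comp (resV_injective _ _))
      (inrCtrV_injective h) fun a b => (inlCtrV_lt_inrCtrV h _ b).ne)
    ((inlCtrV_strictMono h).injective.comp (resV_injective _ _))]
  · simp only [Fintype.prod_sum_type, Sum.elim_inl, Sum.elim_inr, ordSign_map (inlCtrV_strictMono h)]
    rw [mul_comm]
    congr 1
    have h1 : ∀ a b, ordSign (inrCtrV h a) (inlCtrV h (K.resV hS.compl b)) = -1 :=
      fun a b => if_neg (inlCtrV_lt_inrCtrV h _ a).not_gt
    simp only [h1, Finset.prod_const, Finset.card_univ, ← pow_mul, card_ne_vert]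
    rfl
  · intro u
    constructor
    · rintro ⟨a | a, rfl⟩
      · exact (inlCtrV_mem h).2 (K.resV_mem hS a)
      · exact (inrCtrV_mem h).2 hx
    · intro hu
      rcases exists_inlCtrV_or h u with ⟨v, rfl⟩ | ⟨v, rfl⟩
      · exact ⟨.inl (K.toResV hS v ((inlCtrV_mem h).1 hu)), rfl⟩
      · exact ⟨.inr v, rfl⟩
  · intro u
    constructor
    · rintro ⟨a, rfl⟩
      exact mt (inlCtrV_mem h).1 (K.resV_mem hS.compl a)
    · intro hu
      rcases exists_inlCtrV_or h u with ⟨v, rfl⟩ | ⟨v, rfl⟩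
      · exact ⟨K.toResV hS.compl v (mt (inlCtrV_mem h).2 hu), rfl⟩
      · exact absurd ((inrCtrV_mem h).2 hx) hu

theorem sum_resH {G : OGraph} {S : Set G.V} (hS : G.IsClosed S) {M : Type*} [AddCommMonoid M]
    (F : G.H → M) : ∑ a, F a = ∑ a, F (G.resH hS a) + ∑ a, F (G.resH hS.compl a) := by
  rw [← (Equiv.ofBijective _ (bijective_resH hS)).sum_comp, Fintype.sum_sum_type]
  rfl

end OGraph

section Left

open OGraph

universe u

variable (k : Type u) [Field k]

/-- One side of the coproduct of a contraction of `K · Y`, when `S` does not contain the contracted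
vertex. -/
theorem smul_proj₂_splitting_of_notMem (K Y : OGraph) (y : Y.H) {S : Set K.V} (hS : K.IsClosed S)
    (x : (K.restrict Sᶜ hS.compl).H)
    (h : (K.disjUnion Y).vert (inlH K Y (K.resH hS.compl x)) ≠ (K.disjUnion Y).vert (inrH K Y y)) :
    (K.disjUnion Y).contractSign (inlH K Y (K.resH hS.compl x)) (inrH K Y y) •
      HG.proj₂ k (splitting k _ (extendSet K Y h S)) =
    K.shuffleSign S • ((-1 : ℤˣ) ^ (K.restrict S hS).degree •
      HG.proj k (graphClass k (K.restrict S hS))) ⊗ₜ[k]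
        HG.proj k (contr k ((K.restrict Sᶜ hS.compl).disjUnion Y) (inlH _ Y x) (inrH _ Y y)) := by
  have hx : K.vert (K.resH hS.compl x) ∉ S := K.resH_mem hS.compl x
  have h' : ((K.restrict Sᶜ hS.compl).disjUnion Y).vert (inlH _ Y x) ≠
    ((K.restrict Sᶜ hS.compl).disjUnion Y).vert (inrH _ Y y) := by simp
  have hc := (isClosed_extendSet K Y h).2 hS
  have hc' := (isClosed_extendSet K Y h).2 hS.compl
  rw [splitting_of_isClosed k hc, graphClass_restrict_extendSet_of_notMem h hS k hx,
    graphClass_restrict_congr k (extendSet_compl K Y h S).symm hc.compl hc',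
    graphClass_restrict_extendSet_of_mem h hS.compl k hx hc' h', contr_of_ne h' (by simp),
    shuffleSign_extendSet_of_notMem h hS hx, HG.proj₂, LinearMap.map_smul_of_tower,
    LinearMap.map_smul_of_tower, TensorProduct.map_tmul, units_smul_tmul_smul, smul_smul, smul_smul]
  congr 1
  rw [contractSign_eq _ (by simp), contractSign_eq _ (by simp), vert_inrH, vert_inrH, rankSign_inrV,
    rankSign_inrV, dir_inlH, dir_inrH, dir_inlH, dir_inrH, ← K.degree_restrict hS, pow_add,
    restrict_dir]
  ac_rfl

/-- One side of the coproduct of a contraction of `K · Y`, when `S` contains the contracted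
vertex. -/
theorem smul_proj₂_splitting_of_mem (K Y : OGraph) (y : Y.H) {S : Set K.V} (hS : K.IsClosed S)
    (x : (K.restrict S hS).H)
    (h : (K.disjUnion Y).vert (inlH K Y (K.resH hS x)) ≠ (K.disjUnion Y).vert (inrH K Y y)) :
    (K.disjUnion Y).contractSign (inlH K Y (K.resH hS x)) (inrH K Y y) •
      HG.proj₂ k (splitting k _ (extendSet K Y h S)) =
    K.shuffleSign S • 
      HG.proj k (contr k ((K.restrict S hS).disjUnion Y) (inlH _ Y x) (inrH _ Y y)) ⊗ₜ[k]
       ((-1 : ℤˣ) ^ (Y.degree * (K.restrict Sᶜ hS.compl).degree) •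
      HG.proj k (graphClass k (K.restrict Sᶜ hS.compl))) := by
  have hx : K.vert (K.resH hS x) ∈ S := K.resH_mem hS x
  have hx' : K.vert (K.resH hS x) ∉ Sᶜ := not_not_intro hx
  have h' : ((K.restrict S hS).disjUnion Y).vert (inlH _ Y x) ≠
    ((K.restrict S hS).disjUnion Y).vert (inrH _ Y y) := by simp
  have hc := (isClosed_extendSet K Y h).2 hS
  have hc' := (isClosed_extendSet K Y h).2 hS.compl
  rw [splitting_of_isClosed k hc, graphClass_restrict_extendSet_of_mem h hS k hx hc h',
    graphClass_restrict_congr k (extendSet_compl K Y h S).symm hc.compl hc',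
    graphClass_restrict_extendSet_of_notMem h hS.compl k hx', contr_of_ne h' (by simp),
    shuffleSign_extendSet_of_mem h hS hx, HG.proj₂, LinearMap.map_smul_of_tower,
    LinearMap.map_smul_of_tower, TensorProduct.map_tmul, units_smul_tmul_smul, smul_smul, smul_smul]
  congr 1
  have hd : 1 ≤ Y.degree := Fintype.card_pos_iff.2 ⟨Y.vert y⟩
  -- The rank sign in `contractSign` counts the vertices of `K` outside `S` once more than it does
  -- for the part over `S`; this restores the exponent from `Y.degree - 1` to `Y.degree`.
  have e : Y.degree * (K.restrict Sᶜ hS.compl).degree = (K.restrict Sᶜ hS.compl).degree *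
      (Y.degree - 1) + (K.restrict Sᶜ hS.compl).degree := by
    obtain ⟨n, hn⟩ := Nat.exists_eq_add_of_le hd
    rw [hn, Nat.add_sub_cancel_left]
    ring
  rw [contractSign_eq _ (by simp), contractSign_eq _ (by simp), vert_inrH, vert_inrH, rankSign_inrV,
    rankSign_inrV, dir_inlH, dir_inrH, dir_inlH, dir_inrH, ← K.degree_restrict hS, pow_add,
    restrict_dir, e, pow_add]
  have aux : ∀ a b c d e f g : ℤˣ, a * b * (c * d * e) * (f * g) = g * (a * b * (c * e) * (f * d)) := by
    intro a b c d e f g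
    ac_rfl
  exact aux _ _ _ _ _ _ _

/-- A union of components of `K` that avoids the end of `x` is still a union of components after the
contraction. -/
theorem HG.proj_contr_disjUnion_of_not_isConnected {K : OGraph} (hK : ¬ K.IsConnected)
    (Y : OGraph) (x : K.H) (y : Y.H) :
    HG.proj k (contr k (K.disjUnion Y) (inlH K Y x) (inrH K Y y)) = 0 := by
  have h : (K.disjUnion Y).vert (inlH K Y x) ≠ (K.disjUnion Y).vert (inrH K Y y) := by simp
  rw [contr_of_ne h (by simp), LinearMap.map_smul_of_tower, HG.proj_of_not_isConnected, smul_zero]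
  obtain ⟨S, hS, ⟨s, hs⟩, hx⟩ : ∃ S, K.IsClosed S ∧ S.Nonempty ∧ K.vert x ∉ S := by
    rw [isConnected_iff] at hK
    push Not at hK
    obtain ⟨S, hS, hs, hS'⟩ := hK ⟨K.vert x⟩
    by_cases hx : K.vert x ∈ S
    · exact ⟨Sᶜ, hS.compl, Set.nonempty_compl.2 hS', not_not_intro hx⟩
    · exact ⟨S, hS, hs, hx⟩
  intro hc
  have := (isConnected_iff.1 hc).2 _ ((isClosed_extendSet K Y h).2 hS)
    ⟨inlCtrV h s, (inlCtrV_mem h).2 hs⟩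
  exact hx ((inlCtrV_mem h).1 (this.ge (Set.mem_univ (inlCtrV h (K.vert x)))))

/-- Parts occurring in a coproduct may be disconnected; for these both sides vanish. -/
theorem GModC.bracket_graphClass_left (K : OGraph) {Y : OGraph} (hY : Y.IsConnected) :
    GModC.bracket k (HG.proj k (graphClass k K)) (HG.proj k (graphClass k Y)) =
      HG.proj k (graphBracket k K Y) := by
  by_cases hK : K.IsConnected
  · exact GModC.bracket_graphClass k hK hY
  · rw [HG.proj_of_not_isConnected k hK, map_zero, LinearMap.zero_apply, graphBracket_eq, map_sum,
      Finset.sum_eq_zero]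
    intro x _
    rw [map_sum, Finset.sum_eq_zero]
    intro y _
    rw [HG.proj_contr_disjUnion_of_not_isConnected k hK]

theorem bracketTensorLeft_tmul (q : ℤ) (Y : GModC k) {a b : ℤ} {A B : GModC k}
    (hA : A ∈ gradeGModC k a) (hB : B ∈ gradeGModC k b) :
    bracketTensorLeft (isInternal_gradeGModC k) (GModC.bracket k) q Y (A ⊗ₜ[k] B) =
      (a.negOnePow • A) ⊗ₜ[k] GModC.bracket k B Y +
        GModC.bracket k A Y ⊗ₜ[k] ((q * b).negOnePow • B) := by
  rw [bracketTensorLeft, LinearMap.add_apply, TensorProduct.map_tmul, TensorProduct.map_tmul,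
    koszulSign_apply _ _ hA, koszulSign_apply _ _ hB, one_mul]
  rfl

/-- Because `Y` is connected and bridgeless, the splittings of a contraction of `K · Y` are indexed
by those of `K`, and `Y` is attached to the factor that contains `x`. -/
theorem HG.projCoproduct_bracket (K : HG k) {Y : OGraph} (hY : Y.IsConnected) (hY' : Y.NoBridge) :
    HG.projCoproduct k (HG.bracket k K (graphClass k Y)) =
      bracketTensorLeft (isInternal_gradeGModC k) (GModC.bracket k) Y.degree
        (HG.proj k (graphClass k Y)) (HG.projCoproduct k K) := by
  suffices h : HG.projCoproduct k ∘ₗ (HG.bracket k).flip (graphClass k Y) =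
      bracketTensorLeft (isInternal_gradeGModC k) (GModC.bracket k) Y.degree
        (HG.proj k (graphClass k Y)) ∘ₗ HG.projCoproduct k from LinearMap.congr_fun h K
  refine HG.hom_ext fun K => ?_
  rw [LinearMap.comp_apply, LinearMap.comp_apply, LinearMap.flip_apply, HG.bracket_graphClass,
    graphBracket_eq, HG.projCoproduct_graphClass]
  have hne : ∀ x y, (K.disjUnion Y).vert (inlH K Y x) ≠ (K.disjUnion Y).vert (inrH K Y y) := by simp
  have h1 : ∀ x y, HG.projCoproduct k (contr k (K.disjUnion Y) (inlH K Y x) (inrH K Y y)) =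
      ∑ S, (K.disjUnion Y).contractSign (inlH K Y x) (inrH K Y y) •
        HG.proj₂ k (splitting k _ (extendSet K Y (hne x y) S)) := by
    intro x y
    rw [contr_of_ne (hne x y) (by simp), LinearMap.map_smul_of_tower, HG.projCoproduct_graphClass,
      Finset.smul_sum]
    symm
    -- Sets that are not extensions of sets of vertices of `K` are not closed, so their splittings
    -- are zero.
    refine Fintype.sum_of_injective _ (extendSet_injective K Y (hne x y)) _ _ (fun S hS => ?_)
      fun S => rfl
    rw [splitting_of_not_isClosed k, map_zero, smul_zero]
    exact fun hc => hS (exists_eq_extendSet K Y (hne x y) hY hY' hc)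
  simp only [map_sum, h1]
  rw [Finset.sum_congr rfl fun x _ => Finset.sum_comm, Finset.sum_comm]
  refine Finset.sum_congr rfl fun S _ => ?_
  by_cases hS : K.IsClosed S
  -- The half-edge of `K` lies over `S` or over its complement, which gives the two terms of the
  -- derivation rule.
  · rw [sum_resH hS]
    simp only [smul_proj₂_splitting_of_mem k K Y _ hS, smul_proj₂_splitting_of_notMem k K Y _ hS]
    rw [splitting_of_isClosed k hS, HG.proj₂, LinearMap.map_smul_of_tower,
      LinearMap.map_smul_of_tower, TensorProduct.map_tmul,
      bracketTensorLeft_tmul k _ _ (HG.proj_mem_gradeGModC k _) (HG.proj_mem_gradeGModC k _),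
      GModC.bracket_graphClass_left k _ hY, GModC.bracket_graphClass_left k _ hY, ← Nat.cast_mul,
      negOnePow_natCast, negOnePow_natCast, graphBracket_eq, graphBracket_eq]
    simp only [← Finset.smul_sum, ← TensorProduct.tmul_sum, ← TensorProduct.sum_tmul, ← map_sum]
    rw [smul_add, add_comm]
  · rw [splitting_of_not_isClosed k hS, map_zero, map_zero, Finset.sum_eq_zero]
    intro x _
    refine Finset.sum_eq_zero fun y _ => ?_
    rw [splitting_of_not_isClosed k, map_zero, smul_zero]
    rwa [isClosed_extendSet]

end Left

/-! ### Compatibility of the bracket and the cobracket -/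

section Compatible

open OGraph

universe u

variable (k : Type u) [Field k]

theorem HG.contractions_contr (G : OGraph) (x y : G.H) :
    HG.contractions k (contr k G x y) = ∑ z, ∑ w, contr₂ k G x y z w := by
  by_cases hb : y = G.bar x
  · rw [contr_of_eq_bar hb, map_zero]
    symm
    refine Finset.sum_eq_zero fun a _ => Finset.sum_eq_zero fun b _ => ?_
    rw [contr₂, dif_neg]
    simp [CanContract₂, hb]
  by_cases h : G.vert x = G.vert y
  · rw [contr_of_vert_eq h, map_zero]
    symm
    refine Finset.sum_eq_zero fun a _ => Finset.sum_eq_zero fun b _ => ?_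
    rw [contr₂, dif_neg]
    simp [CanContract₂, h]
  rw [contr_of_ne h hb, LinearMap.map_smul_of_tower, HG.contractions_graphClass,
    G.sum_eq_sum_ctrH h, Finset.smul_sum]
  · refine Finset.sum_congr rfl fun a _ => ?_
    rw [G.sum_eq_sum_ctrH h, Finset.smul_sum]
    · exact Finset.sum_congr rfl fun b _ => (contr₂_of h hb a b).symm
    · exact contr₂_eq_zero (by simp)
    · exact contr₂_eq_zero (by simp)
  · exact Finset.sum_eq_zero fun b _ => contr₂_eq_zero (by simp)
  · exact Finset.sum_eq_zero fun b _ => contr₂_eq_zero (by simp)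

/-- The contraction has degree `Y.degree - 1`, which has the parity of `Y.degree + 1`. -/
theorem HG.bracket_contr_comm (X Y : OGraph) (z w : Y.H) :
    HG.bracket k (graphClass k X) (contr k Y z w) =
      ((-1 : ℤˣ) ^ (X.degree * (Y.degree + 1))) •
        HG.bracket k (contr k Y z w) (graphClass k X) := by
  by_cases hb : w = Y.bar z
  · simp [contr_of_eq_bar hb]
  by_cases h : Y.vert z = Y.vert w
  · simp [contr_of_vert_eq h]
  rw [contr_of_ne h hb, LinearMap.map_smul_of_tower, LinearMap.map_smul_of_tower,
    LinearMap.smul_apply, HG.bracket_graphClass, HG.bracket_graphClass, graphBracket_comm X,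
    smul_comm]
  congr 1
  have h1 := Y.degree_contract h
  have h2 : Y.degree + 1 = (Y.contract z w h).degree + 2 := by omega
  rw [h2, mul_add, pow_add, mul_comm X.degree 2, pow_mul]
  simp

theorem HG.bracket_contr_right (X Y : OGraph) (z w : Y.H) :
    ((-1 : ℤˣ) ^ X.degree) • HG.bracket k (graphClass k X) (contr k Y z w) =
      ∑ a, ∑ b, contr₂ k (X.disjUnion Y) (inrH X Y z) (inrH X Y w) (inrH X Y a) (inlH X Y b) := by
  obtain ⟨F, h1, h2, hs⟩ := exists_iso_disjUnion_comm Y X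
  rw [HG.bracket_contr_comm, HG.bracket_contr, smul_smul]
  simp only [← h1, ← h2, contr₂_iso, ← Finset.smul_sum]
  rw [hs, ← pow_add]
  congr 1
  have : X.degree + X.degree * (Y.degree + 1) = Y.degree * X.degree + 2 * X.degree := by ring
  rw [this, pow_add, pow_mul]
  simp

/-- A contraction following one that joins `X` to `Y` takes place within `X`, within `Y`, or between
them. The first two kinds cancel against the contractions done before joining. The third kind is
antisymmetric under exchange of the two pairs and vanishes by `h2`. -/
theorem sum_derivation {T A B M : Type*} [Fintype A] [Fintype B] [AddCommGroup M]
    (h2 : ∀ m : M, m = -m → m = 0)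
    (c : T → T → T → T → M) (h : ∀ x y z w, c x y z w = -c z w x y)
    (hl : ∀ x y z w, c x y z w = c y x z w) (hr : ∀ x y z w, c x y z w = c x y w z)
    (i : A → T) (j : B → T) :
    ∑ x, ∑ y, ((∑ z, (∑ w, c (i x) (j y) (i z) (i w) + ∑ w, c (i x) (j y) (i z) (j w))) +
      ∑ z, (∑ w, c (i x) (j y) (j z) (i w) + ∑ w, c (i x) (j y) (j z) (j w))) +
    ∑ z, ∑ w, ∑ a, ∑ b, c (i z) (i w) (i a) (j b) +
    ∑ z, ∑ w, ∑ a, ∑ b, c (j z) (j w) (j a) (i b) = 0 := by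
  have h1 : ∑ z, ∑ w, ∑ a, ∑ b, c (i z) (i w) (i a) (j b) =
      -∑ x, ∑ y, ∑ z, ∑ w, c (i x) (j y) (i z) (i w) := by
    simp only [← Fintype.sum_prod_type', ← Finset.sum_neg_distrib]
    refine Fintype.sum_equiv ⟨fun p => (p.2.2.1, p.2.2.2, p.1, p.2.1),
      fun p => (p.2.2.1, p.2.2.2, p.1, p.2.1), fun _ => rfl, fun _ => rfl⟩ _ _ ?_
    rintro ⟨z, x, y, a⟩
    exact h _ _ _ _
  have h3 : ∑ z, ∑ w, ∑ a, ∑ b, c (j z) (j w) (j a) (i b) =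
      -∑ x, ∑ y, ∑ z, ∑ w, c (i x) (j y) (j z) (j w) := by
    simp only [← Fintype.sum_prod_type', ← Finset.sum_neg_distrib]
    refine Fintype.sum_equiv ⟨fun p => (p.2.2.2, p.2.2.1, p.1, p.2.1),
      fun p => (p.2.2.1, p.2.2.2, p.2.1, p.1), fun _ => rfl, fun _ => rfl⟩ _ _ ?_
    rintro ⟨z, x, y, a⟩
    exact (h _ _ _ _).trans (congrArg _ (hl _ _ _ _))
  have h4 : ∑ x, ∑ y, ∑ z, ∑ w, c (i x) (j y) (i z) (j w) = 0 := by
    apply h2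
    simp only [← Fintype.sum_prod_type', ← Finset.sum_neg_distrib]
    refine Fintype.sum_equiv ⟨fun p => (p.2.2.1, p.2.2.2, p.1, p.2.1),
      fun p => (p.2.2.1, p.2.2.2, p.1, p.2.1), fun _ => rfl, fun _ => rfl⟩ _ _ ?_
    rintro ⟨z, x, y, a⟩
    exact h _ _ _ _
  have h5 : ∑ x, ∑ y, ∑ z, ∑ w, c (i x) (j y) (j z) (i w) = 0 := by
    rw [← h4]
    refine Finset.sum_congr rfl fun x _ => Finset.sum_congr rfl fun y _ => ?_
    rw [Finset.sum_comm]
    exact Finset.sum_congr rfl fun z _ => Finset.sum_congr rfl fun w _ => hr _ _ _ _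
  simp only [Finset.sum_add_distrib, h1, h3, h4, h5]
  abel

/-- By graded symmetry of the bracket the right rule is the left rule up to a sign that depends only
on `p` and the total degree, so only the left rule has to be proved on graphs. -/
theorem bracketTensorRight_eq {p n : ℤ} {X : GModC k}
    (hs : ∀ q : ℤ, ∀ Y ∈ gradeGModC k q, GModC.bracket k X Y = (p * q).negOnePow • GModC.bracket k Y X)
    {T : GModC k ⊗[k] GModC k} (hT : T ∈ tensorGrade k n) :
    bracketTensorRight (isInternal_gradeGModC k) (GModC.bracket k) p X T =
      (p * n).negOnePow • bracketTensorLeft (isInternal_gradeGModC k) (GModC.bracket k) p X T := by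
  suffices h : tensorGrade k n ≤ LinearMap.eqLocus
      (bracketTensorRight (isInternal_gradeGModC k) (GModC.bracket k) p X)
      ((p * n).negOnePow • bracketTensorLeft (isInternal_gradeGModC k) (GModC.bracket k) p X) from
    h hT
  refine iSup_le fun a => ?_
  rintro _ ⟨T, rfl⟩
  induction T using TensorProduct.induction_on with
  | zero => rw [map_zero]; exact zero_mem _
  | add T T' hT hT' => rw [map_add]; exact add_mem hT hT'
  | tmul A B =>
    obtain ⟨A, hA⟩ := A
    obtain ⟨B, hB⟩ := B
    rw [TensorProduct.map_tmul, LinearMap.mem_eqLocus, LinearMap.smul_apply,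
      Submodule.subtype_apply, Submodule.subtype_apply, bracketTensorLeft_tmul k p X hA hB,
      bracketTensorRight, LinearMap.add_apply, TensorProduct.map_tmul, TensorProduct.map_tmul,
      koszulSign_apply _ _ hA, hs _ _ hA, hs _ _ hB]
    have e1 : ∀ (s : ℤˣ) (x y : GModC k), (s • x) ⊗ₜ[k] y = s • (x ⊗ₜ[k] y) := by
      intro s x y
      simpa using units_smul_tmul_smul (R := k) s 1 x y
    have e2 : ∀ (s : ℤˣ) (x y : GModC k), x ⊗ₜ[k] (s • y) = s • (x ⊗ₜ[k] y) := by
      intro s x y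
      simpa using units_smul_tmul_smul (R := k) 1 s x y
    simp only [LinearMap.id_apply, e1, e2, smul_add, smul_smul]
    rw [add_comm]
    have e3 : ∀ m n : ℤ, Even (m - n) → m.negOnePow = n.negOnePow := fun m n h =>
      (Int.negOnePow_eq_iff m n).2 h
    congr 2
    · rw [← Int.negOnePow_add, ← Int.negOnePow_add]
      exact e3 _ _ ⟨0, by ring⟩
    · rw [← Int.negOnePow_add]
      exact e3 _ _ ⟨p * a - p * n, by ring⟩

theorem HG.projCoproduct_mem (G : OGraph) :
    HG.projCoproduct k (graphClass k G) ∈ tensorGrade k G.degree := by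
  rw [HG.projCoproduct_graphClass]
  exact sum_mem fun S _ => HG.proj₂_splitting_mem k G S

variable [CharZero k]

theorem eq_zero_of_eq_neg {M : Type*} [AddCommGroup M] [Module k M] {m : M} (h : m = -m) :
    m = 0 := by
  have h2 : (2 : k) • m = 0 := by
    rw [two_smul]
    nth_rewrite 1 [h]
    exact neg_add_cancel _
  exact (smul_eq_zero.1 h2).resolve_left two_ne_zero

theorem HG.contractions_bracket (X Y : OGraph) :
    HG.contractions k (HG.bracket k (graphClass k X) (graphClass k Y)) +
      HG.bracket k (HG.contractions k (graphClass k X)) (graphClass k Y) +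
      ((-1 : ℤˣ) ^ X.degree) •
        HG.bracket k (graphClass k X) (HG.contractions k (graphClass k Y)) = 0 := by
  rw [HG.bracket_graphClass, graphBracket_eq, HG.contractions_graphClass,
    HG.contractions_graphClass]
  simp only [map_sum, LinearMap.sum_apply, HG.contractions_contr, HG.bracket_contr,
    Finset.smul_sum, HG.bracket_contr_right, sum_disjUnionH]
  exact sum_derivation (fun _ h => eq_zero_of_eq_neg k h) _ (contr₂_anticomm _) (contr₂_comm_left _)
    (contr₂_comm_right _) (inlH X Y) (inrH X Y)

theorem GModC.cobracket_proj_of_mem {X : HG k} (hX : X ∈ connectedPart k) :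
    GModC.cobracket k (HG.proj k X) =
      (2 : k)⁻¹ • HG.projCoproduct k (HG.contractions k X) := by
  suffices h : connectedPart k ≤ LinearMap.eqLocus (GModC.cobracket k ∘ₗ HG.proj k)
      ((2 : k)⁻¹ • HG.projCoproduct k ∘ₗ HG.contractions k) from h hX
  refine Submodule.span_le.2 ?_
  rintro _ ⟨G, hG, rfl⟩
  exact GModC.cobracket_proj k hG

theorem HG.projCoproduct_bracket_right {X : OGraph} (hX : X.IsConnected) (hX' : X.NoBridge)
    (K : HG k) : HG.projCoproduct k (HG.bracket k (graphClass k X) K) =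
      bracketTensorRight (isInternal_gradeGModC k) (GModC.bracket k) X.degree
        (HG.proj k (graphClass k X)) (HG.projCoproduct k K) := by
  suffices h : HG.projCoproduct k ∘ₗ HG.bracket k (graphClass k X) =
      bracketTensorRight (isInternal_gradeGModC k) (GModC.bracket k) X.degree
        (HG.proj k (graphClass k X)) ∘ₗ HG.projCoproduct k from LinearMap.congr_fun h K
  refine HG.hom_ext fun K => ?_
  rw [LinearMap.comp_apply, LinearMap.comp_apply, bracketTensorRight_eq k
    (fun q Y hY => GModC.bracket_symm k _ _ _
    (HG.proj_mem_gradeGModC k X) _ hY) (HG.projCoproduct_mem k K), ← HG.projCoproduct_bracket k _ hX hX',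
    HG.bracket_graphClass, HG.bracket_graphClass, graphBracket_comm, LinearMap.map_smul_of_tower,
    ← Nat.cast_mul, negOnePow_natCast]

/-- With θ = ½ Δ D, the map Δ takes brackets to the tensor brackets on either side, and the
derivation property of D makes the three terms cancel before Δ is applied. -/
theorem GModC.compatible (p q : ℤ) (X : GModC k) (hX : X ∈ gradeGModC k p) (Y : GModC k)
    (hY : Y ∈ gradeGModC k q) : GModC.cobracket k (GModC.bracket k X Y) +
      bracketTensorLeft (isInternal_gradeGModC k) (GModC.bracket k) q Y (GModC.cobracket k X) +
      p.negOnePow • bracketTensorRight (isInternal_gradeGModC k) (GModC.bracket k) p X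
        (GModC.cobracket k Y) = 0 := by
  -- The right tensor bracket is written out with `TensorProduct.mapBilinear` so that its dependence
  -- on `X` is visibly linear.
  refine GModC.ext_grade k (φ := GModC.cobracket k ∘ₗ (GModC.bracket k).flip Y +
    bracketTensorLeft (isInternal_gradeGModC k) (GModC.bracket k) q Y ∘ₗ GModC.cobracket k +
    p.negOnePow • LinearMap.applyₗ (GModC.cobracket k Y) ∘ₗ
      ((TensorProduct.mapBilinear (RingHom.id k) _ _ _ _).flip LinearMap.id ∘ₗ GModC.bracket k +
        TensorProduct.mapBilinear (RingHom.id k) _ _ _ _ (koszulSign (isInternal_gradeGModC k) (p + 1)) ∘ₗ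
          GModC.bracket k)) (ψ := 0) ?_ hX
  rintro G hG hG' rfl
  refine GModC.ext_grade k (φ := GModC.cobracket k ∘ₗ GModC.bracket k (HG.proj k (graphClass k G)) +
    LinearMap.applyₗ (GModC.cobracket k (HG.proj k (graphClass k G))) ∘ₗ
      (TensorProduct.mapBilinear (RingHom.id k) _ _ _ _ (koszulSign (isInternal_gradeGModC k) 1) ∘ₗ
        (GModC.bracket k).flip +
      (TensorProduct.mapBilinear (RingHom.id k) _ _ _ _).flip (koszulSign (isInternal_gradeGModC k) q) ∘ₗ
        (GModC.bracket k).flip) +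
    (G.degree : ℤ).negOnePow • bracketTensorRight (isInternal_gradeGModC k) (GModC.bracket k)
      G.degree (HG.proj k (graphClass k G)) ∘ₗ GModC.cobracket k) (ψ := 0) ?_ hY
  rintro K hK hK' rfl
  change GModC.cobracket k (GModC.bracket k (HG.proj k (graphClass k G))
      (HG.proj k (graphClass k K))) +
    bracketTensorLeft (isInternal_gradeGModC k) (GModC.bracket k) K.degree
      (HG.proj k (graphClass k K)) (GModC.cobracket k (HG.proj k (graphClass k G))) +
    (G.degree : ℤ).negOnePow • bracketTensorRight (isInternal_gradeGModC k) (GModC.bracket k)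
      G.degree (HG.proj k (graphClass k G)) (GModC.cobracket k (HG.proj k (graphClass k K))) = 0
  rw [GModC.bracket_graphClass k hG hK, GModC.cobracket_proj_of_mem k
    (graphBracket_mem_connectedPart k hG hK hG' hK'), GModC.cobracket_proj k hG,
    GModC.cobracket_proj k hK, map_smul, map_smul, ← HG.projCoproduct_bracket k _ hK hK',
    ← HG.projCoproduct_bracket_right k hG hG', smul_comm, ← smul_add, ← smul_add,
    ← HG.bracket_graphClass, negOnePow_natCast, ← LinearMap.map_smul_of_tower, ← map_add, ← map_add,
    HG.contractions_bracket, map_zero, smul_zero]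

end Compatible

/-! ### Coproducts of disjoint unions -/

namespace OGraph

section

variable (k : Type*) [Field k] {K A : OGraph}

theorem graphClass_restrict_eq {S : Set K.V} (hS : K.IsClosed S) {fV : A.V → K.V} {fH : A.H → K.H}
    (hfV : StrictMono fV) (hfH : Function.Injective fH) (hV : ∀ v, (∃ a, fV a = v) ↔ v ∈ S)
    (hH : ∀ b, K.vert b ∈ S → ∃ a, fH a = b) (hbar : ∀ a, K.bar (fH a) = fH (A.bar a))
    (hvert : ∀ a, K.vert (fH a) = fV (A.vert a)) (hdir : ∀ a, K.dir (fH a) = A.dir a) :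
    graphClass k (K.restrict S hS) = graphClass k A := by
  refine graphClass_eq k (aV := K.resV hS) (bV := fV) (aH := K.resH hS) (bH := fH)
    (resV_strictMono _ hS) hfV (resH_injective _ hS) hfH ?_ ?_ ?_ ?_ ?_
  · intro v
    rw [exists_resV, hV]
  · intro b
    rw [exists_resH]
    refine ⟨hH b, ?_⟩
    rintro ⟨a, rfl⟩
    rw [hvert, ← hV]
    exact ⟨_, rfl⟩
  · intro a b e
    rw [resH_bar, e, hbar]
  · intro a b e
    rw [resV_vert, e, hvert]
  · intro a b e
    rw [restrict_dir, e, hdir]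

theorem isClosed_univ : K.IsClosed Set.univ := fun _ => Iff.rfl

theorem graphClass_restrict_univ (hS : K.IsClosed Set.univ) :
    graphClass k (K.restrict Set.univ hS) = graphClass k K :=
  graphClass_restrict_eq k hS (fV := id) (fH := id) strictMono_id Function.injective_id
    (fun v => ⟨fun _ => Set.mem_univ v, fun _ => ⟨v, rfl⟩⟩) (fun b _ => ⟨b, rfl⟩)
    (fun _ => rfl) (fun _ => rfl) fun _ => rfl

/-- A graph is the disjoint union of two complementary parts. -/
theorem graphClass_eq_shuffleSign_smul {S : Set K.V} (hS : K.IsClosed S) : graphClass k K =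
    K.shuffleSign S • graphClass k ((K.restrict S hS).disjUnion (K.restrict Sᶜ hS.compl)) := by
  have hd : ∀ v w, K.resV hS v ≠ K.resV hS.compl w :=
    fun v w e => resV_mem _ hS.compl w (e ▸ resV_mem _ hS v)
  have hd' : ∀ v w, K.resH hS v ≠ K.resH hS.compl w :=
    fun v w e => resH_mem _ hS.compl w (e ▸ resH_mem _ hS v)
  obtain ⟨F, hV1, hV2, hH1, hH2⟩ := exists_iso_disjUnion (resV_injective _ hS)
    (resV_injective _ hS.compl) hd
    (fun u => by
      rw [exists_resV, exists_resV]
      exact em _)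
    (resH_injective _ hS) (resH_injective _ hS.compl) hd'
    (fun u => by
      rw [exists_resH, exists_resH]
      exact em _)
    (fun v => (resH_bar _ hS v).symm) (fun v => (resH_bar _ hS.compl v).symm)
    (fun v => (resV_vert _ hS v).symm) (fun v => (resV_vert _ hS.compl v).symm)
  rw [graphClass_iso k F, F.sign_disjUnion]
  simp only [hV1, hV2, hH1, hH2]
  rw [vertSign_of_strictMono (resV_strictMono _ hS), vertSign_of_strictMono (resV_strictMono _ hS.compl),
    dirSign_eq_one fun a => (restrict_dir _ hS a).symm,
    dirSign_eq_one fun a => (restrict_dir _ hS.compl a).symm, ← shuffleSign_eq_res, one_mul, one_mul,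
    mul_one]

end

section

variable (L B : OGraph)

/-- The union of a set of vertices of `L` and a set of vertices of `B` in `L · B`. -/
def joinSet (S : Set L.V) (T : Set B.V) : Set (L.disjUnion B).V :=
  {u | elimV (fun v => v ∈ S) (fun v => v ∈ T) u}

variable {L B} {S : Set L.V} {T : Set B.V}

@[simp]
theorem inlV_mem_joinSet {v : L.V} : inlV L B v ∈ joinSet L B S T ↔ v ∈ S := Iff.rfl

@[simp]
theorem inrV_mem_joinSet {v : B.V} : inrV L B v ∈ joinSet L B S T ↔ v ∈ T := Iff.rfl

theorem isClosed_joinSet : IsClosed _ (joinSet L B S T) ↔ L.IsClosed S ∧ B.IsClosed T := by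
  rw [IsClosed, forall_disjUnionH]
  simp [IsClosed]

theorem joinSet_compl : (joinSet L B S T)ᶜ = joinSet L B Sᶜ Tᶜ := by
  ext u
  revert u
  simp [forall_disjUnionV]

theorem sum_joinSet {M : Type*} [AddCommMonoid M] (F : Set (L.disjUnion B).V → M) :
    ∑ U, F U = ∑ S, ∑ T, F (joinSet L B S T) := by
  rw [← Fintype.sum_prod_type']
  refine (Fintype.sum_bijective (fun p : Set L.V × Set B.V => joinSet L B p.1 p.2) ⟨?_, ?_⟩ _ _
    fun _ => rfl).symm
  · rintro ⟨S, T⟩ ⟨S', T'⟩ h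
    have h1 : ∀ u, u ∈ joinSet L B S T ↔ u ∈ joinSet L B S' T' := fun u => by
      rw [show joinSet L B S T = joinSet L B S' T' from h]
    rw [forall_disjUnionV] at h1
    exact Prod.ext (Set.ext h1.1) (Set.ext h1.2)
  · intro U
    refine ⟨({v | inlV L B v ∈ U}, {v | inrV L B v ∈ U}), ?_⟩
    ext u
    revert u
    simp [forall_disjUnionV]

variable (k : Type*) [Field k]

theorem graphClass_restrict_joinSet_univ (hS : L.IsClosed S)
    (h : IsClosed _ (joinSet L B S Set.univ)) :
    graphClass k (restrict _ _ h) = graphClass k ((L.restrict S hS).disjUnion B) := by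
  refine graphClass_restrict_eq k h (fV := elimV (fun v => inlV L B (L.resV hS v)) (inrV L B))
    (fH := elimH (fun v => inlH L B (L.resH hS v)) (inrH L B))
    (strictMono_disjUnion ((inlV_strictMono L B).comp (resV_strictMono _ hS))
      (inrV_strictMono L B) (fun v w => inlV_lt_inrV _ _ _ _)) ?_ ?_ ?_ ?_ ?_ ?_
  · intro a b
    revert a b
    simp [forall_disjUnionH, (resH_injective _ hS).eq_iff]
  · simp [forall_disjUnionV, exists_disjUnionV, exists_resV]
  · simp [forall_disjUnionH, exists_disjUnionH, exists_resH]
  · simp [forall_disjUnionH]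
  · simp [forall_disjUnionH]
  · simp [forall_disjUnionH]

theorem graphClass_restrict_joinSet_empty (hS : L.IsClosed S)
    (h : IsClosed _ (joinSet L B S ∅)) :
    graphClass k (restrict _ _ h) = graphClass k (L.restrict S hS) := by
  refine graphClass_restrict_eq k h (fV := fun v => inlV L B (L.resV hS v))
    (fH := fun v => inlH L B (L.resH hS v))
    ((inlV_strictMono L B).comp (resV_strictMono _ hS))
    ((inlH_injective L B).comp (resH_injective _ hS)) ?_ ?_ ?_ ?_ ?_
  · simp [forall_disjUnionV, exists_resV]
  · simp [forall_disjUnionH, exists_resH]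
  · simp
  · simp
  · simp

theorem graphClass_restrict_joinSet_empty_univ (h : IsClosed _ (joinSet L B ∅ Set.univ)) :
    graphClass k (restrict _ _ h) = graphClass k B := by
  refine graphClass_restrict_eq k h (fV := inrV L B) (fH := inrH L B)
    (inrV_strictMono L B) (inrH_injective L B) ?_ ?_ ?_ ?_ ?_
  · simp [forall_disjUnionV]
  · simp [forall_disjUnionH]
  · simp
  · simp
  · simp

theorem shuffleSign_joinSet_univ (hS : L.IsClosed S) :
    (L.disjUnion B).shuffleSign (joinSet L B S Set.univ) =
      (-1) ^ ((L.restrict Sᶜ hS.compl).degree * B.degree) * L.shuffleSign S := by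
  have h := shuffleSign_eq (G := L.disjUnion B) (S := joinSet L B S Set.univ)
    (i := Sum.elim (fun v => inlV L B (L.resV hS v)) (inrV L B))
    (j := fun v => inlV L B (L.resV hS.compl v))
    (by
      rintro (a | a) (b | b) <;> simp [(resV_injective _ hS).eq_iff])
    ((inlV_injective L B).comp (resV_injective _ hS.compl))
    (by simp [forall_disjUnionV, exists_resV])
    (by simp [forall_disjUnionV, exists_resV])
  rw [h, Fintype.prod_sum_type, shuffleSign_eq_res hS]
  have h1 : ∀ a b, ordSign (inrV L B a) (inlV L B b) = -1 :=
    fun v w => if_neg (inlV_lt_inrV _ _ _ _).not_gt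
  have h2 : ∀ a b, ordSign (inlV L B a) (inlV L B b) = ordSign a b :=
    fun a b => ordSign_map (inlV_strictMono L B) a b
  simp only [Sum.elim_inl, Sum.elim_inr, h1, h2, Finset.prod_const, Finset.card_univ, ← pow_mul]
  rw [mul_comm]
  rfl

theorem shuffleSign_joinSet_empty :
    (L.disjUnion B).shuffleSign (joinSet L B Set.univ ∅) = 1 := by
  have h := shuffleSign_eq (G := L.disjUnion B) (S := joinSet L B Set.univ ∅)
    (inlV_injective L B) (inrV_injective L B)
    (by simp [forall_disjUnionV]) (by simp [forall_disjUnionV])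
  rw [h]
  exact Finset.prod_eq_one fun v _ => Finset.prod_eq_one fun w _ => if_pos (inlV_lt_inrV _ _ _ _)

theorem shuffleSign_empty : L.shuffleSign ∅ = 1 := by
  simp [shuffleSign]

theorem disjUnion_not_isConnected (hL : Nonempty L.V) (hB : Nonempty B.V) :
    ¬ (L.disjUnion B).IsConnected := by
  intro h
  have h1 := h.eq_empty_of_notMem (S := joinSet L B Set.univ ∅) (isClosed_joinSet.2
    ⟨isClosed_univ, isClosed_empty⟩) (inrV_mem_joinSet.not.2 (Set.notMem_empty hB.some))
  exact h1.le (inlV_mem_joinSet.2 (Set.mem_univ hL.some))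

end

end OGraph

section Coproduct

universe u

open OGraph

variable (k : Type u) [Field k]

theorem units_smul_zero {M : Type*} [AddCommGroup M] (u : ℤˣ) : u • (0 : M) = 0 := smul_zero u

theorem units_smul_add {M : Type*} [AddCommGroup M] (u : ℤˣ) (x y : M) :
    u • (x + y) = u • x + u • y := smul_add u x y

theorem units_smul_smul {M : Type*} [AddCommGroup M] (u v : ℤˣ) (x : M) :
    u • v • x = (u * v) • x := smul_smul u v x

theorem units_smul_comm {M : Type*} [AddCommGroup M] [Module k M] (c : k) (u : ℤˣ) (x : M) :
    c • u • x = u • c • x := smul_comm c u x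

theorem map_units_smul {M M' : Type*} [AddCommGroup M] [Module k M] [AddCommGroup M'] [Module k M']
    (f : M →ₗ[k] M') (u : ℤˣ) (x : M) : f (u • x) = u • f x := f.map_smul_of_tower u x

theorem map_sum_sum {M M' ι κ : Type*} [AddCommGroup M] [Module k M] [AddCommGroup M'] [Module k M']
    [Fintype ι] [Fintype κ] (f : M →ₗ[k] M') (F : ι → κ → M) :
    f (∑ i, ∑ j, F i j) = ∑ i, ∑ j, f (F i j) := by
  simp only [map_sum]

theorem HG.proj_disjUnion {L B : OGraph} (hL : Nonempty L.V) (hB : Nonempty B.V) :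
    HG.proj k (graphClass k (L.disjUnion B)) = 0 :=
  HG.proj_of_not_isConnected k (disjUnion_not_isConnected hL hB)

variable {N : Type*} [AddCommGroup N] [Module k N] (φ : HG k →ₗ[k] N) (L B : OGraph)

open Classical in
/-- The splitting of `L · B` into the part of `L` over `S` together with `B`, and the other part of
`L`. -/
noncomputable def adjoinTerm (S : Set L.V) : N ⊗[k] GModC k :=
  if hS : L.IsClosed S then
    ((-1) ^ ((L.restrict Sᶜ hS.compl).degree * B.degree) * L.shuffleSign S) •
      (φ (graphClass k ((L.restrict S hS).disjUnion B)) ⊗ₜ[k]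
        HG.proj k (graphClass k (L.restrict Sᶜ hS.compl)))
  else 0

variable {L B}

theorem map_proj_splitting {G : OGraph} {S : Set G.V} (hS : G.IsClosed S) :
    TensorProduct.map φ (HG.proj k) (splitting k G S) = G.shuffleSign S •
      (φ (graphClass k (G.restrict S hS)) ⊗ₜ[k] HG.proj k (graphClass k (G.restrict Sᶜ hS.compl))) := by
  rw [splitting_of_isClosed k hS, LinearMap.map_smul_of_tower, TensorProduct.map_tmul]

theorem map_proj_splitting_eq_zero {G : OGraph} {S : Set G.V} (hS : G.IsClosed S)
    (h : φ (graphClass k (G.restrict S hS)) = 0 ∨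
      HG.proj k (graphClass k (G.restrict Sᶜ hS.compl)) = 0) :
    TensorProduct.map φ (HG.proj k) (splitting k G S) = 0 := by
  rw [map_proj_splitting k φ hS]
  rcases h with h | h
  · rw [h, TensorProduct.zero_tmul, smul_zero]
  · rw [h, TensorProduct.tmul_zero, smul_zero]

theorem map_proj_splitting_joinSet_univ (S : Set L.V) :
    TensorProduct.map φ (HG.proj k) (splitting k (L.disjUnion B) (joinSet L B S Set.univ)) =
      adjoinTerm k φ L B S := by
  by_cases hS : L.IsClosed S
  · have h : IsClosed _ (joinSet L B S Set.univ) := isClosed_joinSet.2 ⟨hS, isClosed_univ⟩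
    have e : (joinSet L B S Set.univ)ᶜ = joinSet L B Sᶜ ∅ := by rw [joinSet_compl, Set.compl_univ]
    rw [map_proj_splitting k φ h, adjoinTerm, dif_pos hS, graphClass_restrict_joinSet_univ k hS,
      graphClass_restrict_congr k e _ (e ▸ h.compl), graphClass_restrict_joinSet_empty k hS.compl,
      shuffleSign_joinSet_univ hS]
  · rw [adjoinTerm, dif_neg hS, splitting_of_not_isClosed, map_zero]
    exact fun h => hS (isClosed_joinSet.1 h).1

theorem map_proj_splitting_joinSet_empty (hB : Nonempty B.V) {S : Set L.V} (hS : S ≠ Set.univ) :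
    TensorProduct.map φ (HG.proj k) (splitting k (L.disjUnion B) (joinSet L B S ∅)) = 0 := by
  by_cases h : IsClosed _ (joinSet L B S ∅)
  · have e : (joinSet L B S ∅)ᶜ = joinSet L B Sᶜ Set.univ := by rw [joinSet_compl, Set.compl_empty]
    have h1 := (isClosed_joinSet.1 h).1
    obtain ⟨v, hv⟩ := Set.nonempty_compl.2 hS
    rw [map_proj_splitting k φ h, graphClass_restrict_congr k e _ (e ▸ h.compl),
      graphClass_restrict_joinSet_univ k h1.compl, HG.proj_disjUnion k ⟨toResV _ h1.compl v hv⟩ hB,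
      TensorProduct.tmul_zero, smul_zero]
  · rw [splitting_of_not_isClosed k h, map_zero]

theorem map_proj_splitting_joinSet_univ_empty :
    TensorProduct.map φ (HG.proj k) (splitting k (L.disjUnion B) (joinSet L B Set.univ ∅)) =
      φ (graphClass k L) ⊗ₜ[k] HG.proj k (graphClass k B) := by
  have hu : L.IsClosed Set.univ := isClosed_univ
  have h : IsClosed _ (joinSet L B Set.univ ∅) := isClosed_joinSet.2 ⟨hu, isClosed_empty⟩
  have e : (joinSet L B Set.univ ∅)ᶜ = joinSet L B ∅ Set.univ := by
    rw [joinSet_compl, Set.compl_empty, Set.compl_univ]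
  rw [map_proj_splitting k φ h, graphClass_restrict_congr k e _ (e ▸ h.compl),
    graphClass_restrict_joinSet_empty_univ, graphClass_restrict_joinSet_empty k hu,
    graphClass_restrict_univ, shuffleSign_joinSet_empty, one_smul]

/-- The connected graph `B` lies entirely in one factor. If it is in the second, that factor is
disconnected unless all of `L` is in the first. -/
theorem map_proj_coproduct_disjUnion (hB : B.IsConnected) :
    TensorProduct.map φ (HG.proj k) (HG.coproduct k (graphClass k (L.disjUnion B))) =
      φ (graphClass k L) ⊗ₜ[k] HG.proj k (graphClass k B) + ∑ S, adjoinTerm k φ L B S := by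
  have hB' := hB.nonempty
  have h0 : (∅ : Set B.V) ≠ Set.univ := Set.empty_ne_univ
  rw [HG.coproduct_graphClass, cop, map_sum, sum_joinSet]
  have h1 : ∀ S : Set L.V, ∑ T, TensorProduct.map φ (HG.proj k)
      (splitting k (L.disjUnion B) (joinSet L B S T)) = TensorProduct.map φ (HG.proj k)
      (splitting k (L.disjUnion B) (joinSet L B S ∅)) + adjoinTerm k φ L B S := by
    intro S
    rw [← map_proj_splitting_joinSet_univ]
    refine Fintype.sum_eq_add _ _ h0 fun T hT => ?_
    rw [splitting_of_not_isClosed, map_zero]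
    intro h
    exact hT.2 ((isConnected_iff.1 hB).2 T (isClosed_joinSet.1 h).2 (Set.nonempty_iff_ne_empty.2 hT.1))
  simp only [h1, Finset.sum_add_distrib]
  rw [Fintype.sum_eq_single Set.univ, map_proj_splitting_joinSet_univ_empty]
  exact fun S hS => map_proj_splitting_joinSet_empty k φ hB' hS

theorem HG.projCoproduct_disjUnion (hB : B.IsConnected) :
    HG.projCoproduct k (graphClass k (L.disjUnion B)) =
      HG.proj k (graphClass k L) ⊗ₜ[k] HG.proj k (graphClass k B) +
        ((-1 : ℤˣ) ^ (L.degree * B.degree)) •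
          (HG.proj k (graphClass k B) ⊗ₜ[k] HG.proj k (graphClass k L)) := by
  have h0 : L.IsClosed ∅ := isClosed_empty
  have h : IsClosed _ (joinSet L B ∅ Set.univ) := isClosed_joinSet.2 ⟨h0, isClosed_univ⟩
  have hd := L.degree_restrict h0
  have hd0 : (L.restrict ∅ h0).degree = 0 :=
    Fintype.card_eq_zero_iff.2 ⟨fun v => resV_mem _ h0 v⟩
  rw [hd0, zero_add] at hd
  have e : (∅ : Set L.V)ᶜ = Set.univ := Set.compl_empty
  refine (map_proj_coproduct_disjUnion k (HG.proj k) hB).trans ?_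
  -- For nonempty `S` the first factor would contain `B` together with a piece of `L`, hence be
  -- disconnected.
  rw [Fintype.sum_eq_single ∅, adjoinTerm, dif_pos h0, hd, shuffleSign_empty, mul_one,
    graphClass_restrict_congr k e _ isClosed_univ, graphClass_restrict_univ,
    ← graphClass_restrict_joinSet_univ k h0 h, graphClass_restrict_joinSet_empty_univ]
  intro S hS
  obtain ⟨v, hv⟩ := Set.nonempty_iff_ne_empty.2 hS
  rw [adjoinTerm]
  split_ifs with h1
  · rw [HG.proj_disjUnion k ⟨toResV _ h1 v hv⟩ hB.nonempty, TensorProduct.zero_tmul, smul_zero]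
  · rfl

theorem assoc_units_smul {V : Type*} [AddCommGroup V] [Module k V] (u : ℤˣ)
    (x : (V ⊗[k] V) ⊗[k] V) :
    TensorProduct.assoc k V V V (u • x) = u • TensorProduct.assoc k V V V x :=
  LinearMap.map_smul_of_tower (TensorProduct.assoc k V V V).toLinearMap u x

theorem units_smul_tmul {V W : Type*} [AddCommGroup V] [Module k V] [AddCommGroup W] [Module k W]
    (u : ℤˣ) (x : V) (y : W) : (u • x) ⊗ₜ[k] y = u • (x ⊗ₜ[k] y) := by
  have h := units_smul_tmul_smul (R := k) u 1 x y
  rwa [one_smul, mul_one] at h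

theorem tmul_units_smul {V W : Type*} [AddCommGroup V] [Module k V] [AddCommGroup W] [Module k W]
    (u : ℤˣ) (x : V) (y : W) : x ⊗ₜ[k] (u • y) = u • (x ⊗ₜ[k] y) := by
  have h := units_smul_tmul_smul (R := k) 1 u x y
  rwa [one_smul, one_mul] at h

theorem koszulCycle_tmul {V : Type*} [AddCommGroup V] [Module k V] {𝒱 : ℤ → Submodule k V}
    (h : DirectSum.IsInternal 𝒱) {a b c : ℤ} {A B C : V} (hA : A ∈ 𝒱 a) (hB : B ∈ 𝒱 b)
    (hC : C ∈ 𝒱 c) : koszulCycle h (A ⊗ₜ[k] (B ⊗ₜ[k] C)) =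
      (a * (b + c)).negOnePow • (B ⊗ₜ[k] (C ⊗ₜ[k] A)) := by
  simp only [koszulCycle, LinearMap.comp_apply, LinearEquiv.coe_coe, TensorProduct.assoc_symm_tmul,
    TensorProduct.map_tmul, koszulSwap_tmul h hA hB, LinearMap.id_apply]
  rw [units_smul_tmul, assoc_units_smul, LinearMap.map_smul_of_tower, TensorProduct.assoc_tmul,
    TensorProduct.map_tmul, koszulSwap_tmul h hA hC, LinearMap.id_apply, tmul_units_smul, smul_smul,
    mul_add, Int.negOnePow_add]

/-- Splitting `C` off inside the first two positions yields exactly the two nontrivial rotations of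
a tensor that ends in `C`; the signs agree by the Koszul rule. -/
theorem koszulCycle_shuffle {V : Type*} [AddCommGroup V] [Module k V] {𝒱 : ℤ → Submodule k V}
    (h : DirectSum.IsInternal 𝒱) {a b c : ℕ} {A B C : V} (hA : A ∈ 𝒱 a) (hB : B ∈ 𝒱 b)
    (hC : C ∈ 𝒱 c) (s : ℤˣ) :
    TensorProduct.assoc k V V V (((-1) ^ (b * c) * s) •
      ((A ⊗ₜ[k] C + ((-1 : ℤˣ) ^ (a * c)) • (C ⊗ₜ[k] A)) ⊗ₜ[k] B)) =
    koszulCycle h (TensorProduct.assoc k V V V (((-1) ^ (a * b) * s) • (B ⊗ₜ[k] A) ⊗ₜ[k] C)) +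
    koszulCycle h (koszulCycle h (TensorProduct.assoc k V V V (s • (A ⊗ₜ[k] B) ⊗ₜ[k] C))) := by
  rw [TensorProduct.add_tmul, units_smul_add, map_add, units_smul_tmul, units_smul_smul]
  simp only [assoc_units_smul, map_units_smul, TensorProduct.assoc_tmul,
    koszulCycle_tmul k h hB hA hC, koszulCycle_tmul k h hA hB hC, koszulCycle_tmul k h hB hC hA,
    units_smul_smul]
  have h1 : ((b : ℤ) * (a + c)).negOnePow = (-1) ^ (a * b) * (-1) ^ (b * c) := by
    rw [← pow_add, ← negOnePow_natCast]
    push_cast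
    ring_nf
  have h2 : ((a : ℤ) * (b + c)).negOnePow = (-1) ^ (a * b) * (-1) ^ (a * c) := by
    rw [← pow_add, ← negOnePow_natCast]
    push_cast
    ring_nf
  have h3 : ((b : ℤ) * (c + a)).negOnePow = (-1) ^ (a * b) * (-1) ^ (b * c) := by
    rw [← h1, add_comm (c : ℤ)]
  rw [h1, h2, h3]
  generalize (-1 : ℤˣ) ^ (a * b) = p
  generalize (-1 : ℤˣ) ^ (b * c) = q
  generalize (-1 : ℤˣ) ^ (a * c) = r
  have hp : p * p = 1 := Int.units_mul_self p
  congr 2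
  · calc q * s = p * p * (q * s) := by rw [hp, one_mul]
      _ = _ := by ac_rfl
  · calc q * s * r = p * p * (q * s * r) := by rw [hp, one_mul]
      _ = _ := by ac_rfl

theorem koszulCycle_shuffle_zero {V : Type*} [AddCommGroup V] [Module k V]
    {𝒱 : ℤ → Submodule k V} (h : DirectSum.IsInternal 𝒱) (C : V) :
    TensorProduct.assoc k V V V 0 = koszulCycle h (TensorProduct.assoc k V V V (0 ⊗ₜ[k] C)) +
      koszulCycle h (koszulCycle h (TensorProduct.assoc k V V V (0 ⊗ₜ[k] C))) := by
  simp only [map_zero, TensorProduct.zero_tmul, add_zero]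

/-- The sum of the cyclic permutations of a tensor. -/
noncomputable def cyclicSum : GModC k ⊗[k] (GModC k ⊗[k] GModC k) →ₗ[k]
    GModC k ⊗[k] (GModC k ⊗[k] GModC k) :=
  LinearMap.id + koszulCycle (isInternal_gradeGModC k) +
    koszulCycle (isInternal_gradeGModC k) ∘ₗ koszulCycle (isInternal_gradeGModC k)

/-- The projection of the iterated coproduct. -/
noncomputable def HG.projCoproduct₃ : HG k →ₗ[k] GModC k ⊗[k] (GModC k ⊗[k] GModC k) :=
  (TensorProduct.assoc k (GModC k) (GModC k) (GModC k)).toLinearMap ∘ₗ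
    TensorProduct.map (HG.projCoproduct k) (HG.proj k) ∘ₗ HG.coproduct k

theorem assoc_adjoinTerm (hB : B.IsConnected) (S : Set L.V) :
    TensorProduct.assoc k _ _ _ (adjoinTerm k (HG.projCoproduct k) L B S) =
      koszulCycle (isInternal_gradeGModC k) (TensorProduct.assoc k _ _ _
        (HG.proj₂ k (splitting k L Sᶜ) ⊗ₜ[k] HG.proj k (graphClass k B))) +
      koszulCycle (isInternal_gradeGModC k) (koszulCycle (isInternal_gradeGModC k)
        (TensorProduct.assoc k _ _ _
          (HG.proj₂ k (splitting k L S) ⊗ₜ[k] HG.proj k (graphClass k B)))) := by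
  by_cases hS : L.IsClosed S
  · have m1 := HG.proj_mem_gradeGModC k (L.restrict S hS)
    have m2 := HG.proj_mem_gradeGModC k (L.restrict Sᶜ hS.compl)
    have m3 := HG.proj_mem_gradeGModC k B
    rw [adjoinTerm, dif_pos hS, HG.projCoproduct_disjUnion k hB, splitting_of_isClosed k hS,
      splitting_of_isClosed k hS.compl, graphClass_restrict_congr k (compl_compl S) _ hS, HG.proj₂,
      LinearMap.map_smul_of_tower, LinearMap.map_smul_of_tower, TensorProduct.map_tmul,
      TensorProduct.map_tmul, shuffleSign_compl _ hS]
    exact koszulCycle_shuffle k _ m1 m2 m3 _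
  · have hS' : ¬ L.IsClosed Sᶜ := fun h => hS (by simpa using h.compl)
    rw [adjoinTerm, dif_neg hS, splitting_of_not_isClosed k hS, splitting_of_not_isClosed k hS',
      LinearMap.map_zero]
    exact koszulCycle_shuffle_zero k _ _

/-- `B` occupies one of three tensor positions. The last gives the term itself, and the other two
give its rotations by `assoc_adjoinTerm`. -/
theorem HG.projCoproduct₃_disjUnion (hB : B.IsConnected) :
    HG.projCoproduct₃ k (graphClass k (L.disjUnion B)) = cyclicSum k (TensorProduct.assoc k _ _ _
      (HG.projCoproduct k (graphClass k L) ⊗ₜ[k] HG.proj k (graphClass k B))) := by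
  have h := map_proj_coproduct_disjUnion k (L := L) (HG.projCoproduct k) hB
  rw [HG.projCoproduct₃, LinearMap.comp_apply, LinearMap.comp_apply, h, map_add, map_sum]
  have e : ∀ f : GModC k ⊗[k] (GModC k ⊗[k] GModC k) →ₗ[k] GModC k ⊗[k] (GModC k ⊗[k] GModC k),
      f (TensorProduct.assoc k _ _ _ (HG.projCoproduct k (graphClass k L) ⊗ₜ[k]
        HG.proj k (graphClass k B))) = ∑ S, f (TensorProduct.assoc k _ _ _
          (HG.proj₂ k (splitting k L S) ⊗ₜ[k] HG.proj k (graphClass k B))) := by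
    intro f
    rw [HG.projCoproduct_graphClass, TensorProduct.sum_tmul, map_sum, map_sum]
  rw [cyclicSum, LinearMap.add_apply, LinearMap.add_apply, LinearMap.id_apply, LinearMap.comp_apply,
    ← LinearMap.comp_apply (koszulCycle _), e, e, add_assoc]
  refine congrArg₂ _ rfl ?_
  refine (Finset.sum_congr rfl fun S _ => assoc_adjoinTerm k hB S).trans ?_
  rw [Finset.sum_add_distrib]
  refine congrArg₂ _ ?_ rfl
  -- One of the two rotations is indexed by complements, which does not affect the total sum.
  exact (Equiv.ofBijective _ compl_bijective).sum_comp fun S : Set L.V =>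
    koszulCycle (isInternal_gradeGModC k) (TensorProduct.assoc k _ _ _
      (HG.proj₂ k (splitting k L S) ⊗ₜ[k] HG.proj k (graphClass k B)))

variable {G : OGraph}

theorem HG.projCoproduct_eq_zero (hG : ∀ S, G.IsClosed S → S = ∅ ∨ Sᶜ = ∅) :
    HG.projCoproduct k (graphClass k G) = 0 := by
  rw [HG.projCoproduct_graphClass]
  refine Finset.sum_eq_zero fun S _ => HG.proj₂_splitting_eq_zero k fun hS => ?_
  rcases hG S hS with e | e
  · rw [graphClass_restrict_congr k e hS isClosed_empty, HG.proj_restrict_empty]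
    exact Or.inl rfl
  · rw [graphClass_restrict_congr k e hS.compl isClosed_empty, HG.proj_restrict_empty]
    exact Or.inr rfl

theorem HG.projCoproduct₃_eq_zero (hG : ∀ S, G.IsClosed S → S = ∅ ∨ Sᶜ = ∅) :
    HG.projCoproduct₃ k (graphClass k G) = 0 := by
  rw [HG.projCoproduct₃, LinearMap.comp_apply, LinearMap.comp_apply, HG.coproduct_graphClass, cop,
    map_sum, Finset.sum_eq_zero, map_zero]
  intro S _
  by_cases hS : G.IsClosed S
  · refine map_proj_splitting_eq_zero k _ hS ?_
    rcases hG S hS with e | e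
    · rw [graphClass_restrict_congr k e hS isClosed_empty, HG.projCoproduct_eq_zero k
        fun T _ => Or.inl (Set.eq_empty_of_forall_notMem fun v _ => resV_mem _ isClosed_empty v)]
      exact Or.inl rfl
    · rw [graphClass_restrict_congr k e hS.compl isClosed_empty, HG.proj_restrict_empty]
      exact Or.inr rfl
  · rw [splitting_of_not_isClosed k hS, map_zero]

theorem OGraph.IsConnected.eq_empty_or_compl (hG : G.IsConnected) (S : Set G.V)
    (hS : G.IsClosed S) : S = ∅ ∨ Sᶜ = ∅ := by
  by_cases hm : hG.nonempty.some ∈ S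
  · exact Or.inr (hG.eq_empty_of_notMem hS.compl (not_not_intro hm))
  · exact Or.inl (hG.eq_empty_of_notMem hS hm)

/-- A graph all of whose components contain one of two vertices is connected, empty, or the disjoint
union of two connected graphs. -/
theorem OGraph.exists_graphClass_eq_disjUnion {m u : G.V}
    (hG : ∀ S, G.IsClosed S → m ∉ S → u ∉ S → S = ∅) :
    (∀ S, G.IsClosed S → S = ∅ ∨ Sᶜ = ∅) ∨ ∃ (A B : OGraph) (s : ℤˣ), A.IsConnected ∧
      B.IsConnected ∧ graphClass k G = s • graphClass k (A.disjUnion B) := by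
  by_cases h : ∃ S, G.IsClosed S ∧ Xor (m ∈ S) (u ∈ S)
  · obtain ⟨S, hS, hx⟩ := h
    exact Or.inr ⟨_, _, _, restrict_isConnected hG hS hx,
      restrict_isConnected hG hS.compl (xor_compl hx), graphClass_eq_shuffleSign_smul k hS⟩
  · left
    intro S hS
    by_cases hm : m ∈ S
    · have hu : u ∈ S := by
        by_contra hu
        exact h ⟨S, hS, Or.inl ⟨hm, hu⟩⟩
      exact Or.inr (hG _ hS.compl (not_not_intro hm) (not_not_intro hu))
    · have hu : u ∉ S := fun hu => h ⟨S, hS, Or.inr ⟨hu, hm⟩⟩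
      exact Or.inl (hG _ hS hm hu)

/-- The iterated coproduct needs three nonempty parts after projection, but there are at most two
components. -/
theorem HG.projCoproduct₃_eq_zero_of_two {m u : G.V}
    (hG : ∀ S, G.IsClosed S → m ∉ S → u ∉ S → S = ∅) :
    HG.projCoproduct₃ k (graphClass k G) = 0 := by
  rcases OGraph.exists_graphClass_eq_disjUnion k hG with h | ⟨A, B, s, hA, hB, h⟩
  · exact HG.projCoproduct₃_eq_zero k h
  · rw [h, map_units_smul, HG.projCoproduct₃_disjUnion k hB,
      HG.projCoproduct_eq_zero k hA.eq_empty_or_compl, TensorProduct.zero_tmul, map_zero, map_zero,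
      units_smul_zero]

theorem HG.projCoproduct₃_contr_eq_zero {x y : G.H}
    (hG : ∀ S, G.IsClosed S → G.vert x ∉ S → G.vert y ∉ S → S = ∅) :
    HG.projCoproduct₃ k (contr k G x y) = 0 := by
  by_cases hb : y = G.bar x
  · rw [contr_of_eq_bar hb, map_zero]
  by_cases h : G.vert x = G.vert y
  · rw [contr_of_vert_eq h, map_zero]
  rw [contr_of_ne h hb, map_units_smul, HG.projCoproduct₃_eq_zero_of_two k
    fun S hS => hS.eq_empty_of_contract hG hb, units_smul_zero]

theorem HG.projCoproduct₃_contr_inlH (hB : B.IsConnected) (x y : L.H) :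
    HG.projCoproduct₃ k (contr k (L.disjUnion B) (inlH L B x) (inlH L B y)) =
      cyclicSum k (TensorProduct.assoc k _ _ _
        (HG.projCoproduct k (contr k L x y) ⊗ₜ[k] HG.proj k (graphClass k B))) := by
  by_cases hb : y = L.bar x
  · rw [contr_of_eq_bar hb, contr_of_eq_bar (by rw [hb, bar_inlH]), map_zero, map_zero,
      TensorProduct.zero_tmul, map_zero, map_zero]
  by_cases h : L.vert x = L.vert y
  · rw [contr_of_vert_eq h, contr_of_vert_eq (by rw [vert_inlH, vert_inlH, h]), map_zero, map_zero,
      TensorProduct.zero_tmul, map_zero, map_zero]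
  have h' : (L.disjUnion B).vert (inlH L B x) ≠ (L.disjUnion B).vert (inlH L B y) := by simpa
  obtain ⟨F, -, -, hs⟩ := exists_iso_contract_disjUnion L B h h'
  rw [contr_of_ne h hb, contr_of_ne h' (by simpa using hb), contractSign_inlH L B hb,
    graphClass_iso k F, hs, one_smul, map_units_smul, map_units_smul,
    HG.projCoproduct₃_disjUnion k hB, units_smul_tmul, assoc_units_smul,
    map_units_smul]

theorem HG.projCoproduct₃_contr_inlH_inrH {A : OGraph} (hA : A.IsConnected) (hB : B.IsConnected)
    (x : A.H) (y : B.H) :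
    HG.projCoproduct₃ k (contr k (A.disjUnion B) (inlH A B x) (inrH A B y)) = 0 := by
  refine HG.projCoproduct₃_contr_eq_zero k fun S hS hx hy => ?_
  rw [OGraph.IsClosed, forall_disjUnionH] at hS
  have hl := hA.eq_empty_of_notMem (S := {v | inlV A B v ∈ S}) (fun a => hS.1 a) (m := A.vert x) hx
  have hr := hB.eq_empty_of_notMem (S := {v | inrV A B v ∈ S}) (fun a => hS.2 a) (m := B.vert y) hy
  refine Set.eq_empty_of_forall_notMem ?_
  rw [forall_disjUnionV]
  exact ⟨fun v hv => hl.le hv, fun v hv => hr.le hv⟩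

/-- Contractions within `A` or within `B` leave the other factor untouched. A contraction between
`A` and `B` has at most two components and contributes nothing. -/
theorem HG.projCoproduct₃_contractions_disjUnion {A : OGraph} (hA : A.IsConnected)
    (hB : B.IsConnected) :
    HG.projCoproduct₃ k (HG.contractions k (graphClass k (A.disjUnion B))) =
      cyclicSum k (TensorProduct.assoc k _ _ _
        (HG.projCoproduct k (HG.contractions k (graphClass k A)) ⊗ₜ[k]
          HG.proj k (graphClass k B))) +
      ((-1 : ℤˣ) ^ (A.degree * B.degree)) • cyclicSum k (TensorProduct.assoc k _ _ _
        (HG.projCoproduct k (HG.contractions k (graphClass k B)) ⊗ₜ[k]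
          HG.proj k (graphClass k A))) := by
  obtain ⟨F, h1, h2, hs⟩ := exists_iso_disjUnion_comm B A
  have hr : ∀ x y, HG.projCoproduct₃ k (contr k (A.disjUnion B) (inrH A B x) (inrH A B y)) =
      ((-1 : ℤˣ) ^ (A.degree * B.degree)) • cyclicSum k (TensorProduct.assoc k _ _ _
        (HG.projCoproduct k (contr k B x y) ⊗ₜ[k] HG.proj k (graphClass k A))) := by
    intro x y
    rw [← h1, ← h1, contr_iso, map_units_smul, HG.projCoproduct₃_contr_inlH k hA, hs,
      mul_comm]
  have hm : ∀ x y, HG.projCoproduct₃ k (contr k (A.disjUnion B) (inrH A B x) (inlH A B y)) = 0 := by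
    intro x y
    rw [contr_comm]
    exact HG.projCoproduct₃_contr_inlH_inrH k hA hB y x
  have hl : ∀ {X : OGraph} (Y : GModC k), cyclicSum k (TensorProduct.assoc k _ _ _
      (HG.projCoproduct k (HG.contractions k (graphClass k X)) ⊗ₜ[k] Y)) =
      ∑ x, ∑ y, cyclicSum k (TensorProduct.assoc k _ _ _
        (HG.projCoproduct k (contr k X x y) ⊗ₜ[k] Y)) := by
    intro X Y
    rw [HG.contractions_graphClass]
    exact map_sum_sum k (cyclicSum k ∘ₗ (TensorProduct.assoc k _ _ _).toLinearMap ∘ₗ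
      (TensorProduct.mk k _ _).flip Y ∘ₗ HG.projCoproduct k) _
  rw [HG.contractions_graphClass, map_sum_sum, sum_disjUnionH, hl, hl, Finset.smul_sum]
  refine congrArg₂ _ (Finset.sum_congr rfl fun x _ => ?_) (Finset.sum_congr rfl fun x _ => ?_)
  · rw [sum_disjUnionH, Finset.sum_eq_zero (s := (Finset.univ : Finset B.H)) fun y _ =>
      HG.projCoproduct₃_contr_inlH_inrH k hA hB x y, add_zero]
    exact Finset.sum_congr rfl fun y _ => HG.projCoproduct₃_contr_inlH k hB x y
  · rw [sum_disjUnionH, Finset.sum_eq_zero (s := (Finset.univ : Finset A.H)) fun y _ => hm x y,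
      zero_add, Finset.smul_sum]
    exact Finset.sum_congr rfl fun y _ => hr x y

end Coproduct

/-! ### The co-Jacobi identity -/

section CoJacobi

open OGraph

universe u

variable (k : Type u) [Field k] [CharZero k]

/-- The cobracket applied to the first factor of a tensor. -/
noncomputable def GModC.cobracketLeft :
    GModC k ⊗[k] GModC k →ₗ[k] GModC k ⊗[k] (GModC k ⊗[k] GModC k) :=
  (TensorProduct.assoc k (GModC k) (GModC k) (GModC k)).toLinearMap ∘ₗ
    TensorProduct.map (GModC.cobracket k) LinearMap.id

theorem cyclicSum_cobracketLeft {A : OGraph} (hA : A.IsConnected) (Y : GModC k) :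
    cyclicSum k (GModC.cobracketLeft k (HG.proj k (graphClass k A) ⊗ₜ[k] Y)) =
      (2 : k)⁻¹ • cyclicSum k (TensorProduct.assoc k _ _ _
        (HG.projCoproduct k (HG.contractions k (graphClass k A)) ⊗ₜ[k] Y)) := by
  rw [GModC.cobracketLeft, LinearMap.comp_apply, TensorProduct.map_tmul, GModC.cobracket_proj k hA,
    LinearMap.id_apply, LinearEquiv.coe_coe, ← TensorProduct.smul_tmul', map_smul, map_smul]

/-- For a graph `A · B` both sides are the cyclic sum of θ(A) ⊗ B and ± θ(B) ⊗ A. If there is no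
nontrivial splitting, every contraction again has at most two components and both sides vanish. -/
theorem cyclicSum_cobracketLeft_projCoproduct {G : OGraph} {m u : G.V}
    (hG : ∀ S, G.IsClosed S → m ∉ S → u ∉ S → S = ∅) :
    cyclicSum k (GModC.cobracketLeft k (HG.projCoproduct k (graphClass k G))) =
      (2 : k)⁻¹ • HG.projCoproduct₃ k (HG.contractions k (graphClass k G)) := by
  rcases OGraph.exists_graphClass_eq_disjUnion k hG with h | ⟨A, B, s, hA, hB, h⟩
  · rw [HG.projCoproduct_eq_zero k h, map_zero, map_zero, HG.contractions_graphClass]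
    rw [map_sum_sum, Finset.sum_eq_zero, smul_zero]
    refine fun x _ => Finset.sum_eq_zero fun y _ => HG.projCoproduct₃_contr_eq_zero k ?_
    intro S hS hx _
    refine (h S hS).resolve_right fun e => ?_
    exact e.le (show G.vert x ∈ Sᶜ from hx)
  · rw [h, map_units_smul, map_units_smul, map_units_smul, map_units_smul, map_units_smul,
      HG.projCoproduct₃_contractions_disjUnion k hA hB, HG.projCoproduct_disjUnion k hB,
      units_smul_comm, map_add, map_add, map_units_smul, map_units_smul,
      cyclicSum_cobracketLeft k hA, cyclicSum_cobracketLeft k hB]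
    refine congrArg (s • ·) ?_
    rw [smul_add, units_smul_comm]

theorem sum_anticomm {T M : Type*} [Fintype T] [AddCommGroup M] (c : T → T → T → T → M)
    (h : ∀ x y z w, c x y z w = -c z w x y) :
    ∑ x, ∑ y, ∑ z, ∑ w, c x y z w = -∑ x, ∑ y, ∑ z, ∑ w, c x y z w := by
  simp only [← Fintype.sum_prod_type', ← Finset.sum_neg_distrib]
  refine Fintype.sum_equiv ⟨fun p => (p.2.2.1, p.2.2.2, p.1, p.2.1),
    fun p => (p.2.2.1, p.2.2.2, p.1, p.2.1), fun _ => rfl, fun _ => rfl⟩ _ _ ?_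
  rintro ⟨x, y, z, w⟩
  exact h _ _ _ _

/-- Exchanging the two pairs shows that the sum is its own negative, and the characteristic is zero.
-/
theorem HG.contractions_contractions (X : HG k) :
    HG.contractions k (HG.contractions k X) = 0 := by
  suffices h : HG.contractions k ∘ₗ HG.contractions k = 0 from LinearMap.congr_fun h X
  refine HG.hom_ext fun G => eq_zero_of_eq_neg k ?_
  rw [LinearMap.comp_apply, HG.contractions_graphClass]
  rw [map_sum_sum]
  simp only [HG.contractions_contr]
  exact sum_anticomm _ (contr₂_anticomm G)

/-- The preceding identity applies to each contraction of a connected graph, since every component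
contains the merged vertex or the new edge. The result is ¼ Δ₃ D², which vanishes. -/
theorem cyclicSum_cobracketLeft_cobracket (X : GModC k) :
    cyclicSum k (GModC.cobracketLeft k (GModC.cobracket k X)) = 0 := by
  suffices h : LinearMap.ker (cyclicSum k ∘ₗ GModC.cobracketLeft k ∘ₗ GModC.cobracket k) = ⊤ from
    h.ge Submodule.mem_top
  refine GModC.eq_top k fun G hG _ => ?_
  have key : ∀ x y, cyclicSum k (GModC.cobracketLeft k (HG.projCoproduct k (contr k G x y))) =
      (2 : k)⁻¹ • HG.projCoproduct₃ k (HG.contractions k (contr k G x y)) := by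
    intro x y
    by_cases hb : y = G.bar x
    · simp only [contr_of_eq_bar hb, map_zero, smul_zero]
    by_cases h : G.vert x = G.vert y
    · simp only [contr_of_vert_eq h, map_zero, smul_zero]
    rw [contr_of_ne h hb, map_units_smul, map_units_smul, map_units_smul, map_units_smul,
      map_units_smul, cyclicSum_cobracketLeft_projCoproduct k fun S hS =>
      eq_empty_of_isClosed_contract hG hb hS, units_smul_comm]
  have hz := HG.contractions_contractions k (graphClass k G)
  rw [HG.contractions_graphClass] at hz
  have h1 := map_sum_sum k (cyclicSum k ∘ₗ GModC.cobracketLeft k ∘ₗ HG.projCoproduct k)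
    (contr k G)
  have h2 := map_sum_sum k ((2 : k)⁻¹ • HG.projCoproduct₃ k ∘ₗ HG.contractions k) (contr k G)
  have h3 : (cyclicSum k ∘ₗ GModC.cobracketLeft k ∘ₗ HG.projCoproduct k)
      (∑ x, ∑ y, contr k G x y) = 0 := by
    refine (h1.trans (Finset.sum_congr rfl fun x _ => Finset.sum_congr rfl fun y _ =>
      key x y)).trans (h2.symm.trans ?_)
    rw [LinearMap.smul_apply, LinearMap.comp_apply, hz, map_zero, smul_zero]
  rw [LinearMap.mem_ker, LinearMap.comp_apply, LinearMap.comp_apply, GModC.cobracket_proj k hG,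
    HG.contractions_graphClass, map_smul, map_smul]
  exact (congrArg _ h3).trans (smul_zero _)

theorem GModC.cojacobi (X : GModC k) :
    let T := TensorProduct.assoc k (GModC k) (GModC k) (GModC k)
      (TensorProduct.map (GModC.cobracket k) LinearMap.id (GModC.cobracket k X))
    T + koszulCycle (isInternal_gradeGModC k) T +
      koszulCycle (isInternal_gradeGModC k) (koszulCycle (isInternal_gradeGModC k) T) = 0 :=
  cyclicSum_cobracketLeft_cobracket k X

end CoJacobi

theorem theorem2 {k : Type*} [Field k] [CharZero k] :
    ∃ (B : HG k →ₗ[k] HG k →ₗ[k] HG k) (Θ : HG k →ₗ[k] HG k ⊗[k] HG k)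
      (b : GModC k →ₗ[k] GModC k →ₗ[k] GModC k) (t : GModC k →ₗ[k] GModC k ⊗[k] GModC k),
      IsHGBracket B ∧ IsHGCobracket Θ ∧
      Function.Injective (inclGModC k) ∧
      (∀ X Y : connectedPart k,
        inclGModC k (b (toGModC k X) (toGModC k Y)) = (cutPart k).mkQ (B X Y)) ∧
      (∀ X : connectedPart k,
        TensorProduct.map (inclGModC k) (inclGModC k) (t (toGModC k X)) =
          TensorProduct.map (cutPart k).mkQ (cutPart k).mkQ (Θ X)) ∧
      IsGradedLieBialgebra (gradeGModC k) b t :=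
  ⟨HG.bracket k, HG.cobracket k, GModC.bracket k, GModC.cobracket k, HG.bracket_graphClass,
    HG.cobracket_graphClass k, inclGModC_injective k, inclGModC_bracket k,
    map_inclGModC_cobracket k,
    { internal := isInternal_gradeGModC k
      bracket_degree := GModC.bracket_degree k
      bracket_symm := GModC.bracket_symm k
      jacobi := GModC.jacobi k
      cobracket_degree := GModC.cobracket_degree k
      cobracket_symm := GModC.cobracket_symm k
      cojacobi := GModC.cojacobi k
      compatible := GModC.compatible k }⟩
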